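/- Work in ZFC. For a cardinal $\theta$ let $H(\theta)$ be the set of all sets whose transitive closure has size less than $\theta$. A *weak $\kappa$-model* is a (not necessarily transitive) set $M$ of size $\kappa$ with $\kappa+1\subseteq M$ and $\langle M,\in\rangle\models\mathsf{ZFC}^-$, that is, ZFC without the powerset axiom, with the collection scheme in place of replacement and with choice in the form that every set can be well-ordered; it is a *$\kappa$-model* if moreover $M^{<\kappa}\subseteq M$. An elementary embedding $j\colon M\to N$ of a weak $\kappa$-model $M$ into a transitive set $N$ is *$\kappa$-powerset preserving* if it has critical point $\kappa$ and $M$ and $N$ have the same subsets of $\kappa$. A cardinal $\kappa$ is *super Ramsey* (respectively *super weakly Ramsey*) if every $A\subseteq\kappa$ is an element of some $\kappa$-model (respectively weak $\kappa$-model) $M\prec H(\kappa^+)$ for which there is a $\kappa$-powerset preserving elementary embedding $j\colon M\to N$. For regular (infinite) cardinals $\alpha\le\kappa$, $\kappa$ is *$\alpha$-Ramsey* if for arbitrarily large regular cardinals $\theta$, every $A\subseteq\kappa$ is an element of some weak $\kappa$-model $M\prec H(\theta)$ which is closed under ${<}\alpha$-sequences and for which there is a $\kappa$-powerset preserving elementary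 embedding $j\colon M\to N$. **Proposition 5.2.** (1) If $\kappa$ is $\kappa$-Ramsey, then $\kappa$ is super Ramsey and a limit of super Ramsey cardinals, i.e. for every cardinal $\mu<\kappa$ there is a super Ramsey cardinal $\nu$ with $\mu<\nu<\kappa$. (2) If $\kappa$ is $\omega$-Ramsey, then $\kappa$ is super weakly Ramsey and a limit of super weakly Ramsey cardinals. -/

import Mathlib

universe u

namespace RamseyLike

open FirstOrder

/-! ### The language of set theory, and sets of sets as structures for it -/

/-- The only symbol of the language of set theory: the binary membership relation. -/
inductive MemRel : ℕ → Type
  | mem : MemRel 2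

/-- The first-order language of set theory, with one binary relation symbol. -/
def setLang : FirstOrder.Language.{0, 0} := ⟨fun _ => Empty, MemRel⟩

/-- A set (or class) of sets is a structure for the language of set theory, in which the relation
symbol is interpreted as the true membership relation. In particular every `M : ZFSet` gives the
structure `⟨M, ∈⟩`. -/
instance memStructure (p : ZFSet.{u} → Prop) : setLang.Structure {x : ZFSet.{u} // p x} where
  funMap := fun f => Empty.elim f
  RelMap := fun {_} r => match r with
    | MemRel.mem => fun v => (v 0).1 ∈ (v 1).1

/-! ### The theory ZFC without the powerset axiom -/

section ZFCMinus

variable {X : Type*} [setLang.Structure X]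

/-- The interpretation of the membership symbol in a structure. -/
def Mem (x y : X) : Prop := FirstOrder.Language.Structure.RelMap (L := setLang) MemRel.mem ![x, y]

/-- In the structure `X`, `d` is the unordered pair of `x` and `y`. -/
def IsUPair (d x y : X) : Prop := ∀ z : X, Mem z d ↔ z = x ∨ z = y

/-- In the structure `X`, `p` is the (Kuratowski) ordered pair of `x` and `y`. -/
def IsOPair (p x y : X) : Prop := ∃ s d : X, IsUPair s x x ∧ IsUPair d x y ∧ IsUPair p s d

/-- In the structure `X`, the ordered pair of `x` and `y` is an element of `r`. -/
def Rel (r x y : X) : Prop := ∃ p : X, IsOPair p x y ∧ Mem p r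

variable (X) in
/-- `X ⊨ ZFC⁻`: the structure `X` satisfies ZFC without the powerset axiom, with the scheme of
collection rather than replacement, and choice as the principle that every set can be
well-ordered. The two schemes range over all first-order formulas with parameters. -/
structure ModelsZFCMinus : Prop where
  extensionality : ∀ a b : X, (∀ z, Mem z a ↔ Mem z b) → a = b
  foundation : ∀ a : X, (∃ x, Mem x a) → ∃ x, Mem x a ∧ ∀ y, Mem y x → ¬ Mem y a
  pairing : ∀ a b : X, ∃ d, IsUPair d a b
  union : ∀ a : X, ∃ b, ∀ x, Mem x b ↔ ∃ y, Mem y a ∧ Mem x y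
  infinity : ∃ w : X, (∃ e, Mem e w ∧ ∀ z, ¬ Mem z e) ∧
    ∀ x, Mem x w → ∃ y, Mem y w ∧ ∀ z, Mem z y ↔ Mem z x ∨ z = x
  separation : ∀ (n : ℕ) (φ : setLang.Formula (Fin (n + 1))) (p : Fin n → X) (a : X),
    ∃ b : X, ∀ x, Mem x b ↔ Mem x a ∧ φ.Realize (Fin.cons x p : Fin (n + 1) → X)
  collection : ∀ (n : ℕ) (φ : setLang.Formula (Fin (n + 2))) (p : Fin n → X) (a : X),
    (∀ x, Mem x a → ∃ y : X, φ.Realize (Fin.cons x (Fin.cons y p) : Fin (n + 2) → X)) →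
    ∃ b : X, ∀ x, Mem x a →
      ∃ y, Mem y b ∧ φ.Realize (Fin.cons x (Fin.cons y p) : Fin (n + 2) → X)
  wellOrdering : ∀ a : X, ∃ r : X,
    (∀ x, Mem x a → ¬ Rel r x x) ∧
    (∀ x y z, Mem x a → Mem y a → Mem z a → Rel r x y → Rel r y z → Rel r x z) ∧
    (∀ x y, Mem x a → Mem y a → Rel r x y ∨ x = y ∨ Rel r y x) ∧
    ∀ b : X, (∀ x, Mem x b → Mem x a) → (∃ x, Mem x b) →
      ∃ x, Mem x b ∧ ∀ y, Mem y b → y ≠ x → Rel r x y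

end ZFCMinus

/-! ### The sets `H(θ)` and elementary substructures -/

/-- The von Neumann cardinal (the initial ordinal of `κ`) as a set. -/
noncomputable def cardSet (κ : Cardinal.{u}) : ZFSet.{u} := κ.ord.toZFSet

/-- `H(θ)`, the set of all sets whose transitive closure has size less than `θ`, that is, of all
sets which are included in a transitive set of size less than `θ`. All of them lie in `V_θ`, see
`mem_H`. -/
noncomputable def H (θ : Cardinal.{u}) : ZFSet.{u} :=
  ZFSet.sep (fun x => ∃ t : ZFSet.{u}, t.IsTransitive ∧ x ⊆ t ∧ t.card < θ)
    (ZFSet.vonNeumann θ.ord)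

/-- The rank of a transitive set of size less than `θ` is less than `θ`. -/
theorem rank_lt_of_card_lt {θ : Cardinal.{u}} {t : ZFSet.{u}} (ht : t.IsTransitive)
    (hc : t.card < θ) : t.rank < θ.ord := by
  have key : ∀ (n : Ordinal.{u}) (y : ZFSet.{u}), y.rank = n → (y ∈ t ∨ y = t) →
      ∀ a < y.rank, ∃ z ∈ t, z.rank = a := by
    intro n
    induction n using WellFoundedLT.induction with
    | ind n ih =>
      intro y hy hyt a ha
      obtain ⟨z, hz, haz⟩ := ZFSet.lt_rank_iff.1 ha
      have hzt : z ∈ t := by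
        rcases hyt with h | h
        · exact ht y h hz
        · exact h ▸ hz
      rcases haz.lt_or_eq with h | h
      · exact ih z.rank (hy ▸ ZFSet.rank_lt_of_mem hz) z rfl (Or.inl hzt) a h
      · exact ⟨z, hzt, h.symm⟩
  have hsub : Set.Iio t.rank ⊆ ZFSet.rank '' (t : Set ZFSet.{u}) := by
    intro a ha
    obtain ⟨z, hz, h⟩ := key _ t rfl (Or.inr rfl) a ha
    exact ⟨z, hz, h⟩
  have h1 := (Cardinal.mk_le_mk_of_subset hsub).trans Cardinal.mk_image_le
  rw [Cardinal.mk_Iio_ordinal] at h1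
  have h2 : Cardinal.lift.{u + 1} t.rank.card ≤ Cardinal.lift.{u + 1} t.card :=
    h1.trans_eq ZFSet.cardinalMk_coe_sort
  exact Cardinal.lt_ord.2 ((Cardinal.lift_le.1 h2).trans_lt hc)

theorem mem_H {θ : Cardinal.{u}} {x : ZFSet.{u}} :
    x ∈ H θ ↔ ∃ t : ZFSet.{u}, t.IsTransitive ∧ x ⊆ t ∧ t.card < θ := by
  rw [H, ZFSet.mem_sep, ZFSet.mem_vonNeumann]
  refine ⟨fun h => h.2, fun h => ⟨?_, h⟩⟩
  obtain ⟨t, ht, hx, hc⟩ := h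
  exact (ZFSet.rank_mono hx).trans_lt (rank_lt_of_card_lt ht hc)

/-- `M ≺ K`: the structure `⟨M, ∈⟩` is an elementary substructure of `⟨K, ∈⟩`, that is, `M ⊆ K`
and the inclusion is an elementary embedding. -/
def ElemSub (M K : ZFSet.{u}) : Prop := ∃ i : M ↪ₑ[setLang] K, ∀ x : M, (i x : ZFSet.{u}) = x

/-! ### Weak `κ`-models and powerset preserving embeddings -/

/-- A weak `κ`-model is a set `M` of size `κ` with `κ + 1 ⊆ M` and `⟨M, ∈⟩ ⊨ ZFC⁻`. It need not be
transitive. -/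
structure IsWeakModel (κ : Cardinal.{u}) (M : ZFSet.{u}) : Prop where
  card_eq : M.card = κ
  subset : cardSet κ ⊆ M
  mem : cardSet κ ∈ M
  models : ModelsZFCMinus M

/-- `M` is closed under `<α`-sequences: every function (as a set of ordered pairs) from an ordinal
below `α` to `M` is an element of `M`. -/
def ClosedUnderSeq (α : Cardinal.{u}) (M : ZFSet.{u}) : Prop :=
  ∀ β < α.ord, ∀ f : ZFSet.{u}, ZFSet.IsFunc β.toZFSet M f → f ∈ M

/-- A `κ`-model is a weak `κ`-model `M` with `M^{<κ} ⊆ M`. -/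
def IsModel (κ : Cardinal.{u}) (M : ZFSet.{u}) : Prop := IsWeakModel κ M ∧ ClosedUnderSeq κ M

/-- The elementary embedding `j : M → N` is `κ`-powerset preserving: `κ` is its critical point (the
least ordinal moved), and `M` and `N` have the same subsets of `κ`. -/
structure PowersetPreserving (κ : Cardinal.{u}) {M N : ZFSet.{u}} (j : M ↪ₑ[setLang] N) :
    Prop where
  fixes : ∀ x : M, (x : ZFSet.{u}) ∈ cardSet κ → (j x : ZFSet.{u}) = x
  moves : ∃ x : M, (x : ZFSet.{u}) = cardSet κ ∧ (j x : ZFSet.{u}) ≠ x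
  same_subsets : ∀ A : ZFSet.{u}, A ⊆ cardSet κ → (A ∈ M ↔ A ∈ N)

/-- There is a `κ`-powerset preserving elementary embedding `j : M → N`. The target is a
transitive set; well-founded targets can be replaced by their transitive collapse. -/
def HasPowersetPreservingEmbedding (κ : Cardinal.{u}) (M : ZFSet.{u}) : Prop :=
  ∃ N : ZFSet.{u}, N.IsTransitive ∧ ∃ j : M ↪ₑ[setLang] N, PowersetPreserving κ j

/-! ### The large cardinals -/

/-- `κ` is super Ramsey. -/
def SuperRamsey (κ : Cardinal.{u}) : Prop :=
  ∀ A : ZFSet.{u}, A ⊆ cardSet κ → ∃ M : ZFSet.{u}, A ∈ M ∧ IsModel κ M ∧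
    ElemSub M (H (Order.succ κ)) ∧ HasPowersetPreservingEmbedding κ M

/-- `κ` is super weakly Ramsey. -/
def SuperWeaklyRamsey (κ : Cardinal.{u}) : Prop :=
  ∀ A : ZFSet.{u}, A ⊆ cardSet κ → ∃ M : ZFSet.{u}, A ∈ M ∧ IsWeakModel κ M ∧
    ElemSub M (H (Order.succ κ)) ∧ HasPowersetPreservingEmbedding κ M

/-- `κ` is `α`-Ramsey, for regular cardinals `α ≤ κ` (regular cardinals are infinite): for
arbitrarily large regular cardinals `θ`, every `A ⊆ κ` is an element of some weak `κ`-model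
`M ≺ H(θ)` which is closed under `<α`-sequences and has a `κ`-powerset preserving embedding. -/
def AlphaRamsey (α κ : Cardinal.{u}) : Prop :=
  α.IsRegular ∧ κ.IsRegular ∧ α ≤ κ ∧
    ∀ μ : Cardinal.{u}, ∃ θ : Cardinal.{u}, μ ≤ θ ∧ θ.IsRegular ∧
      ∀ A : ZFSet.{u}, A ⊆ cardSet κ → ∃ M : ZFSet.{u}, A ∈ M ∧ IsWeakModel κ M ∧
        ElemSub M (H θ) ∧ ClosedUnderSeq α M ∧ HasPowersetPreservingEmbedding κ M

/-- `κ` is a limit of cardinals with property `P`: such cardinals are unbounded below `κ`. -/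
def IsLimitOf (P : Cardinal.{u} → Prop) (κ : Cardinal.{u}) : Prop :=
  ∀ μ < κ, ∃ ν, μ < ν ∧ ν < κ ∧ P ν

end RamseyLike

namespace RamseyLike

open FirstOrder

/-! Fix a regular `θ` with `H(κ⁺) ∈ H(θ)`, a weak `κ`-model `M ≺ H(θ)` and a `κ`-powerset preserving
`j : M → N` (the structure `Setup`).

`κ` itself: put `M₀ = M ∩ H(κ⁺)`. An element of `M₀` lies in a transitive set which `M` enumerates
along `κ ⊆ M`, so `M₀` is transitive; it is elementary in `H(κ⁺)` because `H(κ⁺)` is definable in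
`H(θ)` from `κ`, hence an element of `M`. The restriction `M₀ → j(H(κ⁺))` of `j` is still powerset
preserving, and `M₀` inherits closure under short sequences. So `M₀` witnesses that `κ` is super
(weakly) Ramsey.

Cardinals below `κ`: a transitive set enumerated along `κ` is coded by a subset of `κ`, and `M` and
`N` have the same subsets of `κ`. Hence `N` computes `H(κ⁺)` as exactly `M₀`
(`Setup.eq_inter_of_isHSucc`). Being super (weakly) Ramsey is a property of `H(κ⁺)`: by
Löwenheim–Skolem and collapsing, the target of a witnessing embedding can be taken of size at most
`κ` (`PowersetPreserving.exists_small`), so that model, target and embedding are elements of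
`H(κ⁺)`. For `A ∈ M₀` elementarity of `M` yields such a witness inside `M₀`, and as `M₀ ≺ H(κ⁺)` it
is also a witness in the sense of `N` (`Setup.reflects_target`). Thus in `N` some `n < j(κ)` above
any given `m < κ`, namely `κ`, is super (weakly) Ramsey. Pulling this back along `j` gives such an
`n < κ` in the sense of `H(θ)`, which is right about it (`Reflects.superRamseyIf`). No closure of
`M` is needed for this half.

The argument moves statements between `H(θ)`, `M` and `N`. The class `IsDef` records that a
statement is given by one formula in all transitive sets, so that instance search writes the
formulas. Elementarity occurs inside the reflected statement, which therefore speaks of satisfaction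
relations for a set of codes of formulas. -/

theorem mem_iff {p : ZFSet.{u} → Prop} (x y : {x // p x}) : Mem x y ↔ x.1 ∈ y.1 := Iff.rfl

/-! ### Uniform definability over transitive sets -/

/-- The membership symbol. -/
abbrev memSym : setLang.Relations 2 := MemRel.mem

/-- `P W v` is uniformly first-order expressible in transitive sets `W` at points `v` of `W`. -/
class IsDef {α : Type} (P : ZFSet.{u} → (α → ZFSet.{u}) → Prop) : Prop where
  exists_formula : ∃ φ : setLang.Formula α, ∀ W : ZFSet.{u}, W.IsTransitive →
    ∀ v : α → W, φ.Realize v ↔ P W (fun a => v a)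

/-- Terms, whose graphs are first-order expressible. -/
class IsTerm {α : Type} (T : (α → ZFSet.{u}) → ZFSet.{u}) : Prop where
  isDef : IsDef (fun _ (v : Option α → ZFSet.{u}) => v none = T (fun a => v (some a)))

namespace IsDef
variable {α : Type} {P Q : ZFSet.{u} → (α → ZFSet.{u}) → Prop}

theorem congr (hP : IsDef P) (h : ∀ W : ZFSet.{u}, W.IsTransitive → ∀ v : α → ZFSet.{u},
    (∀ a, v a ∈ W) → (P W v ↔ Q W v)) : IsDef Q := by
  obtain ⟨φ, hφ⟩ := hP
  exact ⟨φ, fun W hW v => (hφ W hW v).trans (h W hW _ fun a => (v a).2)⟩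

theorem comap {β : Type} (f : α → β) (hP : IsDef P) :
    IsDef (fun W (v : β → ZFSet.{u}) => P W (fun a => v (f a))) := by
  obtain ⟨φ, hφ⟩ := hP
  refine ⟨φ.relabel f, fun W hW v => ?_⟩
  rw [Language.Formula.realize_relabel, hφ W hW]; rfl

instance : IsDef (fun (_ : ZFSet.{u}) (_ : α → ZFSet.{u}) => False) :=
  ⟨⊥, fun W _ v => by simp [Language.Formula.Realize]⟩

instance imp [hP : IsDef P] [hQ : IsDef Q] : IsDef (fun W v => P W v → Q W v) := by
  obtain ⟨φ, hφ⟩ := hP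
  obtain ⟨ψ, hψ⟩ := hQ
  exact ⟨φ.imp ψ, fun W hW v => by rw [Language.Formula.realize_imp, hφ W hW, hψ W hW]⟩

instance not [IsDef P] : IsDef (fun W v => ¬ P W v) :=
  inferInstanceAs (IsDef fun W v => P W v → False)

instance and [hP : IsDef P] [hQ : IsDef Q] : IsDef (fun W v => P W v ∧ Q W v) := by
  obtain ⟨φ, hφ⟩ := hP
  obtain ⟨ψ, hψ⟩ := hQ
  exact ⟨φ ⊓ ψ, fun W hW v => by rw [Language.Formula.realize_inf, hφ W hW, hψ W hW]⟩

instance or [hP : IsDef P] [hQ : IsDef Q] : IsDef (fun W v => P W v ∨ Q W v) := by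
  obtain ⟨φ, hφ⟩ := hP
  obtain ⟨ψ, hψ⟩ := hQ
  exact ⟨φ ⊔ ψ, fun W hW v => by rw [Language.Formula.realize_sup, hφ W hW, hψ W hW]⟩

instance iff [hP : IsDef P] [hQ : IsDef Q] : IsDef (fun W v => P W v ↔ Q W v) := by
  obtain ⟨φ, hφ⟩ := hP
  obtain ⟨ψ, hψ⟩ := hQ
  exact ⟨φ.iff ψ, fun W hW v => by rw [Language.Formula.realize_iff, hφ W hW, hψ W hW]⟩

instance forall_fin {n : ℕ} {R : Fin n → ZFSet.{u} → (α → ZFSet.{u}) → Prop}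
    [hR : ∀ k, IsDef (R k)] : IsDef (fun W v => ∀ k, R k W v) := by
  choose φ hφ using fun k => (hR k).exists_formula
  refine ⟨Language.Formula.iInf φ, fun W hW v => ?_⟩
  rw [Language.Formula.realize_iInf]
  exact forall_congr' fun k => hφ k W hW v

/-- The bound variable becomes the point `none` of `Option α`, and the old variables are shifted by
`some`. -/
instance all {R : ZFSet.{u} → ZFSet.{u} → (α → ZFSet.{u}) → Prop}
    [hR : IsDef (fun W (v : Option α → ZFSet.{u}) => R (v none) W (fun a => v (some a)))] :
    IsDef (fun W v => ∀ x ∈ W, R x W v) := by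
  obtain ⟨φ, hφ⟩ := hR
  refine ⟨(φ.relabel (fun o : Option α => o.elim (Sum.inr ()) Sum.inl)).iAlls Unit,
    fun W hW v => ?_⟩
  rw [Language.Formula.realize_iAlls]
  simp only [Language.Formula.realize_relabel, hφ W hW]
  exact ⟨fun h x hx => h fun _ => ⟨x, hx⟩, fun h i => h _ (i ()).2⟩

instance ex {R : ZFSet.{u} → ZFSet.{u} → (α → ZFSet.{u}) → Prop}
    [hR : IsDef (fun W (v : Option α → ZFSet.{u}) => R (v none) W (fun a => v (some a)))] :
    IsDef (fun W v => ∃ x ∈ W, R x W v) := by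
  have : IsDef (fun W v => ¬ ∀ x ∈ W, ¬ R x W v) := inferInstance
  exact this.congr fun W _ v _ => by push Not; rfl

instance mem_var {a b : α} : IsDef (fun (_ : ZFSet.{u}) v => v a ∈ v b) :=
  ⟨memSym.formula₂ (.var a) (.var b), fun W _ v => by
    rw [Language.Formula.realize_rel₂]; exact Iff.rfl⟩

instance eq_var {a b : α} : IsDef (fun (_ : ZFSet.{u}) v => v a = v b) :=
  ⟨Language.Term.equal (.var a) (.var b), fun W _ v => by
    rw [Language.Formula.realize_equal]; exact Subtype.ext_iff⟩

/-- Transitivity of `W` enters here: the elements of `v a` lie in `W`, so a bounded quantifier has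
the same meaning inside and outside of `W`. -/
instance ball {a : α} {R : ZFSet.{u} → ZFSet.{u} → (α → ZFSet.{u}) → Prop}
    [hR : IsDef (fun W (v : Option α → ZFSet.{u}) => R (v none) W (fun a => v (some a)))] :
    IsDef (fun W v => ∀ x ∈ v a, R x W v) := by
  have : IsDef (fun W v => ∀ x ∈ W, x ∈ v a → R x W v) := inferInstance
  exact this.congr fun W hW v hv =>
    ⟨fun h x hx => h x (hW _ (hv a) hx) hx, fun h x _ hx => h x hx⟩

instance bex {a : α} {R : ZFSet.{u} → ZFSet.{u} → (α → ZFSet.{u}) → Prop}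
    [hR : IsDef (fun W (v : Option α → ZFSet.{u}) => R (v none) W (fun a => v (some a)))] :
    IsDef (fun W v => ∃ x ∈ v a, R x W v) := by
  have : IsDef (fun W v => ¬ ∀ x ∈ v a, ¬ R x W v) := inferInstance
  exact this.congr fun W _ v _ => by push Not; rfl

instance eq_term {a : α} {T : (α → ZFSet.{u}) → ZFSet.{u}} [hT : IsTerm T] :
    IsDef (fun _ v => v a = T v) :=
  hT.isDef.comap (fun o : Option α => o.elim a id)

instance mem_term {a : α} {T : (α → ZFSet.{u}) → ZFSet.{u}} [hT : IsTerm T] :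
    IsDef (fun _ v => T v ∈ v a) := by
  have := hT.isDef
  have : IsDef (fun _ v => ∃ x ∈ v a, x = T v) := inferInstance
  exact this.congr fun W _ v _ => by simp

instance subset {a b : α} : IsDef (fun (_ : ZFSet.{u}) v => v a ⊆ v b) :=
  inferInstanceAs (IsDef fun _ v => ∀ x ∈ v a, x ∈ v b)

end IsDef

namespace IsTerm
variable {α : Type}

instance var {a : α} : IsTerm (fun v : α → ZFSet.{u} => v a) := ⟨inferInstance⟩

instance empty : IsTerm (fun _ : α → ZFSet.{u} => ∅) := by
  constructor
  have : IsDef (fun _ (v : Option α → ZFSet.{u}) => ∀ x ∈ v none, False) := inferInstance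
  exact this.congr fun W _ v _ => by rw [ZFSet.eq_empty]

end IsTerm


theorem isDef_pair_eq {α : Type} (a b c : α) :
    IsDef (fun (_ : ZFSet.{u}) v => v a = ZFSet.pair (v b) (v c)) := by
  have : IsDef (fun (_ : ZFSet.{u}) v =>
    (∃ s ∈ v a, v b ∈ s ∧ ∀ z ∈ s, z = v b) ∧ (∃ d ∈ v a, v b ∈ d ∧ v c ∈ d ∧
      ∀ z ∈ d, z = v b ∨ z = v c) ∧ ∀ s ∈ v a, (v b ∈ s ∧ ∀ z ∈ s, z = v b) ∨
        (v b ∈ s ∧ v c ∈ s ∧ ∀ z ∈ s, z = v b ∨ z = v c)) := inferInstance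
  refine this.congr fun W _ v _ => ?_
  have h1 : ∀ s : ZFSet.{u}, (v b ∈ s ∧ ∀ z ∈ s, z = v b) ↔ s = {v b} := fun s =>
    ⟨fun h => by ext z; rw [ZFSet.mem_singleton]; exact ⟨h.2 z, fun e => e ▸ h.1⟩,
      by rintro rfl; simp⟩
  have h2 : ∀ s : ZFSet.{u}, (v b ∈ s ∧ v c ∈ s ∧ ∀ z ∈ s, z = v b ∨ z = v c) ↔
      s = {v b, v c} := fun s =>
    ⟨fun h => by
      ext z; rw [ZFSet.mem_pair]
      exact ⟨h.2.2 z, fun h' => h'.elim (fun e => e ▸ h.1) (fun e => e ▸ h.2.1)⟩,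
      by rintro rfl; simp⟩
  simp only [h1, h2]
  constructor
  · rintro ⟨⟨s, hs, rfl⟩, ⟨d, hd, rfl⟩, h⟩
    ext z
    rw [ZFSet.pair, ZFSet.mem_pair]
    exact ⟨h z, by rintro (rfl | rfl) <;> assumption⟩
  · intro h
    rw [h, ZFSet.pair]
    simp

theorem mem_of_pair_mem {W a b : ZFSet.{u}} (hW : W.IsTransitive) (h : ZFSet.pair a b ∈ W) :
    a ∈ W ∧ b ∈ W := by
  have : ({a, b} : ZFSet.{u}) ∈ W := hW _ h (by simp [ZFSet.pair])
  exact ⟨hW _ this (by simp), hW _ this (by simp)⟩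

/-- The components are named by quantifiers over `W`. Nothing is lost, since a transitive `W` that
contains a pair contains both components. -/
instance IsTerm.pair {α : Type} {S T : (α → ZFSet.{u}) → ZFSet.{u}} [hS : IsTerm S]
    [hT : IsTerm T] : IsTerm (fun v => ZFSet.pair (S v) (T v)) := by
  constructor
  have h0 := isDef_pair_eq.{u} (some (some none) : Option (Option (Option α))) (some none) none
  have h1 := hS.isDef.comap (fun o : Option α =>
    (o.elim (some none) (fun a => some (some (some a))) : Option (Option (Option α))))
  have h2 := hT.isDef.comap (fun o : Option α =>
    (o.elim none (fun a => some (some (some a))) : Option (Option (Option α))))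
  have : IsDef (fun W (v : Option α → ZFSet.{u}) => ∃ a ∈ W, ∃ b ∈ W,
      v none = ZFSet.pair a b ∧ a = S (fun a => v (some a)) ∧ b = T (fun a => v (some a))) := by
    have := @IsDef.and _ _ _ h0 (@IsDef.and _ _ _ h1 h2)
    exact @IsDef.ex _ _ (@IsDef.ex _ _ this)
  refine this.congr fun W hW v hv => ?_
  constructor
  · rintro ⟨a, _, b, _, h, rfl, rfl⟩; exact h
  · intro h
    have h0 := hv none
    rw [h] at h0
    have := mem_of_pair_mem hW h0
    exact ⟨_, this.1, _, this.2, h, rfl, rfl⟩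

/-! ### Satisfaction of a fixed formula in a set -/

/-- The formula `φ` holds in the structure `⟨X, ∈⟩` at the points `v` of `X`. -/
def RealizeIn {n : ℕ} (φ : setLang.BoundedFormula Empty n) (X : ZFSet.{u})
    (v : Fin n → ZFSet.{u}) : Prop :=
  ∃ h : ∀ i, v i ∈ X, φ.Realize (M := X) default (fun i => ⟨v i, h i⟩)

/-- Realizations of formulas of the language of set theory without free variables, with the terms
resolved. -/
theorem setLang_induction {motive : ∀ n, setLang.BoundedFormula Empty n → Prop}
    (falsum : ∀ n, motive n .falsum)
    (equal : ∀ n (i k : Fin n), motive n (.equal (.var (.inr i)) (.var (.inr k))))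
    (mem : ∀ n (i k : Fin n) (ts : Fin 2 → setLang.Term (Empty ⊕ Fin n)),
      ts 0 = .var (.inr i) → ts 1 = .var (.inr k) → motive n (.rel memSym ts))
    (imp : ∀ n φ ψ, motive n φ → motive n ψ → motive n (.imp φ ψ))
    (all : ∀ n φ, motive (n + 1) φ → motive n (.all φ)) :
    ∀ n (φ : setLang.BoundedFormula Empty n), motive n φ := by
  have hterm : ∀ n (t : setLang.Term (Empty ⊕ Fin n)), ∃ i, t = .var (.inr i) := by
    rintro n (⟨e | i⟩ | f)
    · exact e.elim
    · exact ⟨i, rfl⟩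
    · exact Empty.elim f
  intro n φ
  induction φ with
  | falsum => exact falsum _
  | equal t₁ t₂ =>
    obtain ⟨i, rfl⟩ := hterm _ t₁
    obtain ⟨k, rfl⟩ := hterm _ t₂
    exact equal _ i k
  | rel R ts =>
    cases R
    obtain ⟨i, hi⟩ := hterm _ (ts 0)
    obtain ⟨k, hk⟩ := hterm _ (ts 1)
    exact mem _ i k ts hi hk
  | imp φ ψ h1 h2 => exact imp _ _ _ h1 h2
  | all φ h => exact all _ _ h

section RealizeIn
variable {n : ℕ} {X : ZFSet.{u}} {v : Fin n → ZFSet.{u}}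

theorem realizeIn_iff {φ : setLang.BoundedFormula Empty n} (v : Fin n → X) :
    RealizeIn φ X (fun i => v i) ↔ φ.Realize default v :=
  ⟨fun h => h.2, fun h => ⟨fun i => (v i).2, h⟩⟩

theorem realizeIn_falsum : ¬ RealizeIn .falsum X v := fun h => h.2

theorem realizeIn_equal (i k : Fin n) :
    RealizeIn (.equal (.var (.inr i)) (.var (.inr k))) X v ↔ (∀ i, v i ∈ X) ∧ v i = v k := by
  constructor
  · rintro ⟨h, e⟩; exact ⟨h, congrArg Subtype.val e⟩
  · rintro ⟨h, e⟩; exact ⟨h, Subtype.ext e⟩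

theorem realizeIn_mem (i k : Fin n) (ts : Fin 2 → setLang.Term (Empty ⊕ Fin n))
    (hi : ts 0 = .var (.inr i)) (hk : ts 1 = .var (.inr k)) :
    RealizeIn (.rel memSym ts) X v ↔ (∀ i, v i ∈ X) ∧ v i ∈ v k := by
  have : ∀ h : ∀ i, v i ∈ X, (Language.BoundedFormula.rel memSym ts).Realize (M := X) default
      (fun i => ⟨v i, h i⟩) ↔ v i ∈ v k := by
    intro h
    change ((ts 0).realize _ : X).1 ∈ ((ts 1).realize _ : X).1 ↔ _
    rw [hi, hk]; rfl
  exact ⟨fun ⟨h, e⟩ => ⟨h, (this h).1 e⟩, fun ⟨h, e⟩ => ⟨h, (this h).2 e⟩⟩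

theorem realizeIn_imp (φ ψ : setLang.BoundedFormula Empty n) :
    RealizeIn (.imp φ ψ) X v ↔ (∀ i, v i ∈ X) ∧ (RealizeIn φ X v → RealizeIn ψ X v) :=
  ⟨fun ⟨h, e⟩ => ⟨h, fun ⟨_, e'⟩ => ⟨h, e e'⟩⟩, fun ⟨h, e⟩ => ⟨h, fun e' => (e ⟨h, e'⟩).2⟩⟩

theorem realizeIn_all (φ : setLang.BoundedFormula Empty (n + 1)) :
    RealizeIn (.all φ) X v ↔ (∀ i, v i ∈ X) ∧ ∀ x ∈ X, RealizeIn φ X (Fin.snoc v x) := by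
  have key : ∀ (h : ∀ i, v i ∈ X) (x : X), (fun i => ((Fin.snoc (fun i => ⟨v i, h i⟩) x :
      Fin (n + 1) → X) i : ZFSet.{u})) = Fin.snoc v x.1 := by
    intro h x
    funext i
    refine Fin.lastCases ?_ (fun i => ?_) i <;> simp
  constructor
  · rintro ⟨h, e⟩
    refine ⟨h, fun x hx => ?_⟩
    rw [← key h ⟨x, hx⟩, realizeIn_iff]
    exact e ⟨x, hx⟩
  · rintro ⟨h, e⟩
    refine ⟨h, fun x => ?_⟩
    rw [← realizeIn_iff, key h x]
    exact e x x.2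

end RealizeIn

/-- By induction on `φ`: relativizing all quantifiers to the parameter `v a` expresses truth in `⟨v
a, ∈⟩`. This works for one formula at a time; satisfaction for all formulas at once needs codes. -/
theorem isDef_realizeIn {n : ℕ} (φ : setLang.BoundedFormula Empty n) :
    ∀ {α : Type} (f : Fin n → α) (a : α),
      IsDef (fun (_ : ZFSet.{u}) v => RealizeIn φ (v a) (fun i => v (f i))) := by
  refine setLang_induction (motive := fun n φ => ∀ {α : Type} (f : Fin n → α) (a : α),
      IsDef (fun (_ : ZFSet.{u}) v => RealizeIn φ (v a) (fun i => v (f i)))) ?_ ?_ ?_ ?_ ?_ n φ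
  · intro n α f a
    simpa only [realizeIn_falsum] using (inferInstance : IsDef fun _ _ => False)
  · intro n i k α f a
    simp only [realizeIn_equal]
    infer_instance
  · intro n i k ts hi hk α f a
    simp only [realizeIn_mem i k ts hi hk]
    infer_instance
  · intro n φ ψ h1 h2 α f a
    have := @h1 α f a
    have := @h2 α f a
    simp only [realizeIn_imp]
    infer_instance
  · intro n φ h α f a
    have h' := h (α := Option α) (Fin.snoc (fun i => some (f i)) none) (some a)
    have : IsDef fun (_ : ZFSet.{u}) (v : Option α → ZFSet.{u}) => RealizeIn φ (v (some a))
        (Fin.snoc (fun i => v (some (f i))) (v none)) := by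
      refine h'.congr fun W _ v _ => ?_
      have : (fun i => v ((Fin.snoc (fun i => some (f i)) none : Fin (n + 1) → Option α) i)) =
          Fin.snoc (fun i => v (some (f i))) (v none) := by
        funext i
        refine Fin.lastCases ?_ (fun i => ?_) i <;> simp
      rw [← this]
    simp only [realizeIn_all]
    infer_instance

/-- The formula `φ` is evaluated in the ambient structure. -/
theorem isDef_formula {α β : Type} (φ : setLang.Formula α) (f : α → β) :
    IsDef (fun (W : ZFSet.{u}) (v : β → ZFSet.{u}) => ∃ h : ∀ a, v (f a) ∈ W,
      φ.Realize (M := W) (fun a => ⟨v (f a), h a⟩)) := by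
  refine ⟨φ.relabel f, fun W hW v => ?_⟩
  rw [Language.Formula.realize_relabel]
  exact ⟨fun h => ⟨fun a => (v _).2, h⟩, fun h => h.2⟩

/-! ### Elementary embeddings and definable relations -/

/-- The extension of `j` by the empty set. -/
noncomputable def app {M N : ZFSet.{u}} (j : M ↪ₑ[setLang] N) (x : ZFSet.{u}) : ZFSet.{u} :=
  open Classical in if h : x ∈ M then j ⟨x, h⟩ else ∅

section Transfer

variable {M N K : ZFSet.{u}} {α : Type}

theorem app_of_mem (j : M ↪ₑ[setLang] N) {x : ZFSet.{u}} (h : x ∈ M) : app j x = j ⟨x, h⟩ :=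
  dif_pos h

theorem app_mem (j : M ↪ₑ[setLang] N) {x : ZFSet.{u}} (h : x ∈ M) : app j x ∈ N := by
  rw [app_of_mem j h]; exact (j _).2

theorem ElemSub.subset (h : ElemSub M K) : M ⊆ K := by
  obtain ⟨i, hi⟩ := h
  intro x hx
  have := (i ⟨x, hx⟩).2
  rwa [hi] at this

theorem ElemSub.realize_iff (h : ElemSub M K) (φ : setLang.Formula α) (v : α → ZFSet.{u})
    (hv : ∀ a, v a ∈ M) : φ.Realize (M := M) (fun a => ⟨v a, hv a⟩) ↔
      φ.Realize (M := K) (fun a => ⟨v a, h.subset (hv a)⟩) := by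
  obtain ⟨i, hi⟩ := id h
  rw [← i.map_formula]
  exact iff_of_eq (congrArg _ (funext fun a => Subtype.ext (hi _)))

/-- Elementary embeddings preserve definable relations. -/
theorem IsDef.transfer {P : ZFSet.{u} → (α → ZFSet.{u}) → Prop} (hP : IsDef P)
    (h : ElemSub M K) (hK : K.IsTransitive) (hN : N.IsTransitive) (j : M ↪ₑ[setLang] N)
    (v : α → ZFSet.{u}) (hv : ∀ a, v a ∈ M) : P K v ↔ P N (fun a => app j (v a)) := by
  obtain ⟨φ, hφ⟩ := hP
  rw [← hφ K hK (fun a => ⟨v a, h.subset (hv a)⟩), ← h.realize_iff φ v hv, ← j.map_formula,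
    hφ N hN]
  exact iff_of_eq (congrArg _ (funext fun a => (app_of_mem j (hv a)).symm))

theorem elemSub_refl (M : ZFSet.{u}) : ElemSub M M := ⟨.refl _ _, fun _ => rfl⟩

/-- The Tarski–Vaught criterion for elementary substructures. -/
theorem ElemSub.exists_mem {R : ZFSet.{u} → ZFSet.{u} → (α → ZFSet.{u}) → Prop}
    (h : ElemSub M K) (hK : K.IsTransitive)
    (hR : IsDef (fun W (v : Option α → ZFSet.{u}) => R (v none) W (fun a => v (some a))))
    (v : α → ZFSet.{u}) (hv : ∀ a, v a ∈ M) (hx : ∃ x ∈ K, R x K v) : ∃ x ∈ M, R x K v := by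
  obtain ⟨φ, hφ⟩ := hR
  let ψ := (φ.relabel (fun o : Option α => o.elim (Sum.inr ()) Sum.inl)).iExs Unit
  have h1 : ψ.Realize (M := K) (fun a => ⟨v a, h.subset (hv a)⟩) := by
    obtain ⟨x, hxK, hx⟩ := hx
    rw [Language.Formula.realize_iExs]
    refine ⟨fun _ => ⟨x, hxK⟩, ?_⟩
    rw [Language.Formula.realize_relabel, hφ K hK]
    exact hx
  rw [← h.realize_iff ψ v hv, Language.Formula.realize_iExs] at h1
  obtain ⟨i, hi⟩ := h1
  rw [Language.Formula.realize_relabel] at hi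
  refine ⟨i (), (i ()).2, ?_⟩
  have := (h.realize_iff φ (fun o : Option α => o.elim (i ()).1 v)
    (by rintro (_ | a); exacts [(i ()).2, hv a])).1 (by
      convert hi using 1; funext o; cases o <;> rfl)
  exact (hφ K hK _).1 this

theorem ElemSub.iff_of_isTransitive {P : ZFSet.{u} → (α → ZFSet.{u}) → Prop} (hP : IsDef P)
    (h : ElemSub M K) (hK : K.IsTransitive) (hM : M.IsTransitive)
    (v : α → ZFSet.{u}) (hv : ∀ a, v a ∈ M) : P K v ↔ P M v := by
  rw [hP.transfer h hK hM (.refl _ _) v hv]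
  exact iff_of_eq (congrArg _ (funext fun a => app_of_mem _ (hv a)))

end Transfer

/-! ### Cardinalities and closure properties of `H(θ)` -/

section Card

theorem card_range_le {x : ZFSet.{u}} (F : x → ZFSet.{u}) : (ZFSet.range F).card ≤ x.card := by
  have := ZFSet.lift_card_range_le (f := F)
  rw [ZFSet.cardinalMk_coe_sort] at this
  simpa using this

theorem card_le_of_surj {k t : ZFSet.{u}} (F : ZFSet.{u} → ZFSet.{u})
    (h : ∀ y ∈ t, ∃ a ∈ k, F a = y) : t.card ≤ k.card := by
  refine (ZFSet.card_mono ?_).trans (card_range_le (fun a : k => F a))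
  intro y hy
  obtain ⟨a, ha, e⟩ := h y hy
  exact ZFSet.mem_range.2 ⟨⟨a, ha⟩, e⟩

theorem exists_surj_of_card_le {k t : ZFSet.{u}} (h : t.card ≤ k.card) (ht : t.Nonempty) :
    ∃ F : ZFSet.{u} → ZFSet.{u}, (∀ a ∈ k, F a ∈ t) ∧ ∀ y ∈ t, ∃ a ∈ k, F a = y := by
  have h' : Cardinal.mk t ≤ Cardinal.mk k := by
    rw [ZFSet.cardinalMk_coe_sort, ZFSet.cardinalMk_coe_sort]
    exact Cardinal.lift_le.2 h
  obtain ⟨e⟩ := h'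
  obtain ⟨y₀, hy₀⟩ := ht
  have : Nonempty t := ⟨⟨y₀, hy₀⟩⟩
  classical
  refine ⟨fun a => if h : a ∈ k then (Function.invFun e ⟨a, h⟩ : t) else ∅, fun a ha => ?_,
    fun y hy => ⟨e ⟨y, hy⟩, (e ⟨y, hy⟩).2, ?_⟩⟩
  · simp only [dif_pos ha]; exact (Function.invFun e ⟨a, ha⟩).2
  · simp only [dif_pos (e ⟨y, hy⟩).2]
    exact congrArg Subtype.val (Function.leftInverse_invFun e.injective ⟨y, hy⟩)

theorem card_insert_lt {θ : Cardinal.{u}} (hθ : Cardinal.aleph0 ≤ θ) {x y : ZFSet.{u}}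
    (h : y.card < θ) : (insert x y).card < θ :=
  ZFSet.card_insert_le.trans_lt (Cardinal.add_lt_of_lt hθ h (Cardinal.one_lt_aleph0.trans_le hθ))

theorem card_sUnion_lt {θ : Cardinal.{u}} (hθ : θ.IsRegular) {x : ZFSet.{u}} (hx : x.card < θ)
    (F : ZFSet.{u} → ZFSet.{u}) (h : ∀ y ∈ x, (F y).card < θ) :
    (ZFSet.iUnion (fun y : x => F y)).card < θ := by
  have h1 := ZFSet.lift_card_iUnion_le_sum_card (f := fun y : x => F y)
  have h2 : Cardinal.sum (fun y : x => (F y).card) < Cardinal.lift.{u + 1} θ := by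
    have e := Cardinal.lift_sum.{u + 1, u, u + 1} (fun y : x => (F y).card)
    rw [Cardinal.lift_id.{u + 1}] at e
    rw [e]
    refine Cardinal.sum_lt_of_isRegular hθ.lift ?_ ?_
    · rw [ZFSet.cardinalMk_coe_sort]; exact Cardinal.lift_lt.2 hx
    · exact fun y => Cardinal.lift_lt.2 (h y y.2)
  exact Cardinal.lift_lt.1 (h1.trans_lt h2)

end Card

section H
variable {θ : Cardinal.{u}} {x y : ZFSet.{u}}

theorem isTransitive_H : (H θ).IsTransitive := by
  intro x hx y hy
  obtain ⟨t, ht, hxt, hc⟩ := mem_H.1 hx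
  exact mem_H.2 ⟨t, ht, ht _ (hxt hy), hc⟩

theorem mem_H_of_subset (hy : y ∈ H θ) (h : x ⊆ y) : x ∈ H θ := by
  obtain ⟨t, ht, hyt, hc⟩ := mem_H.1 hy
  exact mem_H.2 ⟨t, ht, h.trans hyt, hc⟩

/-- By regularity, the union of fewer than `θ` transitive covers of size less than `θ` is again of
size less than `θ`. The elements of `x` are inserted so that the union includes `x` itself. -/
theorem mem_H_of_card_lt (hθ : θ.IsRegular) (h : x ⊆ H θ) (hc : x.card < θ) : x ∈ H θ := by
  have : ∀ y : ZFSet.{u}, ∃ t : ZFSet.{u}, y ∈ x → t.IsTransitive ∧ y ⊆ t ∧ t.card < θ := by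
    intro y
    by_cases hy : y ∈ x
    · obtain ⟨t, ht⟩ := mem_H.1 (h hy)
      exact ⟨t, fun _ => ht⟩
    · exact ⟨∅, fun h => (hy h).elim⟩
  choose t ht using this
  refine mem_H.2 ⟨ZFSet.iUnion (fun y : x => insert y.1 (t y)), ?_, ?_, ?_⟩
  · refine ZFSet.IsTransitive.iUnion fun ⟨y, hy⟩ z hz w hw => ?_
    rw [ZFSet.mem_insert_iff] at hz ⊢
    obtain ⟨h1, h2, -⟩ := ht y hy
    rcases hz with rfl | hz
    · exact Or.inr (h2 hw)
    · exact Or.inr (h1 _ hz hw)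
  · intro y hy
    exact ZFSet.mem_iUnion.2 ⟨⟨y, hy⟩, ZFSet.mem_insert _ _⟩
  · exact card_sUnion_lt hθ hc (fun y => insert y (t y))
      fun y hy => card_insert_lt hθ.aleph0_le (ht y hy).2.2

theorem empty_mem_H (hθ : θ.IsRegular) : ∅ ∈ H θ :=
  mem_H.2 ⟨∅, ZFSet.isTransitive_empty, fun _ h => h, by simpa using hθ.pos⟩

theorem upair_mem_H (hθ : θ.IsRegular) (hx : x ∈ H θ) (hy : y ∈ H θ) :
    ({x, y} : ZFSet.{u}) ∈ H θ := by
  refine mem_H_of_card_lt hθ ?_ ?_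
  · intro z hz
    rcases ZFSet.mem_pair.1 hz with rfl | rfl <;> assumption
  · exact card_insert_lt hθ.aleph0_le (by
      rw [ZFSet.card_singleton]; exact Cardinal.one_lt_aleph0.trans_le hθ.aleph0_le)

theorem pair_mem_H (hθ : θ.IsRegular) (hx : x ∈ H θ) (hy : y ∈ H θ) : ZFSet.pair x y ∈ H θ := by
  have := upair_mem_H hθ hx hx
  rw [ZFSet.pair_eq_singleton] at this
  exact upair_mem_H hθ this (upair_mem_H hθ hx hy)

theorem sUnion_mem_H (hx : x ∈ H θ) : ZFSet.sUnion x ∈ H θ := by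
  obtain ⟨t, ht, hxt, hc⟩ := mem_H.1 hx
  refine mem_H.2 ⟨t, ht, fun z hz => ?_, hc⟩
  obtain ⟨y, hy, hz⟩ := ZFSet.mem_sUnion.1 hz
  exact ht _ (hxt hy) hz

theorem card_lt_of_mem_H (hx : x ∈ H θ) : x.card < θ := by
  obtain ⟨t, -, hxt, hc⟩ := mem_H.1 hx
  exact (ZFSet.card_mono hxt).trans_lt hc

theorem mem_H_of_isTransitive (hx : x.IsTransitive) (hc : x.card < θ) : x ∈ H θ :=
  mem_H.2 ⟨x, hx, fun _ h => h, hc⟩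

theorem rank_lt_of_mem_H (hx : x ∈ H θ) : x.rank < θ.ord := by
  obtain ⟨t, ht, hxt, hc⟩ := mem_H.1 hx
  exact (ZFSet.rank_mono hxt).trans_lt (rank_lt_of_card_lt ht hc)

theorem H_subset_H {θ' : Cardinal.{u}} (h : θ ≤ θ') : H θ ⊆ H θ' := by
  intro x hx
  obtain ⟨t, ht, hxt, hc⟩ := mem_H.1 hx
  exact mem_H.2 ⟨t, ht, hxt, hc.trans_le h⟩

theorem toZFSet_mem_H {o : Ordinal.{u}} (h : o.card < θ) : o.toZFSet ∈ H θ :=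
  mem_H_of_isTransitive (ZFSet.isOrdinal_toZFSet o).isTransitive (by rwa [Ordinal.card_toZFSet])

theorem card_cardSet (κ : Cardinal.{u}) : (cardSet κ).card = κ := by
  rw [cardSet, Ordinal.card_toZFSet, Cardinal.card_ord]

theorem isOrdinal_cardSet (κ : Cardinal.{u}) : (cardSet κ).IsOrdinal :=
  ZFSet.isOrdinal_toZFSet _

theorem cardSet_mem_H {κ : Cardinal.{u}} (h : κ < θ) : cardSet κ ∈ H θ :=
  toZFSet_mem_H (by rwa [Cardinal.card_ord])

end H

/-! ### Functions, and enumerations of transitive sets -/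

section Function

/-- The graph of `F` on `k`. -/
noncomputable def graph (k : ZFSet.{u}) (F : ZFSet.{u} → ZFSet.{u}) : ZFSet.{u} :=
  ZFSet.range (fun a : k => ZFSet.pair a (F a))

variable {k t f : ZFSet.{u}} {F : ZFSet.{u} → ZFSet.{u}}

theorem mem_graph {p : ZFSet.{u}} : p ∈ graph k F ↔ ∃ a ∈ k, ZFSet.pair a (F a) = p := by
  simp [graph]

theorem pair_mem_graph {a y : ZFSet.{u}} : ZFSet.pair a y ∈ graph k F ↔ a ∈ k ∧ y = F a := by
  rw [mem_graph]
  constructor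
  · rintro ⟨b, hb, e⟩
    obtain ⟨rfl, rfl⟩ := ZFSet.pair_inj.1 e
    exact ⟨hb, rfl⟩
  · rintro ⟨h, rfl⟩
    exact ⟨a, h, rfl⟩

theorem isFunc_graph (h : ∀ a ∈ k, F a ∈ t) : ZFSet.IsFunc k t (graph k F) := by
  refine ⟨fun p hp => ?_, fun a ha => ⟨F a, pair_mem_graph.2 ⟨ha, rfl⟩, fun y hy =>
    (pair_mem_graph.1 hy).2⟩⟩
  obtain ⟨a, ha, rfl⟩ := mem_graph.1 hp
  exact ZFSet.pair_mem_prod.2 ⟨ha, h a ha⟩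

theorem graph_mem_H {θ : Cardinal.{u}} (hθ : θ.IsRegular) (hk : k ∈ H θ)
    (h : ∀ a ∈ k, F a ∈ H θ) : graph k F ∈ H θ := by
  refine mem_H_of_card_lt hθ ?_ ((card_range_le _).trans_lt (card_lt_of_mem_H hk))
  intro p hp
  obtain ⟨a, ha, rfl⟩ := mem_graph.1 hp
  exact pair_mem_H hθ (isTransitive_H _ hk ha) (h a ha)

/-- The value of the function `f` at `a`. -/
noncomputable def val (f a : ZFSet.{u}) : ZFSet.{u} :=
  open Classical in if h : ∃ y, ZFSet.pair a y ∈ f then h.choose else ∅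

theorem pair_mem_iff_of_isFunc (hf : ZFSet.IsFunc k t f) {a y : ZFSet.{u}} (ha : a ∈ k) :
    ZFSet.pair a y ∈ f ↔ y = val f a := by
  obtain ⟨w, hw, h⟩ := hf.2 a ha
  have h' : ∃ y, ZFSet.pair a y ∈ f := ⟨w, hw⟩
  have e : val f a = w := by rw [val, dif_pos h']; exact h _ h'.choose_spec
  rw [e]
  exact ⟨h y, fun e => e ▸ hw⟩

theorem mem_of_pair_mem_of_isFunc (hf : ZFSet.IsFunc k t f) {a y : ZFSet.{u}}
    (h : ZFSet.pair a y ∈ f) : a ∈ k ∧ y ∈ t :=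
  ZFSet.pair_mem_prod.1 (hf.1 h)

theorem val_mem (hf : ZFSet.IsFunc k t f) {a : ZFSet.{u}} (ha : a ∈ k) : val f a ∈ t :=
  (mem_of_pair_mem_of_isFunc hf ((pair_mem_iff_of_isFunc hf ha).2 rfl)).2

theorem eq_graph_of_isFunc (hf : ZFSet.IsFunc k t f) : f = graph k (val f) := by
  ext p
  rw [mem_graph]
  constructor
  · intro hp
    obtain ⟨a, ha, y, hy, rfl⟩ := ZFSet.mem_prod.1 (hf.1 hp)
    exact ⟨a, ha, by rw [(pair_mem_iff_of_isFunc hf ha).1 hp]⟩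
  · rintro ⟨a, ha, rfl⟩
    exact (pair_mem_iff_of_isFunc hf ha).2 rfl

theorem graph_congr {G : ZFSet.{u} → ZFSet.{u}} (h : ∀ a ∈ k, F a = G a) :
    graph k F = graph k G := by
  ext p
  simp only [mem_graph]
  exact exists_congr fun a => and_congr_right fun ha => by rw [h a ha]

instance isDef_isFunc {α : Type} {a b c : α} :
    IsDef (fun (_ : ZFSet.{u}) v => ZFSet.IsFunc (v a) (v b) (v c)) := by
  have : IsDef (fun (_ : ZFSet.{u}) v =>
    (∀ p ∈ v c, ∃ x ∈ v a, ∃ y ∈ v b, p = ZFSet.pair x y) ∧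
      ∀ x ∈ v a, ∃ y ∈ v b, ZFSet.pair x y ∈ v c ∧ ∀ z ∈ v b, ZFSet.pair x z ∈ v c → z = y) :=
    inferInstance
  refine this.congr fun W _ v _ => ?_
  constructor
  · rintro ⟨h1, h2⟩
    have h3 : v c ⊆ ZFSet.prod (v a) (v b) := fun p hp => by
      obtain ⟨x, hx, y, hy, rfl⟩ := h1 p hp
      exact ZFSet.pair_mem_prod.2 ⟨hx, hy⟩
    refine ⟨h3, fun x hx => ?_⟩
    obtain ⟨y, hy, hxy, h⟩ := h2 x hx
    exact ⟨y, hxy, fun z hz => h z (ZFSet.pair_mem_prod.1 (h3 hz)).2 hz⟩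
  · intro h
    refine ⟨fun p hp => by simpa using h.1 hp, fun x hx => ?_⟩
    obtain ⟨y, hy, hy'⟩ := h.2 x hx
    exact ⟨y, (mem_of_pair_mem_of_isFunc h hy).2, hy, fun z _ hz => hy' z hz⟩

instance isDef_isTransitive {α : Type} {a : α} :
    IsDef (fun (_ : ZFSet.{u}) v => (v a).IsTransitive) :=
  inferInstanceAs (IsDef (fun _ v => ∀ y ∈ v a, y ⊆ v a))

instance isDef_isOrdinal {α : Type} {a : α} :
    IsDef (fun (_ : ZFSet.{u}) v => (v a).IsOrdinal) := by
  simp only [ZFSet.isOrdinal_iff_forall_mem_isTransitive]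
  infer_instance

/-- `f` is a function from `k` onto the transitive set `t`. -/
def Enumerates (k t f : ZFSet.{u}) : Prop :=
  t.IsTransitive ∧ ZFSet.IsFunc k t f ∧ ∀ y ∈ t, ∃ a ∈ k, ZFSet.pair a y ∈ f

instance isDef_enumerates {α : Type} {a b c : α} :
    IsDef (fun (_ : ZFSet.{u}) v => Enumerates (v a) (v b) (v c)) := by
  unfold Enumerates
  infer_instance

theorem Enumerates.card_le (h : Enumerates k t f) : t.card ≤ k.card := by
  refine card_le_of_surj (val f) fun y hy => ?_
  obtain ⟨a, ha, h'⟩ := h.2.2 y hy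
  exact ⟨a, ha, ((pair_mem_iff_of_isFunc h.2.1 ha).1 h').symm⟩

theorem exists_enumerates (ht : t.IsTransitive) (hc : t.card ≤ k.card) (hn : t.Nonempty) :
    ∃ f, Enumerates k t f := by
  obtain ⟨F, h1, h2⟩ := exists_surj_of_card_le hc hn
  refine ⟨graph k F, ht, isFunc_graph h1, fun y hy => ?_⟩
  obtain ⟨a, ha, rfl⟩ := h2 y hy
  exact ⟨a, ha, pair_mem_graph.2 ⟨ha, rfl⟩⟩

theorem Enumerates.mem_H {θ : Cardinal.{u}} (h : Enumerates k t f) (hθ : θ.IsRegular)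
    (hk : k ∈ H θ) : t ∈ H θ ∧ f ∈ H θ := by
  have ht : t ∈ H θ := mem_H_of_isTransitive h.1 (h.card_le.trans_lt (card_lt_of_mem_H hk))
  refine ⟨ht, ?_⟩
  rw [eq_graph_of_isFunc h.2.1]
  exact graph_mem_H hθ hk fun a ha => isTransitive_H _ ht (val_mem h.2.1 ha)

/-- This replaces the cardinality condition in `H(ν⁺)` by the existence of a surjection, which is
first-order. Adding `x` to its transitive cover makes the cover nonempty, so that `ν` can be mapped
onto it. -/
theorem mem_H_succ_iff {ν : Cardinal.{u}} (hν : Cardinal.aleph0 ≤ ν) {x : ZFSet.{u}} :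
    x ∈ H (Order.succ ν) ↔ ∃ t f, Enumerates (cardSet ν) t f ∧ x ∈ t := by
  constructor
  · intro hx
    obtain ⟨t, ht, hxt, hc⟩ := RamseyLike.mem_H.1 hx
    have ht' : (insert x t).IsTransitive := by
      intro z hz w hw
      rw [ZFSet.mem_insert_iff] at hz ⊢
      rcases hz with rfl | hz
      · exact Or.inr (hxt hw)
      · exact Or.inr (ht _ hz hw)
    have hc' := card_insert_lt (x := x) (hν.trans (Order.le_succ ν)) hc
    obtain ⟨f, hf⟩ := exists_enumerates (k := cardSet ν) ht'
      (by rw [card_cardSet]; exact Order.lt_succ_iff.1 hc') ⟨x, ZFSet.mem_insert _ _⟩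
    exact ⟨_, f, hf, ZFSet.mem_insert _ _⟩
  · rintro ⟨t, f, h, hx⟩
    refine isTransitive_H _ (mem_H_of_isTransitive h.1 (h.card_le.trans_lt ?_)) hx
    rw [card_cardSet]
    exact Order.lt_succ ν

end Function

/-! ### Codes of formulas and internal satisfaction relations -/

/-- Codes of operations on unary relations, which suffice to express the formulas of the language
of set theory, see `OpSem` for the meaning of the operations. -/
inductive Code : Type
  | fls : Code
  | node : Fin 6 → Code → Code → Code

/-- Distinct hereditarily finite sets. -/
def tag : ℕ → ZFSet.{u}
  | 0 => ∅
  | n + 1 => ZFSet.pair ∅ (tag n)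

theorem pair_ne_empty (x y : ZFSet.{u}) : ZFSet.pair x y ≠ ∅ := by
  intro h
  have : ({x} : ZFSet.{u}) ∈ ZFSet.pair x y := by simp [ZFSet.pair]
  rw [h] at this
  exact ZFSet.notMem_empty _ this

theorem tag_injective : Function.Injective tag.{u} := by
  intro m
  induction m with
  | zero =>
    rintro (_ | n) h
    · rfl
    · exact (pair_ne_empty _ _ h.symm).elim
  | succ m ih =>
    rintro (_ | n) h
    · exact (pair_ne_empty _ _ h).elim
    · rw [ih (ZFSet.pair_inj.1 h).2]

instance IsTerm.tag {α : Type} (n : ℕ) : IsTerm (fun _ : α → ZFSet.{u} => RamseyLike.tag n) := by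
  induction n with
  | zero => exact IsTerm.empty
  | succ n ih => exact IsTerm.pair

/-- The hereditarily finite set that represents a code. -/
def Code.toZFSet : Code → ZFSet.{u}
  | fls => ∅
  | node o c d => ZFSet.pair (tag o) (ZFSet.pair c.toZFSet d.toZFSet)

theorem Code.toZFSet_injective : Function.Injective Code.toZFSet.{u} := by
  intro c
  induction c with
  | fls =>
    rintro (_ | ⟨o, c, d⟩) h
    · rfl
    · exact (pair_ne_empty _ _ h.symm).elim
  | node o c d hc hd =>
    rintro (_ | ⟨o', c', d'⟩) h
    · exact (pair_ne_empty _ _ h).elim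
    · obtain ⟨h1, h2⟩ := ZFSet.pair_inj.1 h
      obtain ⟨h2, h3⟩ := ZFSet.pair_inj.1 h2
      rw [hc h2, hd h3, Fin.ext (tag_injective h1)]

/-- The operations on unary relations on `X`. Finite sequences of elements of `X` are nested pairs.
The operations `0` and `1` serve to access the entries of a sequence, the others stand for
membership, equality, implication and universal quantification. -/
def OpSem (o : Fin 6) (X : ZFSet.{u}) (P Q : ZFSet.{u} → Prop) (t : ZFSet.{u}) : Prop :=
  match o with
  | 0 => ∃ s ∈ X, ∃ x ∈ X, t = ZFSet.pair (ZFSet.pair s x) x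
  | 1 => ∃ s ∈ X, ∃ x ∈ X, ∃ y ∈ X, t = ZFSet.pair (ZFSet.pair s x) y ∧
      ∃ w ∈ X, w = ZFSet.pair s y ∧ P w
  | 2 => ∃ y ∈ X, ∃ z ∈ X, (∃ w ∈ X, w = ZFSet.pair t y ∧ P w) ∧
      (∃ w ∈ X, w = ZFSet.pair t z ∧ Q w) ∧ y ∈ z
  | 3 => ∃ y ∈ X, ∃ z ∈ X, (∃ w ∈ X, w = ZFSet.pair t y ∧ P w) ∧
      (∃ w ∈ X, w = ZFSet.pair t z ∧ Q w) ∧ y = z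
  | 4 => P t → Q t
  | 5 => ∀ x ∈ X, ∀ w ∈ X, w = ZFSet.pair t x → P w

/-- The operations evaluate `P` and `Q` at points of `X` only; this is why a satisfaction relation
has to be controlled on `X` alone. -/
theorem opSem_congr {o : Fin 6} {X : ZFSet.{u}} {P P' Q Q' : ZFSet.{u} → Prop} {t : ZFSet.{u}}
    (ht : t ∈ X) (hP : ∀ x ∈ X, P x ↔ P' x) (hQ : ∀ x ∈ X, Q x ↔ Q' x) :
    OpSem o X P Q t ↔ OpSem o X P' Q' t := by
  have e1 : ∀ p : ZFSet.{u}, (∃ w ∈ X, w = p ∧ P w) ↔ ∃ w ∈ X, w = p ∧ P' w := fun p =>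
    exists_congr fun w => and_congr_right fun h => and_congr_right fun _ => hP w h
  have e2 : ∀ p : ZFSet.{u}, (∃ w ∈ X, w = p ∧ Q w) ↔ ∃ w ∈ X, w = p ∧ Q' w := fun p =>
    exists_congr fun w => and_congr_right fun h => and_congr_right fun _ => hQ w h
  fin_cases o
  · exact Iff.rfl
  · simp only [OpSem, e1]
  · simp only [OpSem, e1, e2]
  · simp only [OpSem, e1, e2]
  · exact imp_congr (hP t ht) (hQ t ht)
  · exact forall₂_congr fun x _ => forall₂_congr fun w h => imp_congr_right fun _ => hP w h

section OpSem
variable {α : Type} {P Q : ZFSet.{u} → ZFSet.{u} → (α → ZFSet.{u}) → Prop}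
  [hP : IsDef (fun W (v : Option α → ZFSet.{u}) => P (v none) W (fun a => v (some a)))]
  [hQ : IsDef (fun W (v : Option α → ZFSet.{u}) => Q (v none) W (fun a => v (some a)))]

theorem isDef_comp (a : α) : IsDef (fun W v => P (v a) W v) :=
  hP.comap (fun o : Option α => o.elim a id)

theorem isDef_extend₁ {β : Type} (f : α → β) :
    IsDef (fun W (v : Option β → ZFSet.{u}) => P (v none) W (fun a => v (some (f a)))) :=
  hP.comap (Option.map f)

instance isDef_opSem {o : Fin 6} {a b : α} :
    IsDef (fun W v => OpSem o (v a) (fun x => P x W v) (fun x => Q x W v) (v b)) := by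
  -- `P` and `Q` occur below up to three new quantifiers, or at `v b` itself; these are the
  -- corresponding instances for the search.
  have h1 := @isDef_extend₁ _ P hP _
    (fun a => some (some (some a)) : α → Option (Option (Option α)))
  have h2 := @isDef_extend₁ _ P hP _ (fun a => some (some a) : α → Option (Option α))
  have h3 := @isDef_extend₁ _ Q hQ _ (fun a => some (some a) : α → Option (Option α))
  have h4 := @isDef_extend₁ _ P hP _ (fun a => some a : α → Option α)
  have h5 := @isDef_comp _ P hP
  have h6 := @isDef_comp _ Q hQ
  fin_cases o <;> simp only [OpSem] <;> infer_instance

instance isDef_opSem_self {o : Fin 6} {b : α} :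
    IsDef (fun W v => OpSem o W (fun x => P x W v) (fun x => Q x W v) (v b)) := by
  have h1 := @isDef_extend₁ _ P hP _
    (fun a => some (some (some a)) : α → Option (Option (Option α)))
  have h2 := @isDef_extend₁ _ P hP _ (fun a => some (some a) : α → Option (Option α))
  have h3 := @isDef_extend₁ _ Q hQ _ (fun a => some (some a) : α → Option (Option α))
  have h4 := @isDef_extend₁ _ P hP _ (fun a => some a : α → Option α)
  have h5 := @isDef_comp _ P hP
  have h6 := @isDef_comp _ Q hQ
  fin_cases o <;> simp only [OpSem] <;> infer_instance

end OpSem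

/-- The unary relation on `X` with the given code. -/
def sat (X : ZFSet.{u}) : Code → ZFSet.{u} → Prop
  | .fls => fun _ => False
  | .node o c d => OpSem o X (sat X c) (sat X d)

instance isDef_sat {c : Code} {α : Type} {b : α} :
    IsDef (fun (W : ZFSet.{u}) v => sat W c (v b)) := by
  induction c generalizing α with
  | fls => exact inferInstanceAs (IsDef fun _ _ => False)
  | node o c d hc hd =>
    exact inferInstanceAs (IsDef fun W v => OpSem o W (fun x => sat W c x)
      (fun x => sat W d x) (v b))

/-- The set `F` contains the codes. -/
def ClosedCodes (F : ZFSet.{u}) : Prop :=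
  ∅ ∈ F ∧ ∀ o : Fin 6, ∀ c ∈ F, ∀ d ∈ F, ZFSet.pair (tag o) (ZFSet.pair c d) ∈ F

/-- The set `D` is a satisfaction relation for `X`. -/
def IsSat (F D X : ZFSet.{u}) : Prop :=
  (∀ t ∈ X, ZFSet.pair ∅ t ∉ D) ∧ ∀ o : Fin 6, ∀ c ∈ F, ∀ d ∈ F, ∀ t ∈ X,
    ZFSet.pair (ZFSet.pair (tag o) (ZFSet.pair c d)) t ∈ D ↔
      OpSem o X (fun x => ZFSet.pair c x ∈ D) (fun x => ZFSet.pair d x ∈ D) t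

instance isDef_closedCodes {α : Type} {a : α} :
    IsDef (fun (_ : ZFSet.{u}) v => ClosedCodes (v a)) := by
  unfold ClosedCodes
  infer_instance

instance isDef_isSat {α : Type} {a b c : α} :
    IsDef (fun (_ : ZFSet.{u}) v => IsSat (v a) (v b) (v c)) := by
  unfold IsSat
  infer_instance

theorem ClosedCodes.toZFSet_mem {F : ZFSet.{u}} (h : ClosedCodes F) (c : Code) : c.toZFSet ∈ F := by
  induction c with
  | fls => exact h.1
  | node o c d hc hd => exact h.2 o _ hc _ hd

/-- The recursion clauses of `IsSat` determine `D` at every genuine code, by induction outside of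
the structure. Hence any two satisfaction relations for `X` agree on codes. -/
theorem IsSat.iff {F D X : ZFSet.{u}} (h : IsSat F D X) (hF : ClosedCodes F) (c : Code) :
    ∀ t ∈ X, ZFSet.pair c.toZFSet t ∈ D ↔ sat X c t := by
  induction c with
  | fls => exact fun t ht => ⟨fun h' => h.1 t ht h', False.elim⟩
  | node o c d hc hd =>
    intro t ht
    exact (h.2 o _ (hF.toZFSet_mem c) _ (hF.toZFSet_mem d) t ht).trans (opSem_congr ht hc hd)

theorem Code.countable : Countable Code := by
  let f : Code → ℕ := fun c => Code.rec 0
    (fun o _ _ m n => Nat.pair o (Nat.pair m n) + 1) c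
  have hf : Function.Injective f := by
    intro c
    induction c with
    | fls =>
      rintro (_ | ⟨o, c, d⟩) h
      · rfl
      · simp [f] at h
    | node o c d hc hd =>
      rintro (_ | ⟨o', c', d'⟩) h
      · simp [f] at h
      · have h : Nat.pair o (Nat.pair (f c) (f d)) + 1 =
          Nat.pair o' (Nat.pair (f c') (f d')) + 1 := h
        obtain ⟨h1, h2⟩ := Nat.pair_eq_pair.1 (Nat.succ_injective h)
        obtain ⟨h2, h3⟩ := Nat.pair_eq_pair.1 h2
        rw [hc h2, hd h3, Fin.ext h1]
  exact hf.countable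

/-- The set of codes. -/
noncomputable def codes : ZFSet.{u} := ZFSet.range (Code.toZFSet.{u})

theorem mem_codes {x : ZFSet.{u}} : x ∈ codes ↔ ∃ c : Code, c.toZFSet = x := ZFSet.mem_range

theorem closedCodes_codes : ClosedCodes codes.{u} := by
  refine ⟨mem_codes.2 ⟨.fls, rfl⟩, fun o c hc d hd => ?_⟩
  obtain ⟨c, rfl⟩ := mem_codes.1 hc
  obtain ⟨d, rfl⟩ := mem_codes.1 hd
  exact mem_codes.2 ⟨.node o c d, rfl⟩

theorem ClosedCodes.codes_subset {F : ZFSet.{u}} (h : ClosedCodes F) : codes ⊆ F := by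
  intro x hx
  obtain ⟨c, rfl⟩ := mem_codes.1 hx
  exact h.toZFSet_mem c

theorem card_codes_le : codes.{u}.card ≤ Cardinal.aleph0 := by
  have := ZFSet.lift_card_range_le (f := Code.toZFSet.{u})
  have h2 : Cardinal.mk Code ≤ Cardinal.aleph0 := by
    have := Code.countable
    exact Cardinal.mk_le_aleph0
  have h3 := this.trans (Cardinal.lift_le.2 h2)
  rw [Cardinal.lift_aleph0, Cardinal.lift_le_aleph0] at h3
  exact h3

/-- The satisfaction relation for `X`. -/
noncomputable def satSet (X : ZFSet.{u}) : ZFSet.{u} :=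
  ZFSet.sep (fun p => ∃ c t, p = ZFSet.pair (Code.toZFSet c) t ∧ sat X c t) (ZFSet.prod codes X)

theorem pair_mem_satSet {X t : ZFSet.{u}} {c : Code} :
    ZFSet.pair c.toZFSet t ∈ satSet X ↔ t ∈ X ∧ sat X c t := by
  rw [satSet, ZFSet.mem_sep, ZFSet.pair_mem_prod]
  constructor
  · rintro ⟨⟨-, h1⟩, c', t', h, h2⟩
    obtain ⟨e, rfl⟩ := ZFSet.pair_inj.1 h
    rw [Code.toZFSet_injective e]
    exact ⟨h1, h2⟩
  · rintro ⟨h1, h2⟩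
    exact ⟨⟨mem_codes.2 ⟨c, rfl⟩, h1⟩, c, t, rfl, h2⟩

theorem isSat_satSet (X : ZFSet.{u}) : IsSat codes (satSet X) X := by
  refine ⟨fun t ht h => (pair_mem_satSet (c := .fls)).1 h |>.2, fun o c hc d hd t ht => ?_⟩
  obtain ⟨c, rfl⟩ := mem_codes.1 hc
  obtain ⟨d, rfl⟩ := mem_codes.1 hd
  refine (pair_mem_satSet (c := .node o c d)).trans ((and_iff_right ht).trans ?_)
  exact opSem_congr ht (fun x hx => (pair_mem_satSet.trans (and_iff_right hx)).symm)
    (fun x hx => (pair_mem_satSet.trans (and_iff_right hx)).symm)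

section H
variable {θ : Cardinal.{u}}

theorem tag_mem_H (hθ : θ.IsRegular) (n : ℕ) : tag n ∈ H θ := by
  induction n with
  | zero => exact empty_mem_H hθ
  | succ n ih => exact pair_mem_H hθ (empty_mem_H hθ) ih

theorem codes_mem_H (hθ : θ.IsRegular) (h : Cardinal.aleph0 < θ) : codes ∈ H θ := by
  refine mem_H_of_card_lt hθ ?_ (card_codes_le.trans_lt h)
  intro x hx
  obtain ⟨c, rfl⟩ := mem_codes.1 hx
  induction c with
  | fls => exact empty_mem_H hθ
  | node o c d hc hd =>
    exact pair_mem_H hθ (tag_mem_H hθ _)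
      (pair_mem_H hθ (hc (mem_codes.2 ⟨c, rfl⟩)) (hd (mem_codes.2 ⟨d, rfl⟩)))

theorem prod_mem_H (hθ : θ.IsRegular) {x y : ZFSet.{u}} (hx : x ∈ H θ) (hy : y ∈ H θ) :
    ZFSet.prod x y ∈ H θ := by
  refine mem_H_of_card_lt hθ ?_ ?_
  · intro p hp
    obtain ⟨a, ha, b, hb, rfl⟩ := ZFSet.mem_prod.1 hp
    exact pair_mem_H hθ (isTransitive_H _ hx ha) (isTransitive_H _ hy hb)
  · refine (ZFSet.card_mono ?_).trans_lt (card_sUnion_lt hθ (card_lt_of_mem_H hx)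
      (fun a => ZFSet.range (fun b : y => ZFSet.pair a b))
      fun a _ => (card_range_le _).trans_lt (card_lt_of_mem_H hy))
    intro p hp
    obtain ⟨a, ha, b, hb, rfl⟩ := ZFSet.mem_prod.1 hp
    exact ZFSet.mem_iUnion.2 ⟨⟨a, ha⟩, ZFSet.mem_range.2 ⟨⟨b, hb⟩, rfl⟩⟩

theorem satSet_mem_H (hθ : θ.IsRegular) (h : Cardinal.aleph0 < θ) {X : ZFSet.{u}} (hX : X ∈ H θ) :
    satSet X ∈ H θ :=
  mem_H_of_subset (prod_mem_H hθ (codes_mem_H hθ h) hX) ZFSet.sep_subset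

end H

/-- `X` is closed under pairs. -/
def PairClosed (X : ZFSet.{u}) : Prop :=
  ∅ ∈ X ∧ ∀ x ∈ X, ∀ y ∈ X, ZFSet.pair x y ∈ X

instance isDef_pairClosed {α : Type} {a : α} :
    IsDef (fun (_ : ZFSet.{u}) v => PairClosed (v a)) := by
  unfold PairClosed
  infer_instance

/-- The set that represents a finite sequence. -/
def enc : (n : ℕ) → (Fin n → ZFSet.{u}) → ZFSet.{u}
  | 0, _ => ∅
  | n + 1, v => ZFSet.pair (enc n (Fin.init v)) (v (Fin.last n))

theorem enc_snoc {n : ℕ} (v : Fin n → ZFSet.{u}) (x : ZFSet.{u}) :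
    enc (n + 1) (Fin.snoc v x) = ZFSet.pair (enc n v) x := by
  simp [enc]

/-- The code of the projection to the `k`-th last entry of a sequence. -/
def idx : ℕ → Code
  | 0 => .node 0 .fls .fls
  | k + 1 => .node 1 (idx k) .fls

theorem PairClosed.enc_mem {X : ZFSet.{u}} (hX : PairClosed X) :
    ∀ {n : ℕ} {v : Fin n → ZFSet.{u}}, (∀ i, v i ∈ X) → enc n v ∈ X
  | 0, _, _ => hX.1
  | _ + 1, _, h => hX.2 _ (hX.enc_mem fun i => h i.castSucc) _ (h _)

/-- In the tuple `v` followed by `y`, operation `0` compares `y` with the last entry of `v`, and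
operation `1` deletes that entry. Entry `i` is reached after `Fin.rev i` deletions. -/
theorem sat_idx {X : ZFSet.{u}} (hX : PairClosed X) : ∀ {n : ℕ} {v : Fin n → ZFSet.{u}},
    (∀ i, v i ∈ X) → ∀ (i : Fin n), ∀ y ∈ X,
      sat X (idx (Fin.rev i)) (ZFSet.pair (enc n v) y) ↔ y = v i
  | 0, _, _, i, _, _ => i.elim0
  | n + 1, v, hv, i, y, hy => by
    have h1 : enc n (Fin.init v) ∈ X := hX.enc_mem fun i => hv i.castSucc
    refine Fin.lastCases ?_ (fun i => ?_) i
    · rw [Fin.rev_last]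
      change (∃ s ∈ X, ∃ x ∈ X, ZFSet.pair (ZFSet.pair _ _) y = ZFSet.pair (ZFSet.pair s x) x) ↔ _
      constructor
      · rintro ⟨s, -, x, -, h⟩
        obtain ⟨h, rfl⟩ := ZFSet.pair_inj.1 h
        exact (ZFSet.pair_inj.1 h).2.symm
      · rintro rfl
        exact ⟨_, h1, _, hy, rfl⟩
    · rw [Fin.rev_castSucc]
      refine Iff.trans ?_ (sat_idx hX (fun i => hv i.castSucc) i y hy)
      change (∃ s ∈ X, ∃ x ∈ X, ∃ z ∈ X, ZFSet.pair (ZFSet.pair _ _) y =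
        ZFSet.pair (ZFSet.pair s x) z ∧ ∃ w ∈ X, w = ZFSet.pair s z ∧ sat X (idx (Fin.rev i)) w) ↔ _
      constructor
      · rintro ⟨s, -, x, -, z, -, h, _, -, rfl, h'⟩
        obtain ⟨e, rfl⟩ := ZFSet.pair_inj.1 h
        obtain ⟨rfl, -⟩ := ZFSet.pair_inj.1 e
        exact h'
      · intro h
        exact ⟨_, h1, _, hv _, y, hy, rfl, _, hX.2 _ h1 _ hy, rfl, h⟩

/-- Every formula has a code. -/
theorem exists_code {n : ℕ} (φ : setLang.BoundedFormula Empty n) : ∃ c : Code, ∀ X : ZFSet.{u},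
    PairClosed X → ∀ v : Fin n → ZFSet.{u}, (∀ i, v i ∈ X) →
      (sat X c (enc n v) ↔ RealizeIn φ X v) := by
  -- Operations `2` and `3` fetch the values of two variables by appending a candidate to the tuple;
  -- this identifies the candidate that passes the test.
  have var : ∀ {n : ℕ} {X : ZFSet.{u}} (_ : PairClosed X) {v : Fin n → ZFSet.{u}}
      (_ : ∀ i, v i ∈ X) (i : Fin n) (y : ZFSet.{u}) (_ : y ∈ X),
      (∃ w ∈ X, w = ZFSet.pair (enc n v) y ∧ sat X (idx (Fin.rev i)) w) ↔ y = v i := by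
    intro n X hX v hv i y hy
    rw [← sat_idx hX hv i y hy]
    exact ⟨by rintro ⟨_, -, rfl, h⟩; exact h,
      fun h => ⟨_, hX.2 _ (hX.enc_mem hv) _ hy, rfl, h⟩⟩
  refine setLang_induction (motive := fun n φ => ∃ c : Code, ∀ X : ZFSet.{u},
    PairClosed X → ∀ v : Fin n → ZFSet.{u}, (∀ i, v i ∈ X) →
      (sat X c (enc n v) ↔ RealizeIn φ X v)) ?_ ?_ ?_ ?_ ?_ n φ
  · exact fun n => ⟨.fls, fun X hX v hv => ⟨False.elim, realizeIn_falsum⟩⟩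
  · refine fun n i k => ⟨.node 3 (idx (Fin.rev i)) (idx (Fin.rev k)), fun X hX v hv => ?_⟩
    rw [realizeIn_equal, and_iff_right hv]
    change (∃ y ∈ X, ∃ z ∈ X, _ ∧ _ ∧ y = z) ↔ _
    constructor
    · rintro ⟨y, hy, z, hz, h1, h2, rfl⟩
      rw [← (var hX hv i y hy).1 h1, ← (var hX hv k y hy).1 h2]
    · intro h
      exact ⟨_, hv i, _, hv k, (var hX hv i _ (hv i)).2 rfl, (var hX hv k _ (hv k)).2 rfl, h⟩
  · refine fun n i k ts hi hk =>
      ⟨.node 2 (idx (Fin.rev i)) (idx (Fin.rev k)), fun X hX v hv => ?_⟩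
    rw [realizeIn_mem i k ts hi hk, and_iff_right hv]
    change (∃ y ∈ X, ∃ z ∈ X, _ ∧ _ ∧ y ∈ z) ↔ _
    constructor
    · rintro ⟨y, hy, z, hz, h1, h2, h⟩
      rwa [← (var hX hv i y hy).1 h1, ← (var hX hv k z hz).1 h2]
    · intro h
      exact ⟨_, hv i, _, hv k, (var hX hv i _ (hv i)).2 rfl, (var hX hv k _ (hv k)).2 rfl, h⟩
  · rintro n φ ψ ⟨c, hc⟩ ⟨d, hd⟩
    refine ⟨.node 4 c d, fun X hX v hv => ?_⟩
    rw [realizeIn_imp, and_iff_right hv]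
    exact imp_congr (hc X hX v hv) (hd X hX v hv)
  · rintro n φ ⟨c, hc⟩
    refine ⟨.node 5 c .fls, fun X hX v hv => ?_⟩
    rw [realizeIn_all, and_iff_right hv]
    change (∀ x ∈ X, ∀ w ∈ X, w = ZFSet.pair (enc n v) x → sat X c w) ↔ _
    refine forall₂_congr fun x hx => ?_
    rw [← hc X hX (Fin.snoc v x) (fun i => by
      refine Fin.lastCases ?_ (fun i => ?_) i <;> simp [hx, hv]), enc_snoc]
    exact ⟨fun h => h _ (hX.2 _ (hX.enc_mem hv) _ hx) rfl, fun h w _ e => e ▸ h⟩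

/-! ### Elementarity from formulas and from codes -/

section Embedding
variable {M N K X : ZFSet.{u}}

theorem exists_elementaryEmbedding (F : ZFSet.{u} → ZFSet.{u}) (hF : ∀ x ∈ M, F x ∈ N)
    (h : ∀ (n : ℕ) (φ : setLang.BoundedFormula Empty n) (v : Fin n → ZFSet.{u}), (∀ i, v i ∈ M) →
      (RealizeIn φ M v ↔ RealizeIn φ N (fun i => F (v i)))) :
    ∃ j : M ↪ₑ[setLang] N, ∀ x : M, (j x : ZFSet.{u}) = F x := by
  refine ⟨⟨fun x => ⟨F x, hF x x.2⟩, fun n φ x => ?_⟩, fun x => rfl⟩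
  rw [← Language.Formula.realize_relabel_sumInr φ (v := default),
    ← Language.Formula.realize_relabel_sumInr φ (v := default)]
  have h1 := h n (Language.BoundedFormula.relabel Sum.inr φ) (fun i => x i) (fun i => (x i).2)
  rw [realizeIn_iff x] at h1
  rw [← realizeIn_iff]
  exact h1.symm

/-- Since `F` respects the empty set and pairs, it commutes with the encoding of tuples, so
preservation of the coded unary relations already gives preservation of all formulas. -/
theorem exists_elementaryEmbedding_of_sat (hM : PairClosed M) (hN : PairClosed N)
    (F : ZFSet.{u} → ZFSet.{u}) (hF : ∀ x ∈ M, F x ∈ N) (hF0 : F ∅ = ∅)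
    (hF2 : ∀ x ∈ M, ∀ y ∈ M, F (ZFSet.pair x y) = ZFSet.pair (F x) (F y))
    (h : ∀ (c : Code), ∀ t ∈ M, sat M c t ↔ sat N c (F t)) :
    ∃ j : M ↪ₑ[setLang] N, ∀ x : M, (j x : ZFSet.{u}) = F x := by
  refine exists_elementaryEmbedding F hF fun n φ v hv => ?_
  have henc : ∀ {n : ℕ} {v : Fin n → ZFSet.{u}}, (∀ i, v i ∈ M) →
      F (enc n v) = enc n (fun i => F (v i)) := by
    intro n
    induction n with
    | zero => exact fun _ => hF0
    | succ n ih =>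
      intro v hv
      rw [enc, enc, hF2 (enc n (Fin.init v)) (hM.enc_mem fun i => hv i.castSucc) (v (Fin.last n))
        (hv _), ih (v := Fin.init v) fun i => hv i.castSucc]
      rfl
  obtain ⟨c, hc⟩ := exists_code.{u} φ
  rw [← hc M hM v hv, h c _ (hM.enc_mem hv), henc hv, hc N hN _ fun i => hF _ (hv i)]

/-- The Tarski–Vaught criterion. -/
theorem elemSub_of_realizeIn (hMX : M ⊆ X)
    (h : ∀ (n : ℕ) (φ : setLang.BoundedFormula Empty (n + 1)) (v : Fin n → ZFSet.{u}),
      (∀ i, v i ∈ M) → (∃ x ∈ X, RealizeIn φ X (Fin.snoc v x)) →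
        ∃ x ∈ M, RealizeIn φ X (Fin.snoc v x)) : ElemSub M X := by
  let i : M ↪[setLang] X :=
    { toFun := fun x => ⟨x, hMX x.2⟩
      inj' := fun x y e => Subtype.ext (congrArg Subtype.val e :)
      map_fun' := fun f => Empty.elim f
      map_rel' := fun r _ => by cases r; exact Iff.rfl }
  have key : ∀ {n : ℕ} (v : Fin n → M) (a : X), (fun k => ((Fin.snoc (i ∘ v) a :
      Fin (n + 1) → X) k : ZFSet.{u})) = Fin.snoc (fun k => (v k : ZFSet.{u})) a.1 := by
    intro n v a
    funext k
    refine Fin.lastCases ?_ (fun k => ?_) k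
    · simp
    · simp; rfl
  refine ⟨i.toElementaryEmbedding fun n φ v a ha => ?_, fun x => rfl⟩
  rw [← realizeIn_iff, key] at ha
  obtain ⟨b, hb, hb'⟩ := h n φ (fun k => v k) (fun k => (v k).2) ⟨a, a.2, ha⟩
  refine ⟨⟨b, hb⟩, ?_⟩
  rw [← realizeIn_iff, key]
  exact hb'

theorem elemSub_of_sat (hMX : M ⊆ X) (hM : PairClosed M) (hX : PairClosed X)
    (h : ∀ c : Code, ∀ t ∈ M, (∃ x ∈ X, sat X c (ZFSet.pair t x)) →
      ∃ x ∈ M, sat X c (ZFSet.pair t x)) : ElemSub M X := by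
  refine elemSub_of_realizeIn hMX fun n φ v hv hx => ?_
  obtain ⟨c, hc⟩ := exists_code.{u} φ
  have hc' : ∀ x ∈ X, sat X c (ZFSet.pair (enc n v) x) ↔ RealizeIn φ X (Fin.snoc v x) := by
    intro x hx
    rw [← enc_snoc]
    refine hc X hX _ fun i => ?_
    refine Fin.lastCases ?_ (fun i => ?_) i
    · simpa using hx
    · simpa using hMX (hv i)
  obtain ⟨x, hx, h'⟩ := hx
  obtain ⟨y, hy, h''⟩ := h c _ (hM.enc_mem hv) ⟨x, hx, (hc' x hx).2 h'⟩
  exact ⟨y, hy, (hc' y (hMX hy)).1 h''⟩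

/-- An elementary substructure meets the elements of its elements. -/
theorem ElemSub.inter (h : ElemSub M K) (hK : K.IsTransitive) (hX : X ∈ M) :
    ElemSub (M ∩ X) X := by
  refine elemSub_of_realizeIn (fun x hx => (ZFSet.mem_inter.1 hx).2) fun n φ v hv hx => ?_
  have hR : IsDef (fun (_ : ZFSet.{u}) (w : Option (Option (Fin n)) → ZFSet.{u}) =>
      w none ∈ w (some none) ∧ RealizeIn φ (w (some none))
        (Fin.snoc (fun i => w (some (some i))) (w none))) := by
    have := isDef_realizeIn φ (Fin.snoc (fun i => some (some i)) none :
      Fin (n + 1) → Option (Option (Fin n))) (some none)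
    have : IsDef (fun (_ : ZFSet.{u}) (w : Option (Option (Fin n)) → ZFSet.{u}) =>
        RealizeIn φ (w (some none)) (Fin.snoc (fun i => w (some (some i))) (w none))) := by
      refine this.congr fun W _ w _ => iff_of_eq (congrArg _ (funext fun i => ?_))
      refine Fin.lastCases ?_ (fun i => ?_) i <;> simp
    infer_instance
  obtain ⟨x, hx, h'⟩ := hx
  obtain ⟨y, hy, h1, h2⟩ := h.exists_mem hK (R := fun x _ (w : Option (Fin n) → ZFSet.{u}) =>
    x ∈ w none ∧ RealizeIn φ (w none) (Fin.snoc (fun i => w (some i)) x)) hR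
    (fun o => o.elim X v)
    (by rintro (_ | i); exacts [hX, (ZFSet.mem_inter.1 (hv i)).1])
    ⟨x, hK _ (h.subset hX) hx, hx, h'⟩
  exact ⟨y, ZFSet.mem_inter.2 ⟨hy, h1⟩, h2⟩

end Embedding

/-! ### Enumerated sets in elementary substructures -/

section Enumerates
variable {M K ν x t f : ZFSet.{u}}

theorem ElemSub.exists_enumerates (h : ElemSub M K) (hK : K.IsTransitive) (hνM : ν ∈ M)
    (hx : x ∈ M) (ht : t ∈ K) (hf : f ∈ K) (he : Enumerates ν t f) (hxt : x ∈ t) :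
    ∃ t ∈ M, ∃ f ∈ M, Enumerates ν t f ∧ x ∈ t := by
  obtain ⟨t, htM, f, hf, he, hxt⟩ := h.exists_mem hK
    (R := fun t W (v : Fin 2 → ZFSet.{u}) => ∃ f ∈ W, Enumerates (v 0) t f ∧ v 1 ∈ t)
    inferInstance ![ν, x] (by simp [Fin.forall_fin_succ, hνM, hx]) ⟨t, ht, f, hf, he, hxt⟩
  obtain ⟨f, hfM, he, -⟩ := h.exists_mem hK
    (R := fun f W (v : Fin 3 → ZFSet.{u}) => Enumerates (v 0) (v 2) f ∧ v 1 ∈ v 2)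
    inferInstance ![ν, x, t] (by simp [Fin.forall_fin_succ, hνM, hx, htM]) ⟨f, hf, he, hxt⟩
  exact ⟨t, htM, f, hfM, he, hxt⟩

/-- Each element of `t` is the value of `f` at some `a ∈ ν ⊆ M`, hence definable from two elements
of `M`. -/
theorem ElemSub.enumerates_subset (h : ElemSub M K) (hK : K.IsTransitive) (hν : ν ⊆ M)
    (ht : t ∈ M) (hf : f ∈ M) (he : Enumerates ν t f) : t ⊆ M := by
  intro y hy
  obtain ⟨a, ha, hp⟩ := he.2.2 y hy
  obtain ⟨z, hz, hz'⟩ := h.exists_mem hK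
    (R := fun y W (v : Fin 2 → ZFSet.{u}) => ZFSet.pair (v 1) y ∈ v 0)
    inferInstance ![f, a] (by simp [Fin.forall_fin_succ, hf, hν ha])
    ⟨y, hK _ (h.subset ht) hy, hp⟩
  have h1 := (pair_mem_iff_of_isFunc he.2.1 ha).1 hp
  have h2 := (pair_mem_iff_of_isFunc he.2.1 ha).1 hz'
  rw [h1, ← h2]
  exact hz

theorem ElemSub.subset_of_enumerates (h : ElemSub M K) (hK : K.IsTransitive) (hνM : ν ∈ M)
    (hν : ν ⊆ M) (hx : x ∈ M) (ht : t ∈ K) (hf : f ∈ K) (he : Enumerates ν t f) (hxt : x ∈ t) :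
    x ⊆ M := by
  obtain ⟨t, ht, f, hf, he, hxt⟩ := h.exists_enumerates hK hνM hx ht hf he hxt
  exact (he.1 _ hxt).trans (h.enumerates_subset hK hν ht hf he)

theorem ElemSub.isTransitive {κ : Cardinal.{u}} (hκ : Cardinal.aleph0 ≤ κ)
    (h : ElemSub M (H (Order.succ κ))) (hκM : cardSet κ ∈ M) (hκ' : cardSet κ ⊆ M) :
    M.IsTransitive := by
  intro x hx
  obtain ⟨t, f, he, hxt⟩ := (mem_H_succ_iff hκ).1 (h.subset hx)
  obtain ⟨ht, hf⟩ := he.mem_H (Cardinal.isRegular_succ hκ) (cardSet_mem_H (Order.lt_succ κ))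
  exact h.subset_of_enumerates isTransitive_H hκM hκ' hx ht hf he hxt

end Enumerates

/-! ### Transitive elementary substructures of `H(θ)` satisfy `ZFC⁻` -/

section ZFC

variable {M : ZFSet.{u}}

theorem isUPair_iff (hM : M.IsTransitive) (d x y : M) :
    IsUPair d x y ↔ d.1 = {x.1, y.1} := by
  constructor
  · intro h
    ext z
    rw [ZFSet.mem_pair]
    constructor
    · intro hz
      exact ((h ⟨z, hM _ d.2 hz⟩).1 hz).imp (congrArg Subtype.val) (congrArg Subtype.val)
    · rintro (rfl | rfl)
      exacts [(h x).2 (Or.inl rfl), (h y).2 (Or.inr rfl)]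
  · intro h z
    rw [mem_iff, h, ZFSet.mem_pair, Subtype.ext_iff, Subtype.ext_iff]

theorem rel_iff (hM : M.IsTransitive) (hM' : ∀ x ∈ M, ∀ y ∈ M, ({x, y} : ZFSet.{u}) ∈ M)
    (r x y : M) : Rel r x y ↔ ZFSet.pair x.1 y.1 ∈ r.1 := by
  constructor
  · rintro ⟨p, ⟨s, d, hs, hd, hp⟩, h⟩
    rw [isUPair_iff hM] at hs hd hp
    rw [ZFSet.pair, ← hd, ← ZFSet.pair_eq_singleton, ← hs, ← hp]
    exact h
  · intro h
    have hs := hM' x x.2 x x.2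
    have hd := hM' x x.2 y y.2
    refine ⟨⟨_, hM _ r.2 h⟩, ⟨⟨_, hs⟩, ⟨_, hd⟩, ?_, ?_, ?_⟩, h⟩
    · rw [isUPair_iff hM]
    · rw [isUPair_iff hM]
    · rw [isUPair_iff hM]
      simp only [ZFSet.pair, ZFSet.pair_eq_singleton]

/-- The formula `φ` holds in `⟨W, ∈⟩` at the points `v` of `W`. -/
def Holds {α : Type} (φ : setLang.Formula α) (W : ZFSet.{u}) (v : α → ZFSet.{u}) : Prop :=
  ∃ h : ∀ a, v a ∈ W, φ.Realize (M := W) (fun a => ⟨v a, h a⟩)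

theorem holds_iff {α : Type} {φ : setLang.Formula α} {v : α → M} :
    Holds φ M (fun a => v a) ↔ φ.Realize v :=
  ⟨fun h => h.2, fun h => ⟨fun a => (v a).2, h⟩⟩

theorem ElemSub.holds_iff {K : ZFSet.{u}} (h : ElemSub M K) {α : Type} {φ : setLang.Formula α}
    {v : α → ZFSet.{u}} (hv : ∀ a, v a ∈ M) : Holds φ M v ↔ Holds φ K v := by
  constructor
  · rintro ⟨_, h'⟩
    exact ⟨_, (h.realize_iff φ v hv).1 h'⟩
  · rintro ⟨_, h'⟩
    exact ⟨hv, (h.realize_iff φ v hv).2 h'⟩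

instance isDef_holds_cons {n : ℕ} {φ : setLang.Formula (Fin (n + 1))} {α : Type} {a : α}
    {f : Fin n → α} :
    IsDef (fun (W : ZFSet.{u}) v => Holds φ W (Fin.cons (v a) (fun i => v (f i)))) := by
  refine (isDef_formula φ (Fin.cons a f : Fin (n + 1) → α)).congr fun W _ v _ => ?_
  have : (fun i => v ((Fin.cons a f : Fin (n + 1) → α) i)) = Fin.cons (v a) (fun i => v (f i)) := by
    funext i
    refine Fin.cases ?_ (fun i => ?_) i <;> simp
  rw [← this]
  rfl

instance isDef_holds_cons₂ {n : ℕ} {φ : setLang.Formula (Fin (n + 2))} {α : Type} {a b : α}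
    {f : Fin n → α} :
    IsDef (fun (W : ZFSet.{u}) v =>
      Holds φ W (Fin.cons (v a) (Fin.cons (v b) (fun i => v (f i))))) := by
  refine (isDef_formula φ (Fin.cons a (Fin.cons b f) : Fin (n + 2) → α)).congr fun W _ v _ => ?_
  have : (fun i => v ((Fin.cons a (Fin.cons b f) : Fin (n + 2) → α) i)) =
      Fin.cons (v a) (Fin.cons (v b) (fun i => v (f i))) := by
    funext i
    refine Fin.cases ?_ (fun i => Fin.cases ?_ (fun i => ?_) i) i <;> simp
  rw [← this]
  rfl

theorem cons_val {n : ℕ} (x : M) (p : Fin n → M) :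
    (fun i => ((Fin.cons x p : Fin (n + 1) → M) i : ZFSet.{u})) =
      Fin.cons x.1 (fun i => (p i).1) := by
  funext i
  refine Fin.cases ?_ (fun i => ?_) i <;> simp

theorem holds_cons_iff {n : ℕ} {φ : setLang.Formula (Fin (n + 1))} (x : M) (p : Fin n → M) :
    Holds φ M (Fin.cons x.1 (fun i => (p i).1)) ↔ φ.Realize (Fin.cons x p : Fin (n + 1) → M) := by
  rw [← cons_val, holds_iff]

theorem holds_cons₂_iff {n : ℕ} {φ : setLang.Formula (Fin (n + 2))} (x y : M) (p : Fin n → M) :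
    Holds φ M (Fin.cons x.1 (Fin.cons y.1 (fun i => (p i).1))) ↔
      φ.Realize (Fin.cons x (Fin.cons y p) : Fin (n + 2) → M) := by
  rw [← cons_val, holds_cons_iff]

theorem cons_mem {n : ℕ} {W x : ZFSet.{u}} (hx : x ∈ W) {p : Fin n → ZFSet.{u}}
    (hp : ∀ i, p i ∈ W) : ∀ i, (Fin.cons x p : Fin (n + 1) → ZFSet.{u}) i ∈ W := by
  intro i
  refine Fin.cases ?_ (fun i => ?_) i
  · simpa using hx
  · simpa using hp i

variable {θ : Cardinal.{u}}

theorem ElemSub.upair_mem (hθ : θ.IsRegular) (h : ElemSub M (H θ)) {x y : ZFSet.{u}}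
    (hx : x ∈ M) (hy : y ∈ M) : ({x, y} : ZFSet.{u}) ∈ M := by
  obtain ⟨d, hd, h'⟩ := h.exists_mem isTransitive_H
    (R := fun d W (v : Fin 2 → ZFSet.{u}) => (∀ z ∈ d, z = v 0 ∨ z = v 1) ∧ v 0 ∈ d ∧ v 1 ∈ d)
    inferInstance ![x, y] (by simp [Fin.forall_fin_succ, hx, hy])
    ⟨{x, y}, upair_mem_H hθ (h.subset hx) (h.subset hy), by simp⟩
  have : d = {x, y} := by
    ext z
    rw [ZFSet.mem_pair]
    exact ⟨h'.1 z, fun e => e.elim (fun e => e ▸ h'.2.1) (fun e => e ▸ h'.2.2)⟩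
  rwa [← this]

theorem ElemSub.pair_mem (hθ : θ.IsRegular) (h : ElemSub M (H θ)) {x y : ZFSet.{u}}
    (hx : x ∈ M) (hy : y ∈ M) : ZFSet.pair x y ∈ M := by
  have := h.upair_mem hθ hx hx
  rw [ZFSet.pair_eq_singleton] at this
  exact h.upair_mem hθ this (h.upair_mem hθ hx hy)

theorem omega_properties : ∅ ∈ cardSet Cardinal.aleph0.{u} ∧
    ∀ x ∈ cardSet Cardinal.aleph0.{u}, insert x x ∈ cardSet Cardinal.aleph0.{u} := by
  rw [cardSet, Cardinal.ord_aleph0]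
  constructor
  · rw [← Ordinal.toZFSet_zero, Ordinal.toZFSet_mem_toZFSet_iff]
    exact Ordinal.omega0_pos
  · intro x hx
    obtain ⟨a, ha, rfl⟩ := Ordinal.mem_toZFSet_iff.1 hx
    rw [← Ordinal.toZFSet_add_one, Ordinal.toZFSet_mem_toZFSet_iff, ← Order.succ_eq_add_one]
    exact Ordinal.isSuccLimit_omega0.succ_lt ha

/-- Each existential axiom has a witness in `H(θ)`, by regularity of `θ`, and Tarski–Vaught moves it
into `M`. Transitivity of `M` ensures that the witness has the required elements in the sense of
`M`. Extensionality and foundation need transitivity only. -/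
theorem modelsZFCMinus_of_elemSub (hθ : θ.IsRegular) (hθ' : Cardinal.aleph0 < θ)
    (h : ElemSub M (H θ)) (hM : M.IsTransitive) : ModelsZFCMinus M where
  extensionality a b hab := Subtype.ext (ZFSet.ext fun z =>
    ⟨fun hz => (hab ⟨z, hM _ a.2 hz⟩).1 hz, fun hz => (hab ⟨z, hM _ b.2 hz⟩).2 hz⟩)
  foundation a ha := by
    obtain ⟨x, hx⟩ := ha
    obtain ⟨y, hy, hy'⟩ := ZFSet.regularity a.1 (by
      intro e
      rw [mem_iff, e] at hx
      exact ZFSet.notMem_empty _ hx)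
    refine ⟨⟨y, hM _ a.2 hy⟩, hy, fun z hz hza => ?_⟩
    have : z.1 ∈ a.1 ∩ y := ZFSet.mem_inter.2 ⟨hza, hz⟩
    rw [hy'] at this
    exact ZFSet.notMem_empty _ this
  pairing a b := ⟨⟨_, h.upair_mem hθ a.2 b.2⟩, (isUPair_iff hM _ _ _).2 rfl⟩
  union a := by
    obtain ⟨b, hb, h'⟩ := h.exists_mem isTransitive_H
      (R := fun b W (v : Fin 1 → ZFSet.{u}) => ∀ x ∈ W, x ∈ b ↔ ∃ y ∈ v 0, x ∈ y)
      inferInstance ![a] (by simp)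
      ⟨ZFSet.sUnion a, sUnion_mem_H (h.subset a.2), fun x _ => ZFSet.mem_sUnion⟩
    refine ⟨⟨b, hb⟩, fun x => (h' x (h.subset x.2)).trans ⟨?_, ?_⟩⟩
    · rintro ⟨y, hy, hxy⟩
      exact ⟨⟨y, hM _ a.2 hy⟩, hy, hxy⟩
    · rintro ⟨y, hy, hxy⟩
      exact ⟨y, hy, hxy⟩
  infinity := by
    obtain ⟨w, hw, ⟨e, he, he'⟩, h'⟩ := h.exists_mem isTransitive_H
      (R := fun w W (v : Fin 0 → ZFSet.{u}) => (∃ e ∈ w, ∀ z ∈ e, False) ∧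
        ∀ x ∈ w, ∃ y ∈ w, ∀ z ∈ W, z ∈ y ↔ z ∈ x ∨ z = x)
      inferInstance ![] (by simp)
      ⟨cardSet Cardinal.aleph0, cardSet_mem_H hθ', ⟨∅, omega_properties.1, by simp⟩,
        fun x hx => ⟨_, omega_properties.2 x hx, fun z _ => by
          rw [ZFSet.mem_insert_iff, or_comm]⟩⟩
    refine ⟨⟨w, hw⟩, ⟨⟨e, hM _ hw he⟩, he, fun z => he' z⟩, fun x hx => ?_⟩
    obtain ⟨y, hy, hy'⟩ := h' x hx
    refine ⟨⟨y, hM _ hw hy⟩, hy, fun z => (hy' z (h.subset z.2)).trans ?_⟩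
    rw [Subtype.ext_iff]
    rfl
  separation n φ p a := by
    obtain ⟨b, hb, h1, h2⟩ := h.exists_mem isTransitive_H
      (R := fun b W (v : Option (Fin n) → ZFSet.{u}) => b ⊆ v none ∧ ∀ x ∈ v none,
        x ∈ b ↔ Holds φ W (Fin.cons x (fun i => v (some i))))
      inferInstance (fun o => o.elim a (fun i => p i))
      (by rintro (_ | i); exacts [a.2, (p i).2])
      ⟨ZFSet.sep (fun x => Holds φ (H θ) (Fin.cons x (fun i => (p i).1))) a,
        mem_H_of_subset (h.subset a.2) ZFSet.sep_subset, ZFSet.sep_subset,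
        fun x hx => ZFSet.mem_sep.trans (and_iff_right hx)⟩
    refine ⟨⟨b, hb⟩, fun x => ?_⟩
    have : x.1 ∈ a.1 → (x.1 ∈ b ↔ φ.Realize (Fin.cons x p : Fin (n + 1) → M)) := by
      intro hx
      rw [h2 x.1 hx, ← holds_cons_iff, h.holds_iff (cons_mem x.2 fun i => (p i).2)]
      rfl
    exact ⟨fun hx => ⟨h1 hx, (this (h1 hx)).1 hx⟩, fun hx => (this hx.1).2 hx.2⟩
  collection n φ p a ha := by
    have h0 : ∀ x : ZFSet.{u}, ∃ y : ZFSet.{u}, x ∈ a.1 →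
        Holds φ (H θ) (Fin.cons x (Fin.cons y (fun i => (p i).1))) := by
      intro x
      by_cases hx : x ∈ a.1
      · obtain ⟨y, hy⟩ := ha ⟨x, hM _ a.2 hx⟩ hx
        rw [← holds_cons₂_iff,
          h.holds_iff (cons_mem (hM _ a.2 hx) (cons_mem y.2 fun i => (p i).2))] at hy
        exact ⟨y, fun _ => hy⟩
      · exact ⟨∅, fun h => (hx h).elim⟩
    -- The range of a choice function on `a` is a collecting set: it has size less than `θ`.
    choose F hF using h0
    obtain ⟨b, hb, h'⟩ := h.exists_mem isTransitive_H
      (R := fun b W (v : Option (Fin n) → ZFSet.{u}) => ∀ x ∈ v none, ∃ y ∈ b,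
        Holds φ W (Fin.cons x (Fin.cons y (fun i => v (some i)))))
      inferInstance (fun o => o.elim a (fun i => p i))
      (by rintro (_ | i); exacts [a.2, (p i).2])
      ⟨ZFSet.range (fun x : a.1 => F x), mem_H_of_card_lt hθ (fun y hy => by
          obtain ⟨x, rfl⟩ := ZFSet.mem_range.1 hy
          obtain ⟨h', -⟩ := hF x x.2
          simpa using h' 1)
        ((card_range_le _).trans_lt (card_lt_of_mem_H (h.subset a.2))),
        fun x hx => ⟨F x, ZFSet.mem_range.2 ⟨⟨x, hx⟩, rfl⟩, hF x hx⟩⟩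
    refine ⟨⟨b, hb⟩, fun x hx => ?_⟩
    obtain ⟨y, hy, hxy⟩ := h' x hx
    have hyM := hM _ hb hy
    refine ⟨⟨y, hyM⟩, hy, ?_⟩
    rw [← holds_cons₂_iff, h.holds_iff (cons_mem x.2 (cons_mem hyM fun i => (p i).2))]
    exact hxy
  wellOrdering a := by
    obtain ⟨r, hr, h1, h2, h3, h4⟩ := h.exists_mem isTransitive_H
      (R := fun r W (v : Fin 1 → ZFSet.{u}) =>
        (∀ x ∈ v 0, ZFSet.pair x x ∉ r) ∧
        (∀ x ∈ v 0, ∀ y ∈ v 0, ∀ z ∈ v 0, ZFSet.pair x y ∈ r → ZFSet.pair y z ∈ r →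
          ZFSet.pair x z ∈ r) ∧
        (∀ x ∈ v 0, ∀ y ∈ v 0, ZFSet.pair x y ∈ r ∨ x = y ∨ ZFSet.pair y x ∈ r) ∧
        -- The clause with `¬ False` says that `b` is nonempty, in a form made of connectives that
        -- have `IsDef` instances.
        ∀ b ∈ W, b ⊆ v 0 → (∃ x ∈ b, ¬ False) →
          ∃ x ∈ b, ∀ y ∈ b, y ≠ x → ZFSet.pair x y ∈ r)
      inferInstance ![a] (by simp)
      (by
        have hmem : ∀ x ∈ a.1, ∀ y ∈ a.1, ZFSet.pair x y ∈ ZFSet.sep (fun p => ∃ x y,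
            p = ZFSet.pair x y ∧ WellOrderingRel x y) (ZFSet.prod a a) ↔ WellOrderingRel x y := by
          intro x hx y hy
          rw [ZFSet.mem_sep, ZFSet.pair_mem_prod]
          constructor
          · rintro ⟨-, x', y', e, hxy⟩
            obtain ⟨rfl, rfl⟩ := ZFSet.pair_inj.1 e
            exact hxy
          · exact fun hxy => ⟨⟨hx, hy⟩, x, y, rfl, hxy⟩
        refine ⟨_, mem_H_of_subset (prod_mem_H hθ (h.subset a.2) (h.subset a.2)) (x := ZFSet.sep
          (fun p => ∃ x y, p = ZFSet.pair x y ∧ WellOrderingRel x y) (ZFSet.prod a a))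
          ZFSet.sep_subset, fun x hx => ?_, fun x hx y hy z hz => ?_, fun x hx y hy => ?_,
          fun b _ hb hne => ?_⟩
        · exact fun h => irrefl_of WellOrderingRel x ((hmem x hx x hx).1 h)
        · rw [hmem x hx y hy, hmem y hy z hz, hmem x hx z hz]
          exact _root_.trans
        · rw [hmem x hx y hy, hmem y hy x hx]
          exact trichotomous_of WellOrderingRel x y
        · obtain ⟨x, hx, -⟩ := hne
          obtain ⟨m, hm, hm'⟩ := (IsWellFounded.wf (r := WellOrderingRel (α := ZFSet.{u}))).has_min
            (b : Set ZFSet.{u}) ⟨x, hx⟩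
          refine ⟨m, hm, fun y hy hne => ?_⟩
          refine (hmem m (hb hm) y (hb hy)).2 ?_
          rcases trichotomous_of WellOrderingRel m y with h | h | h
          · exact h
          · exact (hne h.symm).elim
          · exact (hm' y hy h).elim)
    refine ⟨⟨r, hr⟩, ?_⟩
    simp only [rel_iff hM (fun x hx y hy => h.upair_mem hθ hx hy)]
    refine ⟨fun x hx => h1 x hx, fun x y z hx hy hz => h2 x hx y hy z hz, fun x y hx hy => ?_,
      fun b hb hne => ?_⟩
    · rw [Subtype.ext_iff]
      exact h3 x hx y hy
    · obtain ⟨x, hx⟩ := hne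
      obtain ⟨y, hy, hy'⟩ := h4 b (h.subset b.2) (fun z hz => hb ⟨z, hM _ b.2 hz⟩ hz)
        ⟨x, hx, not_false⟩
      exact ⟨⟨y, hM _ b.2 hy⟩, hy, fun z hz hne => hy' z hz fun e => hne (Subtype.ext e)⟩

end ZFC

/-! ### The Mostowski collapse -/

/-- The Mostowski collapse of the membership relation on `Y`. -/
noncomputable def collapse (Y x : ZFSet.{u}) : ZFSet.{u} :=
  ZFSet.range (fun z : (x ∩ Y : ZFSet.{u}) => collapse Y z)
termination_by x
decreasing_by exact (ZFSet.mem_inter.1 z.2).1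

section Collapse
variable {Y x y w : ZFSet.{u}}

theorem mem_collapse : w ∈ collapse Y x ↔ ∃ z ∈ Y, z ∈ x ∧ collapse Y z = w := by
  rw [collapse, ZFSet.mem_range]
  constructor
  · rintro ⟨⟨z, hz⟩, h⟩
    exact ⟨z, (ZFSet.mem_inter.1 hz).2, (ZFSet.mem_inter.1 hz).1, h⟩
  · rintro ⟨z, h1, h2, h3⟩
    exact ⟨⟨z, ZFSet.mem_inter.2 ⟨h2, h1⟩⟩, h3⟩

/-- The image of the Mostowski collapse. -/
noncomputable def collapseImage (Y : ZFSet.{u}) : ZFSet.{u} :=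
  ZFSet.range (fun z : Y => collapse Y z)

theorem mem_collapseImage : w ∈ collapseImage Y ↔ ∃ z ∈ Y, collapse Y z = w := by
  simp [collapseImage]

theorem isTransitive_collapseImage : (collapseImage Y).IsTransitive := by
  intro x hx y hy
  obtain ⟨z, -, rfl⟩ := mem_collapseImage.1 hx
  obtain ⟨w, hw, -, rfl⟩ := mem_collapse.1 hy
  exact mem_collapseImage.2 ⟨w, hw, rfl⟩

theorem card_collapseImage_le : (collapseImage Y).card ≤ Y.card := card_range_le _

theorem collapse_injective (hY : ∀ x ∈ Y, ∀ y ∈ Y, (∀ z ∈ Y, z ∈ x ↔ z ∈ y) → x = y) :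
    ∀ x ∈ Y, ∀ y ∈ Y, collapse Y x = collapse Y y → x = y := by
  intro x
  induction x using ZFSet.inductionOn with
  | _ x ih =>
    intro hx y hy h
    refine hY x hx y hy fun z hz => ⟨fun hzx => ?_, fun hzy => ?_⟩
    · have := mem_collapse.2 ⟨z, hz, hzx, rfl⟩
      rw [h] at this
      obtain ⟨z', hz', hzy, e⟩ := mem_collapse.1 this
      rwa [ih z hzx hz z' hz' e.symm]
    · have := mem_collapse.2 ⟨z, hz, hzy, rfl⟩
      rw [← h] at this
      obtain ⟨z', hz', hzx, e⟩ := mem_collapse.1 this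
      rwa [← ih z' hzx hz' z hz e]

theorem collapse_eq_self_of_mem {t : ZFSet.{u}} (ht : t.IsTransitive) (htY : t ⊆ Y) :
    ∀ x ∈ t, collapse Y x = x := by
  intro x
  induction x using ZFSet.inductionOn with
  | _ x ih =>
    intro hx
    ext w
    rw [mem_collapse]
    constructor
    · rintro ⟨z, -, hzx, rfl⟩
      rwa [ih z hzx (ht _ hx hzx)]
    · intro hw
      exact ⟨w, htY (ht _ hx hw), hw, ih w hw (ht _ hx hw)⟩

theorem collapse_eq_self_of_subset {t : ZFSet.{u}} (ht : t.IsTransitive) (htY : t ⊆ Y)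
    (hx : x ⊆ t) : collapse Y x = x := by
  ext w
  rw [mem_collapse]
  constructor
  · rintro ⟨z, -, hzx, rfl⟩
    rwa [collapse_eq_self_of_mem ht htY z (hx hzx)]
  · intro hw
    exact ⟨w, htY (hx hw), hw, collapse_eq_self_of_mem ht htY w (hx hw)⟩

theorem exists_collapse_embedding
    (hY : ∀ x ∈ Y, ∀ y ∈ Y, (∀ z ∈ Y, z ∈ x ↔ z ∈ y) → x = y) :
    ∃ e : Y ↪ₑ[setLang] (collapseImage Y), ∀ x : Y, (e x : ZFSet.{u}) = collapse Y x := by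
  have hinj := collapse_injective hY
  let f : Y → collapseImage Y := fun x => ⟨collapse Y x, mem_collapseImage.2 ⟨x, x.2, rfl⟩⟩
  have hf : Function.Bijective f := by
    refine ⟨fun x y h => Subtype.ext (hinj x x.2 y y.2 (congrArg Subtype.val h)), fun ⟨w, hw⟩ => ?_⟩
    obtain ⟨z, hz, e⟩ := mem_collapseImage.1 hw
    exact ⟨⟨z, hz⟩, Subtype.ext e⟩
  let e : Y ≃[setLang] (collapseImage Y) :=
    { Equiv.ofBijective f hf with
      map_fun' := fun g => Empty.elim g
      map_rel' := fun r v => by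
        cases r
        change collapse Y (v 0) ∈ collapse Y (v 1) ↔ (v 0).1 ∈ (v 1).1
        rw [mem_collapse]
        constructor
        · rintro ⟨z, hz, hz', h⟩
          rwa [← hinj z hz _ (v 0).2 h]
        · exact fun h => ⟨_, (v 0).2, h, rfl⟩ }
  exact ⟨e.toElementaryEmbedding, fun x => rfl⟩

end Collapse

/-! ### Löwenheim–Skolem, and shrinking the target of an embedding -/

section LowenheimSkolem

variable {M N K : ZFSet.{u}}

theorem realizeIn_app (j : M ↪ₑ[setLang] N) {n : ℕ} (φ : setLang.BoundedFormula Empty n)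
    {v : Fin n → ZFSet.{u}} (hv : ∀ i, v i ∈ M) :
    RealizeIn φ M v ↔ RealizeIn φ N (fun i => app j (v i)) := by
  have h1 := realizeIn_iff (φ := φ) (fun i => (⟨v i, hv i⟩ : M))
  have h2 := realizeIn_iff (φ := φ) (j ∘ (fun i => (⟨v i, hv i⟩ : M)))
  have h3 := j.map_boundedFormula φ default (fun i => (⟨v i, hv i⟩ : M))
  rw [Subsingleton.elim (j ∘ default) default] at h3
  have h4 : (fun i => app j (v i)) = fun i => ((j ∘ (fun i => (⟨v i, hv i⟩ : M))) i : ZFSet.{u}) :=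
    funext fun i => app_of_mem j (hv i)
  rw [h4, h2, h3, h1]

theorem ElemSub.realizeIn_iff (h : ElemSub M K) {n : ℕ} (φ : setLang.BoundedFormula Empty n)
    {v : Fin n → ZFSet.{u}} (hv : ∀ i, v i ∈ M) : RealizeIn φ M v ↔ RealizeIn φ K v := by
  obtain ⟨i, hi⟩ := h
  rw [realizeIn_app i φ hv]
  exact iff_of_eq (congrArg _ (funext fun k => (app_of_mem i (hv k)).trans (hi _)))

theorem ElemSub.extensional (h : ElemSub M K) (hK : K.IsTransitive) :
    ∀ x ∈ M, ∀ y ∈ M, (∀ z ∈ M, z ∈ x ↔ z ∈ y) → x = y := by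
  intro x hx y hy hxy
  by_contra hne
  have : ∃ z ∈ K, ¬ (z ∈ x ↔ z ∈ y) := by
    by_contra! hcon
    refine hne (ZFSet.ext fun z => ?_)
    by_cases hz : z ∈ K
    · exact hcon z hz
    · exact ⟨fun h' => (hz (hK _ (h.subset hx) h')).elim,
        fun h' => (hz (hK _ (h.subset hy) h')).elim⟩
  obtain ⟨z, hz, h'⟩ := h.exists_mem hK
    (R := fun z W (v : Fin 2 → ZFSet.{u}) => ¬ (z ∈ v 0 ↔ z ∈ v 1))
    inferInstance ![x, y] (by simp [Fin.forall_fin_succ, hx, hy]) this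
  exact h' (hxy z hz)

theorem card_setLang_le : setLang.card ≤ Cardinal.aleph0 := by
  have h1 : ∀ n, Countable (setLang.Functions n) := fun n => inferInstanceAs (Countable Empty)
  have h2 : ∀ n, Countable (setLang.Relations n) := by
    intro n
    have : Subsingleton (setLang.Relations n) := ⟨fun a b => by cases a; cases b; rfl⟩
    infer_instance
  exact Cardinal.mk_le_aleph0_iff.2 inferInstance

/-- The downward Löwenheim–Skolem theorem. -/
theorem exists_elemSub_card_eq {κ : Cardinal.{u}} (hκ : Cardinal.aleph0 ≤ κ) {s N : ZFSet.{u}}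
    (hs : s ⊆ N) (hsc : s.card ≤ κ) (hN : κ ≤ N.card) :
    ∃ Y : ZFSet.{u}, s ⊆ Y ∧ ElemSub Y N ∧ Y.card = κ := by
  have hs' : Cardinal.mk {x : N | x.1 ∈ s} ≤ Cardinal.lift.{u + 1} κ := by
    have : Cardinal.mk {x : N | x.1 ∈ s} ≤ Cardinal.mk s :=
      Cardinal.mk_le_of_injective (f := fun x => ⟨x.1.1, x.2⟩) fun x y h =>
        Subtype.ext (Subtype.ext (congrArg Subtype.val h :))
    rw [ZFSet.cardinalMk_coe_sort] at this
    exact this.trans (Cardinal.lift_le.2 hsc)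
  obtain ⟨S, hS, hSc⟩ := Language.exists_elementarySubstructure_card_eq setLang
    (M := N) {x : N | x.1 ∈ s} κ hκ
    (by rw [Cardinal.lift_id'.{u, u + 1}]; exact hs')
    (by
      have := Cardinal.lift_le.{u}.2 card_setLang_le
      rw [Cardinal.lift_aleph0] at this
      exact this.trans (by simpa using hκ))
    (by simpa [ZFSet.cardinalMk_coe_sort] using hN)
  let Y := ZFSet.sep (fun x => ∃ h : x ∈ N, (⟨x, h⟩ : N) ∈ S) N
  have hY : ∀ {x}, x ∈ Y ↔ ∃ h : x ∈ N, (⟨x, h⟩ : N) ∈ S := fun {x} => by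
    rw [ZFSet.mem_sep]
    exact and_iff_right_of_imp fun h => h.1
  let e : Y ≃[setLang] S :=
    { toFun := fun x => ⟨⟨x, (hY.1 x.2).1⟩, (hY.1 x.2).2⟩
      invFun := fun x => ⟨x.1.1, hY.2 ⟨x.1.2, x.2⟩⟩
      left_inv := fun x => rfl
      right_inv := fun x => rfl
      map_fun' := fun g => Empty.elim g
      map_rel' := fun r v => by cases r; exact Iff.rfl }
  refine ⟨Y, fun x hx => hY.2 ⟨hs hx, hS hx⟩, ⟨S.subtype.comp e.toElementaryEmbedding,
    fun x => rfl⟩, ?_⟩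
  have h1 : Cardinal.mk Y = Cardinal.mk S := Cardinal.mk_congr e.toEquiv
  rw [ZFSet.cardinalMk_coe_sort] at h1
  have h2 : Cardinal.lift.{u + 1} Y.card = Cardinal.lift.{u + 1} κ := by
    rw [h1, ← hSc, Cardinal.lift_id'.{u, u + 1}]
  exact Cardinal.lift_injective h2

/-- Take `Y ≺ N` of size `κ` that includes the range of `j` and `M ∩ N`, and collapse it. As `M ∩ N`
contains `κ`, its elements and all subsets of `κ` in `M`, the collapse fixes all of these. So the
critical point and the subsets of `κ` are unchanged. -/
theorem PowersetPreserving.exists_small {κ : Cardinal.{u}} (hκ : Cardinal.aleph0 ≤ κ)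
    (hM : M.card = κ) (hκM : cardSet κ ∈ M) (hκM' : cardSet κ ⊆ M)
    (hN : N.IsTransitive) {j : M ↪ₑ[setLang] N} (hj : PowersetPreserving κ j) :
    ∃ N' : ZFSet.{u}, N'.IsTransitive ∧ N'.card ≤ κ ∧
      ∃ j' : M ↪ₑ[setLang] N', PowersetPreserving κ j' := by
  have hκN : cardSet κ ∈ N := (hj.same_subsets _ fun _ h => h).1 hκM
  have hκN' : cardSet κ ⊆ N := hN _ hκN
  obtain ⟨Y, hsY, hYN, hYc⟩ := exists_elemSub_card_eq hκ (N := N)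
    (s := ZFSet.range (fun x : M => (j x).1) ∪ (M ∩ N)) (by
      intro x hx
      rcases ZFSet.mem_union.1 hx with hx | hx
      · obtain ⟨y, rfl⟩ := ZFSet.mem_range.1 hx
        exact (j y).2
      · exact (ZFSet.mem_inter.1 hx).2)
    (by
      refine ZFSet.card_union_le.trans (Cardinal.add_le_of_le hκ ?_ ?_)
      · exact (card_range_le _).trans hM.le
      · exact (ZFSet.card_mono fun x hx => (ZFSet.mem_inter.1 hx).1).trans hM.le)
    (by
      have := ZFSet.card_mono hκN'
      rwa [card_cardSet] at this)
  have hjY : ∀ x ∈ M, app j x ∈ Y := fun x hx => hsY (ZFSet.mem_union.2 (Or.inl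
    (ZFSet.mem_range.2 ⟨⟨x, hx⟩, (app_of_mem j hx).symm⟩)))
  have hMN : ∀ x ∈ M, x ∈ N → x ∈ Y := fun x h1 h2 =>
    hsY (ZFSet.mem_union.2 (Or.inr (ZFSet.mem_inter.2 ⟨h1, h2⟩)))
  obtain ⟨j₁, hj₁⟩ := exists_elementaryEmbedding (app j) hjY fun n φ v hv => by
    rw [realizeIn_app j φ hv, hYN.realizeIn_iff φ fun i => hjY _ (hv i)]
  obtain ⟨e, he⟩ := exists_collapse_embedding (hYN.extensional hN)
  have hinj := collapse_injective (hYN.extensional hN)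
  have hκY : cardSet κ ∈ Y := hMN _ hκM hκN
  have hκY' : cardSet κ ⊆ Y := fun x hx => hMN _ (hκM' hx) (hκN' hx)
  have htr := (isOrdinal_cardSet κ).isTransitive
  have hval : ∀ x : M, (e.comp j₁ x : ZFSet.{u}) = collapse Y (j x) := fun x => by
    rw [Language.ElementaryEmbedding.comp_apply, he, hj₁, app_of_mem j x.2]
  refine ⟨collapseImage Y, isTransitive_collapseImage, card_collapseImage_le.trans hYc.le,
    e.comp j₁, ?_, ?_, ?_⟩
  · intro x hx
    rw [hval, hj.fixes x hx]
    exact collapse_eq_self_of_mem htr hκY' _ hx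
  · obtain ⟨x, hx, hne⟩ := hj.moves
    refine ⟨x, hx, fun h => hne ?_⟩
    have hxY : x.1 ∈ Y := hx ▸ hκY
    have hx' : collapse Y x = x := by
      rw [hx]
      exact collapse_eq_self_of_subset htr hκY' fun _ h => h
    refine hinj _ ?_ _ hxY ?_
    · rw [← app_of_mem j x.2]; exact hjY _ x.2
    · rw [hx', ← h, hval]
  · intro A hA
    constructor
    · intro hAM
      exact mem_collapseImage.2 ⟨A, hMN _ hAM ((hj.same_subsets A hA).1 hAM),
        collapse_eq_self_of_subset htr hκY' hA⟩
    · intro hAN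
      obtain ⟨x, hx, rfl⟩ := mem_collapseImage.1 hAN
      -- An element of `x` outside of `κ` could be found in `Y`. Its collapse lies in `A ⊆ κ`, and
      -- the collapse is injective and fixes `κ` pointwise, so the element would be in `κ` after
      -- all.
      have hxκ : x ⊆ cardSet κ := by
        intro z hz
        by_contra hzκ
        obtain ⟨z, hzY, hz, hzκ⟩ := hYN.exists_mem hN
          (R := fun z W (v : Fin 2 → ZFSet.{u}) => z ∈ v 0 ∧ z ∉ v 1)
          inferInstance ![x, cardSet κ] (by simp [Fin.forall_fin_succ, hx, hκY])
          ⟨z, hN _ (hYN.subset hx) hz, hz, hzκ⟩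
        have h1 := hA (mem_collapse.2 ⟨z, hzY, hz, rfl⟩)
        have h2 := hinj _ (hκY' h1) _ hzY (collapse_eq_self_of_mem htr hκY' _ h1)
        rw [h2] at h1
        exact hzκ h1
      rw [collapse_eq_self_of_subset htr hκY' hxκ]
      exact (hj.same_subsets x hxκ).2 (hYN.subset hx)

end LowenheimSkolem

/-! ### Restricting the embedding to `H(κ⁺)` -/

/-- `κ` is super weakly Ramsey, and super Ramsey if `b` holds. -/
def SuperRamseyIf (b : Prop) (κ : Cardinal.{u}) : Prop :=
  ∀ A : ZFSet.{u}, A ⊆ cardSet κ → ∃ M : ZFSet.{u}, A ∈ M ∧ IsWeakModel κ M ∧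
    (b → ClosedUnderSeq κ M) ∧ ElemSub M (H (Order.succ κ)) ∧ HasPowersetPreservingEmbedding κ M

theorem superRamseyIf_true {κ : Cardinal.{u}} : SuperRamseyIf True κ ↔ SuperRamsey κ := by
  simp only [SuperRamseyIf, SuperRamsey, IsModel, true_imp_iff, and_assoc]

theorem superRamseyIf_false {κ : Cardinal.{u}} : SuperRamseyIf False κ ↔ SuperWeaklyRamsey κ := by
  simp only [SuperRamseyIf, SuperWeaklyRamsey, false_imp_iff, true_and]

/-- In the sense of `W`, the set `X` consists of the elements of the transitive sets onto which `ν`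
can be mapped. -/
def IsHSucc (W ν X : ZFSet.{u}) : Prop :=
  ∀ y ∈ W, y ∈ X ↔ ∃ t ∈ W, ∃ f ∈ W, Enumerates ν t f ∧ y ∈ t

instance isDef_isHSucc {α : Type} {a b : α} :
    IsDef (fun (W : ZFSet.{u}) v => IsHSucc W (v a) (v b)) := by
  unfold IsHSucc
  infer_instance

theorem isHSucc_unique {W ν X Y : ZFSet.{u}} (hW : W.IsTransitive) (hX : X ∈ W) (hY : Y ∈ W)
    (h : IsHSucc W ν X) (h' : IsHSucc W ν Y) : X = Y :=
  ZFSet.ext fun y => ⟨fun hy => (h' y (hW _ hX hy)).2 ((h y (hW _ hX hy)).1 hy),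
    fun hy => (h y (hW _ hY hy)).2 ((h' y (hW _ hY hy)).1 hy)⟩

theorem isHSucc_H {ν θ : Cardinal.{u}} (hν : Cardinal.aleph0 ≤ ν) (h : Order.succ ν ≤ θ) :
    IsHSucc (H θ) (cardSet ν) (H (Order.succ ν)) := by
  intro y _
  rw [mem_H_succ_iff hν]
  constructor
  · rintro ⟨t, f, he, hy⟩
    obtain ⟨ht, hf⟩ := he.mem_H (Cardinal.isRegular_succ hν) (cardSet_mem_H (Order.lt_succ ν))
    exact ⟨t, H_subset_H h ht, f, H_subset_H h hf, he, hy⟩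
  · rintro ⟨t, -, f, -, h⟩
    exact ⟨t, f, h⟩

/-- A weak `κ`-model which is an elementary substructure of `H(θ)`, where `θ` is large, together
with a powerset preserving embedding. -/
structure Setup (κ θ : Cardinal.{u}) {M N : ZFSet.{u}} (j : M ↪ₑ[setLang] N) : Prop where
  regular : κ.IsRegular
  regular' : θ.IsRegular
  mem_H : H (Order.succ κ) ∈ H θ
  model : IsWeakModel κ M
  elemSub : ElemSub M (H θ)
  isTransitive : N.IsTransitive
  preserving : PowersetPreserving κ j

namespace Setup
variable {κ θ : Cardinal.{u}} {M N : ZFSet.{u}} {j : M ↪ₑ[setLang] N} (S : Setup κ θ j)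
include S

theorem transfer {α : Type} {P : ZFSet.{u} → (α → ZFSet.{u}) → Prop} (hP : IsDef P)
    (v : α → ZFSet.{u}) (hv : ∀ a, v a ∈ M) : P (H θ) v ↔ P N (fun a => app j (v a)) :=
  hP.transfer S.elemSub isTransitive_H S.isTransitive j v hv

theorem exists_mem {α : Type} {R : ZFSet.{u} → ZFSet.{u} → (α → ZFSet.{u}) → Prop}
    (hR : IsDef (fun W (v : Option α → ZFSet.{u}) => R (v none) W (fun a => v (some a))))
    (v : α → ZFSet.{u}) (hv : ∀ a, v a ∈ M) (hx : ∃ x ∈ H θ, R x (H θ) v) :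
    ∃ x ∈ M, R x (H θ) v :=
  S.elemSub.exists_mem isTransitive_H hR v hv hx

/-- All subsets of `κ` are in `H(κ⁺)`, so `κ < 2 ^ κ ≤ |H(κ⁺)| < θ`. -/
theorem succ_le : Order.succ κ ≤ θ := by
  have := card_lt_of_mem_H S.mem_H
  refine le_of_lt (lt_of_le_of_lt ?_ this)
  refine Order.succ_le_of_lt ?_
  have h1 : (ZFSet.powerset (cardSet κ)).card = 2 ^ κ := by
    rw [ZFSet.card_powerset, card_cardSet]
  refine (Cardinal.cantor κ).trans_le (h1 ▸ ZFSet.card_mono ?_)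
  intro x hx
  exact mem_H_of_subset (cardSet_mem_H (Order.lt_succ κ)) (ZFSet.mem_powerset.1 hx)

theorem app_eq_self {a : ZFSet.{u}} (ha : a ∈ cardSet κ) : app j a = a := by
  rw [app_of_mem j (S.model.subset ha)]
  exact S.preserving.fixes _ ha

theorem cardSet_mem_target : cardSet κ ∈ N :=
  (S.preserving.same_subsets _ fun _ h => h).1 S.model.mem

theorem isOrdinal_app : (app j (cardSet κ)).IsOrdinal :=
  (S.transfer (P := fun _ (v : Fin 1 → ZFSet.{u}) => (v 0).IsOrdinal) inferInstance
    ![cardSet κ] (by simp [S.model.mem])).1 (isOrdinal_cardSet κ)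

/-- Below `κ` the embedding is the identity, so `κ ⊆ j(κ)`. Both are ordinals, and equality would
contradict that `κ` is moved. -/
theorem cardSet_mem_app : cardSet κ ∈ app j (cardSet κ) := by
  have h1 : cardSet κ ⊆ app j (cardSet κ) := by
    intro a ha
    have := (S.transfer (P := fun _ (v : Fin 2 → ZFSet.{u}) => v 0 ∈ v 1) inferInstance
      ![a, cardSet κ] (by simp [Fin.forall_fin_succ, S.model.mem, S.model.subset ha])).1 ha
    have h2 : app j a ∈ app j (cardSet κ) := this
    rwa [S.app_eq_self ha] at h2
  rcases ((isOrdinal_cardSet κ).subset_iff_eq_or_mem S.isOrdinal_app).1 h1 with h | h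
  · obtain ⟨x, hx, hne⟩ := S.preserving.moves
    refine (hne ?_).elim
    rw [← app_of_mem j x.2, hx, ← h]
  · exact h

/-- Every element of `ω` is empty or has a largest element. If `κ` were `ω`, the same would hold for
every element of `j(κ)`, in particular for `ω` itself. -/
theorem aleph0_lt : Cardinal.aleph0 < κ := by
  refine lt_of_le_of_ne S.regular.aleph0_le fun h => ?_
  have hω : ∀ x ∈ cardSet κ, (∀ z ∈ x, False) ∨ ∃ y ∈ x, ∀ z ∈ x, z ∈ y ∨ z = y := by
    intro x hx
    rw [← h, cardSet, Cardinal.ord_aleph0] at hx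
    obtain ⟨a, ha, rfl⟩ := Ordinal.mem_toZFSet_iff.1 hx
    obtain ⟨n, rfl⟩ := Ordinal.lt_omega0.1 ha
    rcases n with _ | n
    · left; simp
    · right
      rw [Nat.cast_succ, Ordinal.toZFSet_add_one]
      refine ⟨_, ZFSet.mem_insert _ _, fun z hz => ?_⟩
      rwa [ZFSet.mem_insert_iff, or_comm] at hz
  have := (S.transfer (P := fun _ (v : Fin 1 → ZFSet.{u}) => ∀ x ∈ v 0,
      (∀ z ∈ x, False) ∨ ∃ y ∈ x, ∀ z ∈ x, z ∈ y ∨ z = y) inferInstance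
    ![cardSet κ] (by simp [S.model.mem])).1 hω _ S.cardSet_mem_app
  have hω' := omega_properties.{u}
  rw [h] at hω'
  rcases this with h' | ⟨y, hy, h'⟩
  · exact h' _ hω'.1
  · rcases h' _ (hω'.2 y hy) with h'' | h''
    · exact ZFSet.mem_asymm h'' (ZFSet.mem_insert _ _)
    · have := ZFSet.mem_insert y y
      rw [h''] at this
      exact ZFSet.mem_irrefl _ this

/-- `H(κ⁺)` is the only element of `H(θ)` that satisfies `IsHSucc` for `κ`, hence definable from `κ
∈ M`. -/
theorem H_mem : H (Order.succ κ) ∈ M := by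
  have h0 := isHSucc_H S.regular.aleph0_le S.succ_le
  obtain ⟨X, hX, h⟩ := S.exists_mem (R := fun X W (v : Fin 1 → ZFSet.{u}) => IsHSucc W (v 0) X)
    inferInstance ![cardSet κ] (by simp [S.model.mem]) ⟨_, S.mem_H, h0⟩
  rwa [isHSucc_unique isTransitive_H S.mem_H (S.elemSub.subset hX) h0 h]

theorem exists_enumerates {x : ZFSet.{u}} (hx : x ∈ M) (hx' : x ∈ H (Order.succ κ)) :
    ∃ t ∈ M, ∃ f ∈ M, Enumerates (cardSet κ) t f ∧ x ∈ t := by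
  obtain ⟨t, ht, f, hf, he, hxt⟩ := (isHSucc_H S.regular.aleph0_le S.succ_le x
    (S.elemSub.subset hx)).1 hx'
  exact S.elemSub.exists_enumerates isTransitive_H S.model.mem hx ht hf he hxt

theorem enumerates_subset {t f : ZFSet.{u}} (ht : t ∈ M) (hf : f ∈ M)
    (he : Enumerates (cardSet κ) t f) : t ⊆ M :=
  S.elemSub.enumerates_subset isTransitive_H S.model.subset ht hf he

theorem isTransitive_inter : (M ∩ H (Order.succ κ)).IsTransitive := by
  intro x hx y hy
  rw [ZFSet.mem_inter] at hx
  obtain ⟨t, ht, f, hf, he, hxt⟩ := S.exists_enumerates hx.1 hx.2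
  exact ZFSet.mem_inter.2
    ⟨S.enumerates_subset ht hf he (he.1 _ hxt hy), isTransitive_H _ hx.2 hy⟩

theorem elemSub_inter : ElemSub (M ∩ H (Order.succ κ)) (H (Order.succ κ)) :=
  S.elemSub.inter isTransitive_H S.H_mem

theorem cardSet_mem_inter : cardSet κ ∈ M ∩ H (Order.succ κ) :=
  ZFSet.mem_inter.2 ⟨S.model.mem, cardSet_mem_H (Order.lt_succ κ)⟩

theorem isWeakModel_inter : IsWeakModel κ (M ∩ H (Order.succ κ)) := by
  have h1 := S.isTransitive_inter _ S.cardSet_mem_inter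
  refine ⟨le_antisymm ?_ ?_, h1, S.cardSet_mem_inter,
    modelsZFCMinus_of_elemSub (Cardinal.isRegular_succ S.regular.aleph0_le)
      (Order.lt_succ_iff.2 S.regular.aleph0_le) S.elemSub_inter S.isTransitive_inter⟩
  · exact (ZFSet.card_mono fun x hx => (ZFSet.mem_inter.1 hx).1).trans S.model.card_eq.le
  · have := ZFSet.card_mono h1
    rwa [card_cardSet] at this

/-- A sequence of length less than `κ` with values in `H(κ⁺)` is itself in `H(κ⁺)`. -/
theorem closedUnderSeq_inter (hM : ClosedUnderSeq κ M) :
    ClosedUnderSeq κ (M ∩ H (Order.succ κ)) := by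
  intro β hβ f hf
  refine ZFSet.mem_inter.2 ⟨hM β hβ f ⟨fun p hp => ?_, hf.2⟩, ?_⟩
  · obtain ⟨a, ha, b, hb, rfl⟩ := ZFSet.mem_prod.1 (hf.1 hp)
    exact ZFSet.pair_mem_prod.2 ⟨ha, (ZFSet.mem_inter.1 hb).1⟩
  · rw [eq_graph_of_isFunc hf]
    refine graph_mem_H (Cardinal.isRegular_succ S.regular.aleph0_le) ?_
      fun a ha => (ZFSet.mem_inter.1 (val_mem hf ha)).2
    exact toZFSet_mem_H ((Cardinal.lt_ord.1 hβ).trans (Order.lt_succ κ))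

/-- The new target is `j(H(κ⁺))`. For a fixed formula, truth in `H(κ⁺)` is a property of the
parameter `H(κ⁺) ∈ M`, so `j` carries it to truth in `j(H(κ⁺))`. -/
theorem hasPowersetPreservingEmbedding_inter :
    HasPowersetPreservingEmbedding κ (M ∩ H (Order.succ κ)) := by
  have hXM := S.H_mem
  have hmem : ∀ x ∈ M, x ∈ H (Order.succ κ) → app j x ∈ app j (H (Order.succ κ)) := by
    intro x hx hx'
    exact (S.transfer (P := fun _ (v : Fin 2 → ZFSet.{u}) => v 0 ∈ v 1) inferInstance
      ![x, H (Order.succ κ)] (by simp [Fin.forall_fin_succ, hx, hXM])).1 hx'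
  obtain ⟨j', hj'⟩ := exists_elementaryEmbedding (M := M ∩ H (Order.succ κ))
    (N := app j (H (Order.succ κ))) (app j)
    (fun x hx => hmem x (ZFSet.mem_inter.1 hx).1 (ZFSet.mem_inter.1 hx).2) fun n φ v hv => by
      rw [S.elemSub_inter.realizeIn_iff φ hv]
      exact S.transfer (isDef_realizeIn φ some none)
        (fun o : Option (Fin n) => o.elim (H (Order.succ κ)) v) (by
          rintro (_ | i)
          exacts [hXM, (ZFSet.mem_inter.1 (hv i)).1])
  refine ⟨_, ?_, j', ?_, ?_, ?_⟩
  · exact (S.transfer (P := fun _ (v : Fin 1 → ZFSet.{u}) => (v 0).IsTransitive) inferInstance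
      ![H (Order.succ κ)] (by simp [hXM])).1 isTransitive_H
  · intro x hx
    rw [hj', S.app_eq_self hx]
  · obtain ⟨x, hx, hne⟩ := S.preserving.moves
    refine ⟨⟨cardSet κ, S.cardSet_mem_inter⟩, rfl, ?_⟩
    rw [hj']
    intro h
    refine hne ?_
    rw [← app_of_mem j x.2, hx]
    exact h
  · intro A hA
    have hAH : A ∈ H (Order.succ κ) := mem_H_of_subset (cardSet_mem_H (Order.lt_succ κ)) hA
    rw [ZFSet.mem_inter, and_iff_left hAH, S.preserving.same_subsets A hA]
    constructor
    · intro hAN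
      -- The target loses no subset of `κ`: in `N` every subset of `j(κ)` belongs to `j(H(κ⁺))`, and
      -- `κ ⊆ j(κ)`.
      have := (S.transfer (P := fun W (v : Fin 2 → ZFSet.{u}) => ∀ x ∈ W, x ⊆ v 0 → x ∈ v 1)
        inferInstance ![cardSet κ, H (Order.succ κ)]
        (by simp [Fin.forall_fin_succ, S.model.mem, hXM])).1
        (fun x _ hx => mem_H_of_subset (cardSet_mem_H (Order.lt_succ κ)) hx)
      exact this A hAN (hA.trans (S.isOrdinal_app.isTransitive _ S.cardSet_mem_app))
    · exact fun h => S.isTransitive _ (app_mem j hXM) h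

end Setup

/-- `H(κ⁺)` is transitive and included in the level of the cumulative hierarchy at `κ⁺`, so any `θ`
larger than the size of that level will do. -/
theorem exists_large (κ : Cardinal.{u}) :
    ∃ μ : Cardinal.{u}, ∀ θ, μ ≤ θ → H (Order.succ κ) ∈ H θ := by
  refine ⟨Order.succ (ZFSet.vonNeumann (Order.succ κ).ord).card, fun θ hθ => ?_⟩
  refine mem_H_of_isTransitive isTransitive_H (lt_of_lt_of_le (Order.lt_succ_of_le ?_) hθ)
  refine ZFSet.card_mono fun x hx => ?_
  exact ZFSet.mem_vonNeumann.2 (rank_lt_of_mem_H hx)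

theorem AlphaRamsey.exists_setup {α κ : Cardinal.{u}} (h : AlphaRamsey α κ) :
    ∃ θ : Cardinal.{u}, ∀ A : ZFSet.{u}, A ⊆ cardSet κ → ∃ M N : ZFSet.{u},
      ∃ j : M ↪ₑ[setLang] N, Setup κ θ j ∧ A ∈ M ∧ ClosedUnderSeq α M := by
  obtain ⟨-, hκ, -, h⟩ := h
  obtain ⟨μ, hμ⟩ := exists_large κ
  obtain ⟨θ, hθ, hθr, h⟩ := h μ
  refine ⟨θ, fun A hA => ?_⟩
  obtain ⟨M, hAM, hM, hMH, hc, N, hN, j, hj⟩ := h A hA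
  exact ⟨M, N, j, ⟨hκ, hθr, hμ θ hθ, hM, hMH, hN, hj⟩, hAM, hc⟩

theorem AlphaRamsey.superRamseyIf {b : Prop} {α κ : Cardinal.{u}} (h : AlphaRamsey α κ)
    (hb : b → α = κ) : SuperRamseyIf b κ := by
  obtain ⟨θ, h⟩ := h.exists_setup
  intro A hA
  obtain ⟨M, N, j, S, hAM, hc⟩ := h A hA
  refine ⟨M ∩ H (Order.succ κ), ZFSet.mem_inter.2 ⟨hAM, mem_H_of_subset
    (cardSet_mem_H (Order.lt_succ κ)) hA⟩, S.isWeakModel_inter, fun h' => ?_, S.elemSub_inter,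
    S.hasPowersetPreservingEmbedding_inter⟩
  exact S.closedUnderSeq_inter (hb h' ▸ hc)

/-! ### Recovering enumerated sets from relations on the index set -/

section Enumerates

variable {k t f t' f' : ZFSet.{u}}

theorem mem_of_enumerates (h : Enumerates k t f) {y : ZFSet.{u}} :
    y ∈ t ↔ ∃ a ∈ k, y = val f a := by
  constructor
  · intro hy
    obtain ⟨a, ha, hp⟩ := h.2.2 y hy
    exact ⟨a, ha, (pair_mem_iff_of_isFunc h.2.1 ha).1 hp⟩
  · rintro ⟨a, ha, rfl⟩
    exact val_mem h.2.1 ha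

/-- An enumeration of a transitive set is determined by the induced relation. -/
theorem Enumerates.eq (h : Enumerates k t f) (h' : Enumerates k t' f')
    (hf : ∀ a ∈ k, ∀ z ∈ t', z ∈ val f' a ↔ ∃ b ∈ k, z = val f' b ∧ val f b ∈ val f a) :
    t' = t ∧ f' = f := by
  have key : ∀ x : ZFSet.{u}, ∀ a ∈ k, val f a = x → val f' a = x := by
    intro x
    induction x using ZFSet.inductionOn with
    | _ x ih =>
      rintro a ha rfl
      ext z
      constructor
      · intro hz
        obtain ⟨b, hb, rfl, hb'⟩ := (hf a ha z (h'.1 _ (val_mem h'.2.1 ha) hz)).1 hz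
        rwa [ih _ hb' b hb rfl]
      · intro hz
        obtain ⟨b, hb, rfl⟩ := (mem_of_enumerates h).1 (h.1 _ (val_mem h.2.1 ha) hz)
        have e := ih _ hz b hb rfl
        rw [← e]
        exact (hf a ha _ (val_mem h'.2.1 hb)).2 ⟨b, hb, rfl, hz⟩
  have key' : ∀ a ∈ k, val f' a = val f a := fun a ha => key _ a ha rfl
  constructor
  · ext y
    rw [mem_of_enumerates h, mem_of_enumerates h']
    exact exists_congr fun a => and_congr_right fun ha => by rw [key' a ha]
  · rw [eq_graph_of_isFunc h.2.1, eq_graph_of_isFunc h'.2.1]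
    exact graph_congr key'

/-- The function `f` enumerates the transitive collapse of the relation that the values of `h`
induce on `k`. -/
def Collapses (k s h t f : ZFSet.{u}) : Prop :=
  Enumerates k t f ∧ ∀ a ∈ k, ∀ y ∈ t, ZFSet.pair a y ∈ f → ∀ z ∈ t,
    z ∈ y ↔ ∃ b ∈ k, ZFSet.pair b z ∈ f ∧ ∃ u ∈ s, ∃ w ∈ s, ZFSet.pair b u ∈ h ∧
      ZFSet.pair a w ∈ h ∧ u ∈ w

instance isDef_collapses {α : Type} {a b c d e : α} :
    IsDef (fun (_ : ZFSet.{u}) v => Collapses (v a) (v b) (v c) (v d) (v e)) := by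
  unfold Collapses
  infer_instance

theorem collapses_iff {l s h : ZFSet.{u}} (hk : k ⊆ l) (hh : ZFSet.IsFunc l s h) :
    Collapses k s h t f ↔ Enumerates k t f ∧ ∀ a ∈ k, ∀ z ∈ t,
      z ∈ val f a ↔ ∃ b ∈ k, z = val f b ∧ val h b ∈ val h a := by
  refine and_congr_right fun he => ?_
  have e1 : ∀ b ∈ k, ∀ z, ZFSet.pair b z ∈ f ↔ z = val f b := fun b hb z =>
    pair_mem_iff_of_isFunc he.2.1 hb
  have e2 : ∀ b ∈ k, ∀ z, ZFSet.pair b z ∈ h ↔ z = val h b := fun b hb z =>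
    pair_mem_iff_of_isFunc hh (hk hb)
  have e3 : ∀ a ∈ k, ∀ z, (∃ b ∈ k, ZFSet.pair b z ∈ f ∧ ∃ u ∈ s, ∃ w ∈ s,
      ZFSet.pair b u ∈ h ∧ ZFSet.pair a w ∈ h ∧ u ∈ w) ↔
      ∃ b ∈ k, z = val f b ∧ val h b ∈ val h a := by
    intro a ha z
    refine exists_congr fun b => and_congr_right fun hb => ?_
    rw [e1 b hb]
    refine and_congr_right fun _ => ⟨?_, fun h' => ?_⟩
    · rintro ⟨u, -, w, -, h1, h2, h3⟩
      rwa [← (e2 b hb u).1 h1, ← (e2 a ha w).1 h2]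
    · exact ⟨_, val_mem hh (hk hb), _, val_mem hh (hk ha), (e2 b hb _).2 rfl,
        (e2 a ha _).2 rfl, h'⟩
  constructor
  · intro h' a ha z hz
    rw [h' a ha _ (val_mem he.2.1 ha) ((e1 a ha _).2 rfl) z hz, e3 a ha]
  · intro h' a ha y _ hay z hz
    rw [(e1 a ha y).1 hay, h' a ha z hz, e3 a ha]

/-- Collapse the set of values of `h` on `k`, and compose `h` with the collapse. -/
theorem exists_collapses {l s h : ZFSet.{u}} (hk : k ⊆ l) (hh : ZFSet.IsFunc l s h) :
    ∃ t f, Collapses k s h t f := by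
  let Y := ZFSet.range (fun a : k => val h a)
  have hY : ∀ {w}, w ∈ Y ↔ ∃ a ∈ k, val h a = w := by simp [Y]
  have ht : ∀ {w}, w ∈ collapseImage Y ↔ ∃ a ∈ k, collapse Y (val h a) = w := by
    intro w
    rw [mem_collapseImage]
    constructor
    · rintro ⟨z, hz, rfl⟩
      obtain ⟨a, ha, rfl⟩ := hY.1 hz
      exact ⟨a, ha, rfl⟩
    · rintro ⟨a, ha, rfl⟩
      exact ⟨_, hY.2 ⟨a, ha, rfl⟩, rfl⟩
  have hf : ZFSet.IsFunc k (collapseImage Y) (graph k (fun a => collapse Y (val h a))) :=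
    isFunc_graph fun a ha => ht.2 ⟨a, ha, rfl⟩
  have hv : ∀ a ∈ k, val (graph k (fun a => collapse Y (val h a))) a = collapse Y (val h a) :=
    fun a ha => ((pair_mem_iff_of_isFunc hf ha).1 (pair_mem_graph.2 ⟨ha, rfl⟩)).symm
  refine ⟨collapseImage Y, graph k (fun a => collapse Y (val h a)), (collapses_iff hk hh).2
    ⟨⟨isTransitive_collapseImage, hf, fun y hy => ?_⟩, fun a ha z _ => ?_⟩⟩
  · obtain ⟨a, ha, rfl⟩ := ht.1 hy
    exact ⟨a, ha, pair_mem_graph.2 ⟨ha, rfl⟩⟩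
  · rw [hv a ha, mem_collapse]
    constructor
    · rintro ⟨w, hw, hw', rfl⟩
      obtain ⟨b, hb, rfl⟩ := hY.1 hw
      exact ⟨b, hb, (hv b hb).symm, hw'⟩
    · rintro ⟨b, hb, rfl, hb'⟩
      exact ⟨_, hY.2 ⟨b, hb, rfl⟩, hb', (hv b hb).symm⟩

/-- Different ordered pairs of elements of `k` are related by `p` to different elements of `k`. -/
def IsPairing (k p : ZFSet.{u}) : Prop :=
  (∀ a ∈ k, ∀ b ∈ k, ∃ c ∈ k, ZFSet.pair (ZFSet.pair a b) c ∈ p) ∧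
    ∀ a ∈ k, ∀ b ∈ k, ∀ a' ∈ k, ∀ b' ∈ k, ∀ c ∈ k, ZFSet.pair (ZFSet.pair a b) c ∈ p →
      ZFSet.pair (ZFSet.pair a' b') c ∈ p → a = a' ∧ b = b'

instance isDef_isPairing {α : Type} {a b : α} :
    IsDef (fun (_ : ZFSet.{u}) v => IsPairing (v a) (v b)) := by
  unfold IsPairing
  infer_instance

theorem exists_isPairing {κ : Cardinal.{u}} (hκ : Cardinal.aleph0 ≤ κ) :
    ∃ p ∈ H (Order.succ κ), IsPairing (cardSet κ) p := by
  have hr := Cardinal.isRegular_succ hκ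
  have hκ' := cardSet_mem_H (Order.lt_succ κ)
  have hprod := prod_mem_H hr hκ' hκ'
  have hc := Order.lt_succ_iff.1 (card_lt_of_mem_H hprod)
  have h0 : ∅ ∈ cardSet κ := by
    rw [cardSet, ← Ordinal.toZFSet_zero, Ordinal.toZFSet_mem_toZFSet_iff, Cardinal.ord_pos]
    exact Cardinal.aleph0_pos.trans_le hκ
  -- The relation `p` is the converse of a surjection of `κ` onto `κ × κ`. A pair may get several
  -- codes, but no code serves two pairs.
  obtain ⟨F, hF, hF'⟩ := exists_surj_of_card_le (hc.trans_eq (card_cardSet κ).symm)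
    ⟨_, ZFSet.pair_mem_prod.2 ⟨h0, h0⟩⟩
  have hp : ∀ {x c : ZFSet.{u}}, ZFSet.pair x c ∈
      ZFSet.range (fun c : cardSet κ => ZFSet.pair (F c) c) ↔ c ∈ cardSet κ ∧ x = F c := by
    intro x c
    rw [ZFSet.mem_range]
    constructor
    · rintro ⟨⟨d, hd⟩, e⟩
      obtain ⟨rfl, rfl⟩ := ZFSet.pair_inj.1 e
      exact ⟨hd, rfl⟩
    · rintro ⟨hc, rfl⟩
      exact ⟨⟨c, hc⟩, rfl⟩
  refine ⟨ZFSet.range (fun c : cardSet κ => ZFSet.pair (F c) c), ?_, ?_, ?_⟩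
  · refine mem_H_of_card_lt hr ?_ ((card_range_le _).trans_lt (card_lt_of_mem_H hκ'))
    intro q hq
    obtain ⟨⟨c, hc⟩, rfl⟩ := ZFSet.mem_range.1 hq
    exact pair_mem_H hr (isTransitive_H _ hprod (hF c hc)) (isTransitive_H _ hκ' hc)
  · intro a ha b hb
    obtain ⟨c, hc, e⟩ := hF' _ (ZFSet.pair_mem_prod.2 ⟨ha, hb⟩)
    exact ⟨c, hc, hp.2 ⟨hc, e.symm⟩⟩
  · intro a _ b _ a' _ b' _ c _ h1 h2
    have := (hp.1 h1).2.trans (hp.1 h2).2.symm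
    exact ZFSet.pair_inj.1 this

end Enumerates

/-! ### The target computes `H(κ⁺)` as `M ∩ H(κ⁺)` -/

namespace Setup
variable {κ θ : Cardinal.{u}} {M N : ZFSet.{u}} {j : M ↪ₑ[setLang] N} (S : Setup κ θ j)
include S

theorem aleph0_lt' : Cardinal.aleph0 < θ :=
  (Order.lt_succ_iff.2 S.regular.aleph0_le).trans_le S.succ_le

theorem cardSet_mem_H' : cardSet κ ∈ H θ := S.elemSub.subset S.model.mem

theorem cardSet_subset_app : cardSet κ ⊆ app j (cardSet κ) :=
  S.isOrdinal_app.isTransitive _ S.cardSet_mem_app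

theorem app_mem_app {x y : ZFSet.{u}} (hx : x ∈ M) (hy : y ∈ M) :
    x ∈ y ↔ app j x ∈ app j y :=
  S.transfer (P := fun _ (v : Fin 2 → ZFSet.{u}) => v 0 ∈ v 1) inferInstance
    ![x, y] (by simp [Fin.forall_fin_succ, hx, hy])

/-- `N` contains `j(f)` and `κ`, and by transfer it contains the collapse of the relation that
`j(f)` induces on `κ`. As `j(f)(a) = j(f(a))` for `a < κ`, this is the relation induced by `f`,
whose collapse is enumerated by `f` itself. -/
theorem enumerates_mem_target {t f : ZFSet.{u}} (ht : t ∈ M) (hf : f ∈ M)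
    (he : Enumerates (cardSet κ) t f) : t ∈ N ∧ f ∈ N := by
  have h0 : ∀ k ∈ H θ, ∀ l ∈ H θ, ∀ s ∈ H θ, ∀ h ∈ H θ, k ⊆ l → ZFSet.IsFunc l s h →
      ∃ t ∈ H θ, ∃ f ∈ H θ, Collapses k s h t f := by
    intro k hk l _ s _ h _ hkl hh
    obtain ⟨t, f, htf⟩ := exists_collapses hkl hh
    obtain ⟨ht, hf⟩ := htf.1.mem_H S.regular' hk
    exact ⟨t, ht, f, hf, htf⟩
  have h1 := (S.transfer (P := fun W (v : Fin 0 → ZFSet.{u}) => ∀ k ∈ W, ∀ l ∈ W, ∀ s ∈ W,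
    ∀ h ∈ W, k ⊆ l → ZFSet.IsFunc l s h → ∃ t ∈ W, ∃ f ∈ W, Collapses k s h t f)
    inferInstance ![] (by simp)).1 h0
  have hjf : ZFSet.IsFunc (app j (cardSet κ)) (app j t) (app j f) :=
    (S.transfer (P := fun _ (v : Fin 3 → ZFSet.{u}) => ZFSet.IsFunc (v 0) (v 1) (v 2))
      inferInstance ![cardSet κ, t, f]
      (by simp [Fin.forall_fin_succ, S.model.mem, ht, hf])).1 he.2.1
  obtain ⟨t', ht', f', hf', hc⟩ := h1 _ S.cardSet_mem_target _ (app_mem j S.model.mem) _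
    (app_mem j ht) _ (app_mem j hf) S.cardSet_subset_app hjf
  rw [collapses_iff S.cardSet_subset_app hjf] at hc
  have htM := S.enumerates_subset ht hf he
  have hval : ∀ a ∈ cardSet κ, val (app j f) a = app j (val f a) := by
    intro a ha
    have hva := htM (val_mem he.2.1 ha)
    have := (S.transfer (P := fun _ (v : Fin 3 → ZFSet.{u}) => ZFSet.pair (v 0) (v 1) ∈ v 2)
      inferInstance ![a, val f a, f] (by simp [Fin.forall_fin_succ, S.model.subset ha, hva, hf])).1
      ((pair_mem_iff_of_isFunc he.2.1 ha).2 rfl)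
    have h2 : ZFSet.pair (app j a) (app j (val f a)) ∈ app j f := this
    rw [S.app_eq_self ha, pair_mem_iff_of_isFunc hjf (S.cardSet_subset_app ha)] at h2
    exact h2.symm
  obtain ⟨rfl, rfl⟩ := he.eq hc.1 fun a ha z hz => by
    rw [hc.2 a ha z hz]
    refine exists_congr fun b => and_congr_right fun hb => and_congr_right fun _ => ?_
    rw [hval a ha, hval b hb,
      S.app_mem_app (htM (val_mem he.2.1 hb)) (htM (val_mem he.2.1 ha))]
  exact ⟨ht', hf'⟩

theorem mem_target {x : ZFSet.{u}} (hx : x ∈ M) (hx' : x ∈ H (Order.succ κ)) : x ∈ N := by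
  obtain ⟨t, ht, f, hf, he, hxt⟩ := S.exists_enumerates hx hx'
  exact S.isTransitive _ (S.enumerates_mem_target ht hf he).1 hxt

/-- The relation that `f` induces on `κ` is coded in `N` by some `e ⊆ κ`, through a pairing `p`
common to `M` and `N`. Powerset preservation puts `e` into `M`. By elementarity `M` has an
enumeration with code `e`, and the code determines the enumeration. -/
theorem enumerates_mem_of_target {t f : ZFSet.{u}} (ht : t ∈ N) (hf : f ∈ N)
    (he : Enumerates (cardSet κ) t f) : t ∈ M ∧ f ∈ M := by
  obtain ⟨p, hpM, hpX, hp⟩ := S.exists_mem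
    (R := fun p W (v : Fin 2 → ZFSet.{u}) => p ∈ v 0 ∧ IsPairing (v 1) p) inferInstance
    ![H (Order.succ κ), cardSet κ] (by simp [Fin.forall_fin_succ, S.H_mem, S.model.mem])
    (by
      obtain ⟨p, hp, hp'⟩ := exists_isPairing S.regular.aleph0_le
      exact ⟨p, H_subset_H S.succ_le hp, hp, hp'⟩)
  have hpN := S.mem_target hpM hpX
  -- Separation for this property holds in `H(θ)`, hence in `N`.
  obtain ⟨e, heN, heκ, hee⟩ := (S.transfer (P := fun W (v : Fin 0 → ZFSet.{u}) =>
    ∀ k ∈ W, ∀ p ∈ W, ∀ t ∈ W, ∀ f ∈ W, ∃ e ∈ W, e ⊆ k ∧ ∀ c ∈ k, c ∈ e ↔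
      ∃ a ∈ k, ∃ b ∈ k, ZFSet.pair (ZFSet.pair a b) c ∈ p ∧ ∃ y ∈ t, ∃ z ∈ t,
        ZFSet.pair a y ∈ f ∧ ZFSet.pair b z ∈ f ∧ y ∈ z)
    inferInstance ![] (by simp)).1 (by
      intro k hk p _ t _ f _
      refine ⟨ZFSet.sep (fun c => ∃ a ∈ k, ∃ b ∈ k, ZFSet.pair (ZFSet.pair a b) c ∈ p ∧ ∃ y ∈ t,
        ∃ z ∈ t, ZFSet.pair a y ∈ f ∧ ZFSet.pair b z ∈ f ∧ y ∈ z) k,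
        mem_H_of_subset hk ZFSet.sep_subset, ZFSet.sep_subset, fun c hc => ?_⟩
      rw [ZFSet.mem_sep, and_iff_right hc]) _ S.cardSet_mem_target _ hpN _ ht _ hf
  have heM : e ∈ M := (S.preserving.same_subsets e heκ).2 heN
  have key : ∀ a ∈ cardSet κ, ∀ b ∈ cardSet κ,
      (val f a ∈ val f b ↔ ∃ c ∈ e, ZFSet.pair (ZFSet.pair a b) c ∈ p) := by
    intro a ha b hb
    have e1 : ∀ a ∈ cardSet κ, ∀ y, ZFSet.pair a y ∈ f ↔ y = val f a := fun a ha y =>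
      pair_mem_iff_of_isFunc he.2.1 ha
    constructor
    · intro h
      obtain ⟨c, hc, hc'⟩ := hp.1 a ha b hb
      exact ⟨c, (hee c hc).2 ⟨a, ha, b, hb, hc', _, val_mem he.2.1 ha, _, val_mem he.2.1 hb,
        (e1 a ha _).2 rfl, (e1 b hb _).2 rfl, h⟩, hc'⟩
    · rintro ⟨c, hc, hc'⟩
      have hcκ := heκ hc
      obtain ⟨a', ha', b', hb', hc'', y, -, z, -, hy, hz, hyz⟩ := (hee c hcκ).1 hc
      obtain ⟨rfl, rfl⟩ := hp.2 a ha b hb a' ha' b' hb' c hcκ hc' hc''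
      rwa [← (e1 a ha y).1 hy, ← (e1 b hb z).1 hz]
  obtain ⟨htH, hfH⟩ := he.mem_H S.regular' S.cardSet_mem_H'
  have hcode : ∀ {t f : ZFSet.{u}}, Enumerates (cardSet κ) t f →
      ((∀ a ∈ cardSet κ, ∀ b ∈ cardSet κ, ∀ y ∈ t, ∀ z ∈ t, ZFSet.pair a y ∈ f →
        ZFSet.pair b z ∈ f → (y ∈ z ↔ ∃ c ∈ e, ZFSet.pair (ZFSet.pair a b) c ∈ p)) ↔
      ∀ a ∈ cardSet κ, ∀ b ∈ cardSet κ,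
        (val f a ∈ val f b ↔ ∃ c ∈ e, ZFSet.pair (ZFSet.pair a b) c ∈ p)) := by
    intro t f he
    refine forall₂_congr fun a ha => forall₂_congr fun b hb => ⟨fun h => ?_, fun h => ?_⟩
    · exact h _ (val_mem he.2.1 ha) _ (val_mem he.2.1 hb)
        ((pair_mem_iff_of_isFunc he.2.1 ha).2 rfl) ((pair_mem_iff_of_isFunc he.2.1 hb).2 rfl)
    · intro y _ z _ hy hz
      rwa [(pair_mem_iff_of_isFunc he.2.1 ha).1 hy, (pair_mem_iff_of_isFunc he.2.1 hb).1 hz]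
  obtain ⟨t', ht', f', hf', he', hk'⟩ := S.exists_mem
    (R := fun t W (v : Fin 3 → ZFSet.{u}) => ∃ f ∈ W, Enumerates (v 0) t f ∧
      ∀ a ∈ v 0, ∀ b ∈ v 0, ∀ y ∈ t, ∀ z ∈ t, ZFSet.pair a y ∈ f → ZFSet.pair b z ∈ f →
        (y ∈ z ↔ ∃ c ∈ v 1, ZFSet.pair (ZFSet.pair a b) c ∈ v 2)) inferInstance
    ![cardSet κ, e, p] (by simp [Fin.forall_fin_succ, S.model.mem, heM, hpM])
    ⟨t, htH, f, hfH, he, (hcode he).2 key⟩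
  obtain ⟨f', hf', he', hk'⟩ := S.exists_mem
    (R := fun f W (v : Fin 4 → ZFSet.{u}) => Enumerates (v 0) (v 3) f ∧
      ∀ a ∈ v 0, ∀ b ∈ v 0, ∀ y ∈ v 3, ∀ z ∈ v 3, ZFSet.pair a y ∈ f → ZFSet.pair b z ∈ f →
        (y ∈ z ↔ ∃ c ∈ v 1, ZFSet.pair (ZFSet.pair a b) c ∈ v 2)) inferInstance
    ![cardSet κ, e, p, t'] (by simp [Fin.forall_fin_succ, S.model.mem, heM, hpM, ht'])
    ⟨f', hf', he', hk'⟩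
  have he'' : Enumerates (cardSet κ) t' f' := he'
  have hk'' := (hcode he'').1 hk'
  obtain ⟨rfl, rfl⟩ := he.eq he'' fun a ha z hz => by
    constructor
    · intro hza
      obtain ⟨b, hb, rfl⟩ := (mem_of_enumerates he'').1 hz
      exact ⟨b, hb, rfl, (key b hb a ha).2 ((hk'' b hb a ha).1 hza)⟩
    · rintro ⟨b, hb, rfl, h⟩
      exact (hk'' b hb a ha).2 ((key b hb a ha).1 h)
  exact ⟨ht', hf'⟩

/-- The sets `H(κ⁺)` of `N` and `M` are the same. -/
theorem eq_inter_of_isHSucc {X : ZFSet.{u}} (hX : X ∈ N) (h : IsHSucc N (cardSet κ) X) :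
    X = M ∩ H (Order.succ κ) := by
  ext y
  rw [ZFSet.mem_inter]
  constructor
  · intro hy
    obtain ⟨t, ht, f, hf, he, hyt⟩ := (h y (S.isTransitive _ hX hy)).1 hy
    obtain ⟨ht, hf⟩ := S.enumerates_mem_of_target ht hf he
    exact ⟨S.enumerates_subset ht hf he hyt,
      (mem_H_succ_iff S.regular.aleph0_le).2 ⟨t, f, he, hyt⟩⟩
  · rintro ⟨hy, hy'⟩
    obtain ⟨t, ht, f, hf, he, hyt⟩ := S.exists_enumerates hy hy'
    obtain ⟨ht, hf⟩ := S.enumerates_mem_target ht hf he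
    exact (h y (S.mem_target hy hy')).2 ⟨t, ht, f, hf, he, hyt⟩

theorem codes_mem : codes ∈ M := by
  obtain ⟨F, hF, h1, h2⟩ := S.exists_mem
    (R := fun F W (v : Fin 0 → ZFSet.{u}) => ClosedCodes F ∧ ∀ G ∈ W, ClosedCodes G → F ⊆ G)
    inferInstance ![] (by simp) ⟨codes, codes_mem_H S.regular' S.aleph0_lt', closedCodes_codes,
      fun G _ hG => hG.codes_subset⟩
  have : F = codes := ZFSet.ext fun x =>
    ⟨fun hx => h2 _ (codes_mem_H S.regular' S.aleph0_lt') closedCodes_codes hx,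
      fun hx => h1.codes_subset hx⟩
  rwa [← this]

/-- The set of codes is the least set closed under the coding operations. Its image is least in this
sense in `N`, and `codes` is an element of `N` to compare it with. -/
theorem app_codes : app j codes = codes := by
  have hc := codes_mem_H (Cardinal.isRegular_succ S.regular.aleph0_le)
    (Order.lt_succ_iff.2 S.regular.aleph0_le)
  have := (S.transfer (P := fun W (v : Fin 1 → ZFSet.{u}) => ClosedCodes (v 0) ∧
    ∀ G ∈ W, ClosedCodes G → v 0 ⊆ G) inferInstance ![codes] (by simp [S.codes_mem])).1
    ⟨closedCodes_codes, fun G _ hG => hG.codes_subset⟩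
  exact ZFSet.ext fun x =>
    ⟨fun hx => this.2 _ (S.mem_target S.codes_mem hc) closedCodes_codes hx,
      fun hx => this.1.codes_subset hx⟩

/-- The existence of these sets is transferred as a statement about all `n ∈ κ`; in `N` it then
holds for all `n ∈ j(κ)`, among them `κ`. The indices `n` need not be cardinals. -/
theorem exists_isSat_target : ∃ X ∈ N, ∃ D ∈ N, IsHSucc N (cardSet κ) X ∧ IsSat codes D X := by
  have := (S.transfer (P := fun W (v : Fin 2 → ZFSet.{u}) => ∀ n ∈ v 0, ∃ X ∈ W, ∃ D ∈ W,
    IsHSucc W n X ∧ IsSat (v 1) D X) inferInstance ![cardSet κ, codes]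
    (by simp [Fin.forall_fin_succ, S.codes_mem, S.model.mem])).1 (by
      intro n hn
      have hX : ZFSet.sep (fun y => ∃ t ∈ H θ, ∃ f ∈ H θ, Enumerates n t f ∧ y ∈ t)
        (H (Order.succ κ)) ∈ H θ := mem_H_of_subset S.mem_H ZFSet.sep_subset
      refine ⟨_, hX, _, satSet_mem_H S.regular' S.aleph0_lt' hX, fun y _ => ?_, isSat_satSet _⟩
      rw [ZFSet.mem_sep]
      refine and_iff_right_of_imp fun ⟨t, _, f, _, he, hy⟩ => ?_
      refine isTransitive_H _ (mem_H_of_isTransitive he.1 (he.card_le.trans_lt ?_)) hy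
      exact card_lt_of_mem_H (isTransitive_H _ (cardSet_mem_H (Order.lt_succ κ)) hn))
  have h1 := this _ S.cardSet_mem_app
  have h2 : ∃ X ∈ N, ∃ D ∈ N, IsHSucc N (cardSet κ) X ∧ IsSat (app j codes) D X := h1
  rwa [S.app_codes] at h2

end Setup

/-! ### Super Ramseyness as a first-order statement -/

theorem isDef_const (b : Prop) {α : Type} :
    IsDef (fun (_ : ZFSet.{u}) (_ : α → ZFSet.{u}) => b) := by
  by_cases h : b
  · simpa only [h, not_false_eq_true] using
      (inferInstance : IsDef (fun (_ : ZFSet.{u}) (_ : α → ZFSet.{u}) => ¬ False))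
  · simpa only [h] using (inferInstance : IsDef (fun (_ : ZFSet.{u}) (_ : α → ZFSet.{u}) => False))

/-- The ordinal `n` is a cardinal in the sense of `W`. -/
def IsCardinalIn (W n : ZFSet.{u}) : Prop :=
  ∀ a ∈ n, ∀ f ∈ W, ZFSet.IsFunc a n f → ¬ ∀ y ∈ n, ∃ x ∈ a, ZFSet.pair x y ∈ f

instance isDef_isCardinalIn {α : Type} {a : α} :
    IsDef (fun (W : ZFSet.{u}) v => IsCardinalIn W (v a)) := by
  unfold IsCardinalIn
  infer_instance

/-- The set `M` is a weak `n`-model and an elementary substructure of `X`, and `j : M → N` is an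
elementary embedding that preserves the subsets of `n`. Here `D` and `E` are satisfaction relations
for `X` and `N`, and `F` is the set of codes of formulas. -/
structure IsWitness (b : Prop) (n X F D A M N j E : ZFSet.{u}) : Prop where
  mem : A ∈ M
  subset : n ⊆ M
  self_mem : n ∈ M
  trans_left : M.IsTransitive
  trans_right : N.IsTransitive
  pairClosed_left : PairClosed M
  pairClosed_right : PairClosed N
  closed : b → ∀ β ∈ n, ∀ f ∈ X, ZFSet.IsFunc β M f → f ∈ M
  isFunc : ZFSet.IsFunc M N j
  map_pair : ∀ x ∈ M, ∀ y ∈ M, ∀ z ∈ N, ∀ w ∈ N, ZFSet.pair x z ∈ j → ZFSet.pair y w ∈ j →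
    ZFSet.pair (ZFSet.pair x y) (ZFSet.pair z w) ∈ j
  isSat : IsSat F E N
  tarski_vaught : ∀ c ∈ F, ∀ t ∈ M, (∃ x ∈ X, ZFSet.pair c (ZFSet.pair t x) ∈ D) →
    ∃ x ∈ M, ZFSet.pair c (ZFSet.pair t x) ∈ D
  map_sat : ∀ c ∈ F, ∀ t ∈ M, ∀ w ∈ N, ZFSet.pair t w ∈ j →
    (ZFSet.pair c t ∈ D ↔ ZFSet.pair c w ∈ E)
  fixes : ∀ x ∈ n, ZFSet.pair x x ∈ j
  moves : ZFSet.pair n n ∉ j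
  same_subsets : ∀ B ∈ X, B ⊆ n → (B ∈ M ↔ B ∈ N)

theorem isWitness_iff {b : Prop} {n X F D A M N j E : ZFSet.{u}} :
    IsWitness b n X F D A M N j E ↔ A ∈ M ∧ n ⊆ M ∧ n ∈ M ∧ M.IsTransitive ∧ N.IsTransitive ∧
      PairClosed M ∧ PairClosed N ∧ (b → ∀ β ∈ n, ∀ f ∈ X, ZFSet.IsFunc β M f → f ∈ M) ∧
      ZFSet.IsFunc M N j ∧
      (∀ x ∈ M, ∀ y ∈ M, ∀ z ∈ N, ∀ w ∈ N, ZFSet.pair x z ∈ j → ZFSet.pair y w ∈ j →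
        ZFSet.pair (ZFSet.pair x y) (ZFSet.pair z w) ∈ j) ∧
      IsSat F E N ∧
      (∀ c ∈ F, ∀ t ∈ M, (∃ x ∈ X, ZFSet.pair c (ZFSet.pair t x) ∈ D) →
        ∃ x ∈ M, ZFSet.pair c (ZFSet.pair t x) ∈ D) ∧
      (∀ c ∈ F, ∀ t ∈ M, ∀ w ∈ N, ZFSet.pair t w ∈ j →
        (ZFSet.pair c t ∈ D ↔ ZFSet.pair c w ∈ E)) ∧
      (∀ x ∈ n, ZFSet.pair x x ∈ j) ∧ ZFSet.pair n n ∉ j ∧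
      ∀ B ∈ X, B ⊆ n → (B ∈ M ↔ B ∈ N) :=
  ⟨fun ⟨h1, h2, h3, h4, h5, h6, h7, h8, h9, h10, h11, h12, h13, h14, h15, h16⟩ =>
    ⟨h1, h2, h3, h4, h5, h6, h7, h8, h9, h10, h11, h12, h13, h14, h15, h16⟩,
  fun ⟨h1, h2, h3, h4, h5, h6, h7, h8, h9, h10, h11, h12, h13, h14, h15, h16⟩ =>
    ⟨h1, h2, h3, h4, h5, h6, h7, h8, h9, h10, h11, h12, h13, h14, h15, h16⟩⟩

instance isDef_isWitness {b : Prop} {α : Type} {n X F D A M N j E : α} :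
    IsDef (fun (_ : ZFSet.{u}) v =>
      IsWitness b (v n) (v X) (v F) (v D) (v A) (v M) (v N) (v j) (v E)) := by
  have hb := fun (β : Type) => isDef_const.{u} b (α := β)
  simp only [isWitness_iff]
  infer_instance

/-- In the sense of `W`, the ordinal `n` has the properties that define super (weakly) Ramsey
cardinals. -/
def Reflects (b : Prop) (W n F : ZFSet.{u}) : Prop :=
  IsCardinalIn W n ∧ ∃ X ∈ W, ∃ D ∈ W, IsHSucc W n X ∧ IsSat F D X ∧ ∀ A ∈ X, A ⊆ n →
    ∃ M ∈ X, ∃ N ∈ X, ∃ j ∈ X, ∃ E ∈ X, IsWitness b n X F D A M N j E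

instance isDef_reflects {b : Prop} {α : Type} {n F : α} :
    IsDef (fun (W : ZFSet.{u}) v => Reflects b W (v n) (v F)) := by
  unfold Reflects
  infer_instance

theorem pairClosed_H {θ : Cardinal.{u}} (hθ : θ.IsRegular) : PairClosed (H θ) :=
  ⟨empty_mem_H hθ, fun _ hx _ hy => pair_mem_H hθ hx hy⟩

/-- After shrinking the target, `M` and `N` are transitive of size at most `κ`, so they, the graph
of the embedding and the satisfaction relation of `N` belong to `H(κ⁺)`. -/
theorem SuperRamseyIf.exists_isWitness {b : Prop} {κ : Cardinal.{u}} (hκ : Cardinal.aleph0 < κ)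
    (h : SuperRamseyIf b κ) {A D : ZFSet.{u}} (hA : A ⊆ cardSet κ)
    (hD : IsSat codes D (H (Order.succ κ))) :
    ∃ M ∈ H (Order.succ κ), ∃ N ∈ H (Order.succ κ), ∃ j ∈ H (Order.succ κ),
      ∃ E ∈ H (Order.succ κ),
        IsWitness b (cardSet κ) (H (Order.succ κ)) codes D A M N j E := by
  have hr := Cardinal.isRegular_succ hκ.le
  have hω : Cardinal.aleph0 < Order.succ κ := hκ.trans (Order.lt_succ κ)
  obtain ⟨M, hAM, hM, hMc, hMH, N', hN', j', hj'⟩ := h A hA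
  obtain ⟨N, hN, hNc, j, hj⟩ := hj'.exists_small hκ.le hM.card_eq hM.mem hM.subset hN'
  have hMt := hMH.isTransitive hκ.le hM.mem hM.subset
  have hMX : M ∈ H (Order.succ κ) :=
    mem_H_of_isTransitive hMt (hM.card_eq.trans_lt (Order.lt_succ κ))
  have hNX : N ∈ H (Order.succ κ) := mem_H_of_isTransitive hN (Order.lt_succ_of_le hNc)
  have transfer : ∀ {α : Type} {P : ZFSet.{u} → (α → ZFSet.{u}) → Prop} (_ : IsDef P)
    (v : α → ZFSet.{u}) (_ : ∀ a, v a ∈ M), P M v ↔ P N (fun a => app j (v a)) :=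
    fun hP v hv => hP.transfer (elemSub_refl M) hMt hN j v hv
  have h0 : ∅ ∈ cardSet κ := by
    rw [cardSet, ← Ordinal.toZFSet_zero, Ordinal.toZFSet_mem_toZFSet_iff, Cardinal.ord_pos]
    exact Cardinal.aleph0_pos.trans hκ
  have hfix : ∀ x ∈ cardSet κ, app j x = x := fun x hx => by
    rw [app_of_mem j (hM.subset hx)]
    exact hj.fixes _ hx
  have hMp : PairClosed M := ⟨hM.subset h0, fun x hx y hy => hMH.pair_mem hr hx hy⟩
  have hNp : PairClosed N := by
    refine ⟨?_, fun x hx y hy => ?_⟩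
    · have := app_mem j (hM.subset h0)
      rwa [hfix _ h0] at this
    · obtain ⟨p, hp, rfl⟩ := (transfer (P := fun W (v : Fin 0 → ZFSet.{u}) => ∀ x ∈ W, ∀ y ∈ W,
        ∃ p ∈ W, p = ZFSet.pair x y) inferInstance ![] (by simp)).1
        (fun x hx y hy => ⟨_, hMp.2 x hx y hy, rfl⟩) x hx y hy
      exact hp
  have hfun : ZFSet.IsFunc M N (graph M (app j)) := isFunc_graph fun x hx => app_mem j hx
  have hsub : M ⊆ H (Order.succ κ) := hMH.subset
  refine ⟨M, hMX, N, hNX, graph M (app j), graph_mem_H hr hMX fun x hx =>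
    isTransitive_H _ hNX (app_mem j hx), satSet N, satSet_mem_H hr hω hNX, ?_⟩
  refine ⟨hAM, hM.subset, hM.mem, hMt, hN, hMp, hNp, ?_, hfun, ?_, isSat_satSet N, ?_, ?_, ?_, ?_,
    fun B _ hB => hj.same_subsets B hB⟩
  · intro hb β hβ f _ hf
    obtain ⟨a, ha, rfl⟩ := Ordinal.mem_toZFSet_iff.1 hβ
    exact hMc hb a ha f hf
  · intro x hx y hy z _ w _ hxz hyw
    rw [pair_mem_graph] at *
    obtain ⟨-, rfl⟩ := hxz
    obtain ⟨-, rfl⟩ := hyw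
    refine ⟨hMp.2 x hx y hy, ?_⟩
    exact ((transfer (P := fun _ (v : Fin 3 → ZFSet.{u}) => v 0 = ZFSet.pair (v 1) (v 2))
      inferInstance ![ZFSet.pair x y, x, y]
      (by simp [Fin.forall_fin_succ, hx, hy, hMp.2 x hx y hy])).1 rfl).symm
  · rintro c hc t ht ⟨x, hx, hxD⟩
    obtain ⟨c, rfl⟩ := mem_codes.1 hc
    have hp : ∀ x ∈ H (Order.succ κ), ZFSet.pair t x ∈ H (Order.succ κ) := fun x hx =>
      pair_mem_H hr (hsub ht) hx
    rw [hD.iff closedCodes_codes c _ (hp x hx)] at hxD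
    -- For each genuine code `sat` is uniformly definable, so the coded Tarski–Vaught condition
    -- follows from `M ≺ H(κ⁺)`.
    obtain ⟨y, hy, _, -, rfl, hyD⟩ := hMH.exists_mem isTransitive_H
      (R := fun x W (v : Fin 1 → ZFSet.{u}) => ∃ w ∈ W, w = ZFSet.pair (v 0) x ∧ sat W c w)
      inferInstance ![t] (by simp [ht]) ⟨x, hx, _, hp x hx, rfl, hxD⟩
    exact ⟨y, hy, (hD.iff closedCodes_codes c _ (hp y (hsub hy))).2 hyD⟩
  · intro c hc t ht w _ htw
    obtain ⟨-, rfl⟩ := pair_mem_graph.1 htw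
    obtain ⟨c, rfl⟩ := mem_codes.1 hc
    rw [hD.iff closedCodes_codes c _ (hsub ht), pair_mem_satSet, and_iff_right (app_mem j ht)]
    exact (hMH.iff_of_isTransitive (P := fun W (v : Fin 1 → ZFSet.{u}) => sat W c (v 0))
      inferInstance isTransitive_H hMt ![t] (by simp [ht])).trans
      (transfer (P := fun W (v : Fin 1 → ZFSet.{u}) => sat W c (v 0)) inferInstance ![t]
        (by simp [ht]))
  · exact fun x hx => pair_mem_graph.2 ⟨hM.subset hx, (hfix x hx).symm⟩
  · intro h
    obtain ⟨x, hx, hne⟩ := hj.moves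
    refine hne ?_
    rw [← app_of_mem j x.2, hx]
    exact (pair_mem_graph.1 h).2.symm

theorem isCardinalIn_cardSet (W : ZFSet.{u}) (κ : Cardinal.{u}) : IsCardinalIn W (cardSet κ) := by
  intro a ha f _ hf h
  obtain ⟨o, ho, rfl⟩ := Ordinal.mem_toZFSet_iff.1 ha
  have h1 : (cardSet κ).card ≤ o.toZFSet.card := by
    refine card_le_of_surj (val f) fun y hy => ?_
    obtain ⟨x, hx, hp⟩ := h y hy
    exact ⟨x, hx, ((pair_mem_iff_of_isFunc hf hx).1 hp).symm⟩
  rw [card_cardSet, Ordinal.card_toZFSet] at h1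
  exact (Cardinal.lt_ord.1 ho).not_ge h1

/-! ### Reflection below `κ` -/

namespace Setup
variable {κ θ : Cardinal.{u}} {M N : ZFSet.{u}} {j : M ↪ₑ[setLang] N} (S : Setup κ θ j)
include S

/-- The four components are brought into `M` one after another, each becoming a parameter for the
next application of Tarski–Vaught. -/
theorem exists_isWitness_mem {b : Prop} {A D : ZFSet.{u}} (hA : A ∈ M) (hDM : D ∈ M)
    (h : ∃ M ∈ H (Order.succ κ), ∃ N ∈ H (Order.succ κ), ∃ j ∈ H (Order.succ κ),
      ∃ E ∈ H (Order.succ κ), IsWitness b (cardSet κ) (H (Order.succ κ)) codes D A M N j E) :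
    ∃ P ∈ M ∩ H (Order.succ κ), ∃ Q ∈ M ∩ H (Order.succ κ), ∃ j ∈ M ∩ H (Order.succ κ),
      ∃ E ∈ M ∩ H (Order.succ κ),
        IsWitness b (cardSet κ) (H (Order.succ κ)) codes D A P Q j E := by
  have hXM := S.H_mem
  have hκM := S.model.mem
  have hcM := S.codes_mem
  have sub := H_subset_H S.succ_le
  have hr : ∀ {R : ZFSet.{u} → Prop}, (∃ x ∈ H (Order.succ κ), R x) →
      ∃ x ∈ H θ, x ∈ H (Order.succ κ) ∧ R x := fun ⟨x, hx, hR⟩ => ⟨x, sub hx, hx, hR⟩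
  obtain ⟨P, hPM, hP, h⟩ := S.exists_mem (R := fun P _ (v : Fin 5 → ZFSet.{u}) => P ∈ v 0 ∧
    ∃ Q ∈ v 0, ∃ j ∈ v 0, ∃ E ∈ v 0, IsWitness b (v 1) (v 0) (v 2) (v 3) (v 4) P Q j E)
    inferInstance ![H (Order.succ κ), cardSet κ, codes, D, A]
    (by simp [Fin.forall_fin_succ, hXM, hκM, hcM, hDM, hA]) (hr h)
  obtain ⟨Q, hQM, hQ, h⟩ := S.exists_mem (R := fun Q _ (v : Fin 6 → ZFSet.{u}) => Q ∈ v 0 ∧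
    ∃ j ∈ v 0, ∃ E ∈ v 0, IsWitness b (v 1) (v 0) (v 2) (v 3) (v 4) (v 5) Q j E)
    inferInstance ![H (Order.succ κ), cardSet κ, codes, D, A, P]
    (by simp [Fin.forall_fin_succ, hXM, hκM, hcM, hDM, hA, hPM]) (hr h)
  obtain ⟨i, hiM, hi, h⟩ := S.exists_mem (R := fun j _ (v : Fin 7 → ZFSet.{u}) => j ∈ v 0 ∧
    ∃ E ∈ v 0, IsWitness b (v 1) (v 0) (v 2) (v 3) (v 4) (v 5) (v 6) j E)
    inferInstance ![H (Order.succ κ), cardSet κ, codes, D, A, P, Q]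
    (by simp [Fin.forall_fin_succ, hXM, hκM, hcM, hDM, hA, hPM, hQM]) (hr h)
  obtain ⟨E, hEM, hE, h⟩ := S.exists_mem (R := fun E _ (v : Fin 8 → ZFSet.{u}) => E ∈ v 0 ∧
    IsWitness b (v 1) (v 0) (v 2) (v 3) (v 4) (v 5) (v 6) (v 7) E)
    inferInstance ![H (Order.succ κ), cardSet κ, codes, D, A, P, Q, i]
    (by simp [Fin.forall_fin_succ, hXM, hκM, hcM, hDM, hA, hPM, hQM, hiM]) (hr h)
  exact ⟨P, ZFSet.mem_inter.2 ⟨hPM, hP⟩, Q, ZFSet.mem_inter.2 ⟨hQM, hQ⟩, i,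
    ZFSet.mem_inter.2 ⟨hiM, hi⟩, E, ZFSet.mem_inter.2 ⟨hEM, hE⟩, h⟩

/-- The target of the embedding believes that `κ` is super (weakly) Ramsey. -/
theorem reflects_target {b : Prop} (h : SuperRamseyIf b κ) : Reflects b N (cardSet κ) codes := by
  have hr := Cardinal.isRegular_succ S.regular.aleph0_le
  refine ⟨isCardinalIn_cardSet _ _, ?_⟩
  obtain ⟨X, hX, D, hD, hX', hDX⟩ := S.exists_isSat_target
  obtain rfl := S.eq_inter_of_isHSucc hX hX'
  refine ⟨_, hX, D, hD, hX', hDX, fun A hA hAκ => ?_⟩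
  -- `D` belongs to `N` and describes `M ∩ H(κ⁺)`, whereas a witness in `M` has to be found with a
  -- relation `D' ∈ M` that describes `H(κ⁺)`.
  obtain ⟨D', hD', hDX'⟩ := S.exists_mem
    (R := fun D _ (v : Fin 2 → ZFSet.{u}) => IsSat (v 0) D (v 1)) inferInstance
    ![codes, H (Order.succ κ)] (by simp [Fin.forall_fin_succ, S.codes_mem, S.H_mem])
    ⟨_, satSet_mem_H S.regular' S.aleph0_lt' S.mem_H, isSat_satSet _⟩
  have hDX' : IsSat codes D' (H (Order.succ κ)) := hDX'
  obtain ⟨P, hP, Q, hQ, i, hi, E, hE, w⟩ := S.exists_isWitness_mem (ZFSet.mem_inter.1 hA).1 hD'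
    (h.exists_isWitness S.aleph0_lt hAκ hDX')
  refine ⟨P, hP, Q, hQ, i, hi, E, hE, ?_⟩
  have hsub : M ∩ H (Order.succ κ) ⊆ H (Order.succ κ) := S.elemSub_inter.subset
  have hPsub : P ⊆ M ∩ H (Order.succ κ) := S.isTransitive_inter _ hP
  -- The two relations agree at points of `M ∩ H(κ⁺)`, because this set is elementary in `H(κ⁺)`.
  have key : ∀ c ∈ codes, ∀ t ∈ M ∩ H (Order.succ κ),
      (ZFSet.pair c t ∈ D ↔ ZFSet.pair c t ∈ D') := by
    intro c hc t ht
    obtain ⟨c, rfl⟩ := mem_codes.1 hc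
    rw [hDX.iff closedCodes_codes c t ht, hDX'.iff closedCodes_codes c t (hsub ht)]
    exact (S.elemSub_inter.iff_of_isTransitive
      (P := fun W (v : Fin 1 → ZFSet.{u}) => sat W c (v 0)) inferInstance isTransitive_H
      S.isTransitive_inter ![t] (by simpa using ht)).symm
  have hpair : ∀ t ∈ P, ∀ x ∈ M ∩ H (Order.succ κ), ZFSet.pair t x ∈ M ∩ H (Order.succ κ) :=
    fun t ht x hx => S.elemSub_inter.pair_mem hr (hPsub ht) hx
  -- Only the clauses that mention `D` or `H(κ⁺)` depend on the ambient set.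
  refine { w with closed := ?_, tarski_vaught := ?_, map_sat := ?_, same_subsets := ?_ }
  · exact fun hb β hβ f hf => w.closed hb β hβ f (hsub hf)
  · rintro c hc t ht ⟨x, hx, hxD⟩
    obtain ⟨y, hy, hyD⟩ := w.tarski_vaught c hc t ht
      ⟨x, hsub hx, (key c hc _ (hpair t ht x hx)).1 hxD⟩
    exact ⟨y, hy, (key c hc _ (hpair t ht y (hPsub hy))).2 hyD⟩
  · intro c hc t ht
    rw [key c hc t (hPsub ht)]
    exact w.map_sat c hc t ht
  · exact fun B hB => w.same_subsets B (hsub hB)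

/-- In `N` the ordinal `κ` itself is an example below `j(κ)` and above `j(m) = m`; elementarity of
`j` returns an example below `κ`. -/
theorem exists_reflects {b : Prop} (h : SuperRamseyIf b κ) {m : ZFSet.{u}} (hm : m ∈ cardSet κ) :
    ∃ n ∈ cardSet κ, m ∈ n ∧ Reflects b (H θ) n codes := by
  refine (S.transfer (P := fun W (v : Fin 3 → ZFSet.{u}) => ∃ n ∈ v 0, v 1 ∈ n ∧
    Reflects b W n (v 2)) inferInstance ![cardSet κ, m, codes]
    (by simp [Fin.forall_fin_succ, S.codes_mem, S.model.mem, S.model.subset hm])).2 ?_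
  refine ⟨cardSet κ, S.cardSet_mem_app, ?_, ?_⟩
  · change app j m ∈ cardSet κ
    rwa [S.app_eq_self hm]
  · change Reflects b N (cardSet κ) (app j codes)
    rw [S.app_codes]
    exact S.reflects_target h

end Setup

/-- A surjection from a smaller ordinal onto `o` has its graph in `H(θ)`, so `H(θ)` does not mistake
`o` for a cardinal. -/
theorem IsCardinalIn.exists_eq_cardSet {θ : Cardinal.{u}} (hθ : θ.IsRegular) {o : Ordinal.{u}}
    (ho : o.card < θ) (h : IsCardinalIn (H θ) o.toZFSet) : ∃ n, o.toZFSet = cardSet n := by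
  refine ⟨o.card, ?_⟩
  rw [cardSet, Ordinal.toZFSet_injective.eq_iff]
  refine le_antisymm (not_lt.1 fun hlt => ?_) (Cardinal.ord_card_le o)
  have hmem := toZFSet_mem_H ho
  obtain ⟨F, h1, h2⟩ := exists_surj_of_card_le (k := o.card.ord.toZFSet) (t := o.toZFSet)
    (by simp) ⟨_, Ordinal.toZFSet_mem_toZFSet_iff.2 hlt⟩
  have ha := Ordinal.toZFSet_mem_toZFSet_iff.2 hlt
  refine h _ ha (graph o.card.ord.toZFSet F) (graph_mem_H hθ (isTransitive_H _ hmem ha)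
    fun a ha => isTransitive_H _ hmem (h1 a ha)) (isFunc_graph h1) fun y hy => ?_
  obtain ⟨a, ha, rfl⟩ := h2 y hy
  exact ⟨a, ha, pair_mem_graph.2 ⟨ha, rfl⟩⟩

/-- `H(θ)` computes `H(n⁺)` correctly. All subsets of `n`, and all sequences in `M` of length less
than `n`, belong to `H(n⁺)`, so the clauses restricted to that set hold without restriction. Every
formula has a code, which turns the coded clauses into full elementarity. -/
theorem Reflects.superRamseyIf {b : Prop} {θ n : Cardinal.{u}} (hn : Cardinal.aleph0 < n)
    (hnθ : Order.succ n ≤ θ) (hH : H (Order.succ n) ∈ H θ)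
    (h : Reflects b (H θ) (cardSet n) codes) : SuperRamseyIf b n := by
  have hr := Cardinal.isRegular_succ hn.le
  obtain ⟨-, X, hX, D, -, hX', hD, h⟩ := h
  obtain rfl := isHSucc_unique isTransitive_H hX hH hX' (isHSucc_H hn.le hnθ)
  intro A hA
  obtain ⟨M, hM, N, hN, i, hi, E, hE, w⟩ := h A
    (mem_H_of_subset (cardSet_mem_H (Order.lt_succ n)) hA) hA
  have hMX : M ⊆ H (Order.succ n) := isTransitive_H _ hM
  have hp : ∀ t ∈ M, ∀ x ∈ H (Order.succ n), ZFSet.pair t x ∈ H (Order.succ n) :=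
    fun t ht x hx => pair_mem_H hr (hMX ht) hx
  have hMH : ElemSub M (H (Order.succ n)) := by
    refine elemSub_of_sat hMX w.pairClosed_left (pairClosed_H hr) fun c t ht ⟨x, hx, hs⟩ => ?_
    obtain ⟨y, hy, hy'⟩ := w.tarski_vaught _ (closedCodes_codes.toZFSet_mem c) t ht
      ⟨x, hx, (hD.iff closedCodes_codes c _ (hp t ht x hx)).2 hs⟩
    exact ⟨y, hy, (hD.iff closedCodes_codes c _ (hp t ht y (hMX hy))).1 hy'⟩
  have hval : ∀ {x y}, x ∈ M → (ZFSet.pair x y ∈ i ↔ y = val i x) := fun hx =>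
    pair_mem_iff_of_isFunc w.isFunc hx
  have hfix : ∀ x ∈ cardSet n, val i x = x := fun x hx =>
    ((hval (w.subset hx)).1 (w.fixes x hx)).symm
  have h0 : ∅ ∈ cardSet n := by
    rw [cardSet, ← Ordinal.toZFSet_zero, Ordinal.toZFSet_mem_toZFSet_iff, Cardinal.ord_pos]
    exact Cardinal.aleph0_pos.trans hn
  obtain ⟨j, hj⟩ := exists_elementaryEmbedding_of_sat w.pairClosed_left w.pairClosed_right (val i)
    (fun x hx => val_mem w.isFunc hx) (hfix _ h0)
    (fun x hx y hy => ((hval (w.pairClosed_left.2 x hx y hy)).1 (w.map_pair x hx y hy _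
      (val_mem w.isFunc hx) _ (val_mem w.isFunc hy) ((hval hx).2 rfl) ((hval hy).2 rfl))).symm)
    (fun c t ht => by
      have h1 := w.map_sat _ (closedCodes_codes.toZFSet_mem c) t ht _ (val_mem w.isFunc ht)
        ((hval ht).2 rfl)
      rw [hD.iff closedCodes_codes c t (hMX ht),
        w.isSat.iff closedCodes_codes c _ (val_mem w.isFunc ht)] at h1
      rw [← h1]
      exact (hMH.iff_of_isTransitive (P := fun W (v : Fin 1 → ZFSet.{u}) => sat W c (v 0))
        inferInstance isTransitive_H w.trans_left ![t] (by simp [ht])).symm)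
  refine ⟨M, w.mem, ⟨le_antisymm ?_ ?_, w.subset, w.self_mem, modelsZFCMinus_of_elemSub hr
    (hn.trans (Order.lt_succ n)) hMH w.trans_left⟩, fun hb β hβ f hf => ?_, hMH, N, w.trans_right,
    j, ?_, ?_, ?_⟩
  · exact Order.lt_succ_iff.1 (card_lt_of_mem_H hM)
  · have := ZFSet.card_mono w.subset
    rwa [card_cardSet] at this
  · refine w.closed hb _ (Ordinal.toZFSet_mem_toZFSet_iff.2 hβ) f ?_ hf
    rw [eq_graph_of_isFunc hf]
    exact graph_mem_H hr (toZFSet_mem_H ((Cardinal.lt_ord.1 hβ).trans (Order.lt_succ n)))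
      fun a ha => hMX (val_mem hf ha)
  · intro x hx
    rw [hj, hfix _ hx]
  · refine ⟨⟨_, w.self_mem⟩, rfl, fun h => w.moves ?_⟩
    rw [hj] at h
    exact (hval w.self_mem).2 h.symm
  · exact fun B hB => w.same_subsets B (mem_H_of_subset (cardSet_mem_H (Order.lt_succ n)) hB) hB

theorem AlphaRamsey.isLimitOf_superRamseyIf {b : Prop} {α κ : Cardinal.{u}} (h : AlphaRamsey α κ)
    (hb : b → α = κ) : IsLimitOf (SuperRamseyIf b) κ := by
  have hκ := h.superRamseyIf hb
  obtain ⟨θ, h⟩ := h.exists_setup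
  obtain ⟨M, N, j, S, -, -⟩ := h ∅ (ZFSet.empty_subset _)
  intro μ hμ
  -- The maximum with `ℵ₀` makes the reflected cardinal uncountable, as the passage from `Reflects`
  -- to `SuperRamseyIf` requires.
  obtain ⟨x, hx, hμx, hr⟩ := S.exists_reflects hκ (m := cardSet (max μ Cardinal.aleph0))
    (Ordinal.toZFSet_mem_toZFSet_iff.2 (Cardinal.ord_lt_ord.2 (max_lt hμ S.aleph0_lt)))
  obtain ⟨o, ho, rfl⟩ := Ordinal.mem_toZFSet_iff.1 hx
  have hoκ : o.card < κ := Cardinal.lt_ord.1 ho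
  have hκθ : κ < θ := Order.succ_le_iff.1 S.succ_le
  obtain ⟨n, hn⟩ := hr.1.exists_eq_cardSet S.regular' (hoκ.trans hκθ)
  rw [hn] at hx hμx hr
  have hnκ : n < κ := Cardinal.ord_lt_ord.1 (Ordinal.toZFSet_mem_toZFSet_iff.1 hx)
  have hμn : max μ Cardinal.aleph0 < n :=
    Cardinal.ord_lt_ord.1 (Ordinal.toZFSet_mem_toZFSet_iff.1 hμx)
  have hle : Order.succ n ≤ Order.succ κ := Order.succ_le_succ hnκ.le
  exact ⟨n, (le_max_left _ _).trans_lt hμn, hnκ, hr.superRamseyIf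
    ((le_max_right _ _).trans_lt hμn) (hle.trans S.succ_le)
    (mem_H_of_subset S.mem_H (H_subset_H hle))⟩

end RamseyLike

theorem proposition5p2 :
    (∀ κ : Cardinal.{u}, RamseyLike.AlphaRamsey κ κ →
      RamseyLike.SuperRamsey κ ∧ RamseyLike.IsLimitOf RamseyLike.SuperRamsey κ) ∧
    (∀ κ : Cardinal.{u}, RamseyLike.AlphaRamsey Cardinal.aleph0.{u} κ →
      RamseyLike.SuperWeaklyRamsey κ ∧
        RamseyLike.IsLimitOf RamseyLike.SuperWeaklyRamsey κ) := by
  refine ⟨fun κ h => ?_, fun κ h => ?_⟩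
  · have h1 := h.superRamseyIf (b := True) fun _ => rfl
    have h2 := h.isLimitOf_superRamseyIf (b := True) fun _ => rfl
    simp only [RamseyLike.IsLimitOf, RamseyLike.superRamseyIf_true] at h1 h2
    exact ⟨h1, h2⟩
  · have h1 := h.superRamseyIf (b := False) False.elim
    have h2 := h.isLimitOf_superRamseyIf (b := False) False.elim
    simp only [RamseyLike.IsLimitOf, RamseyLike.superRamseyIf_false] at h1 h2
    exact ⟨h1, h2⟩
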